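/- Let $G=(V,E)$ be a finite directed graph (parallel edges and loops allowed) with $q$ weight functions $w_1,\dots,w_q:E\to\mathbb R$, let $s\ne t$ be nodes and let $k\ge 1$ be an integer. Assume that every node is reachable from $s$, that $t$ is reachable from every node, and that $G$ has no negative cycle with respect to any $w_i$. For a walk $P$ put $c_i(P)=\sum_{e\in P}w_i(e)$, $w(e)=\sum_i w_i(e)$ and $c(P)=\sum_{e\in P}w(e)$; let $d_i$ and $d$ be the distances (least length of a walk) with respect to $w_i$ and $w$. An $s$–$t$ walk is all-criteria-shortest if, for each $i$, it minimizes $c_i$ among all $s$–$t$ walks, and $c$-shortest if it minimizes $c$. Call an edge $(u,v)$ tight if $d(s,u)+w(u,v)+d(v,t)=d(s,t)$. (1) The distances $d(s,x),d(x,t),d_i(s,x),d_i(x,t)$ ($x\in V$) are attained, and $d(s,t)\ge\sum_i d_i(s,t)$. Equality holds if and only if an all-criteria-shortest $s$–$t$ walk exists, and in this case the all-criteria-shortest $s$–$t$ walks are exactly the $c$-shortest ones. (2) A node $u$ lies on a $c$-shortest $s$–$t$ walk if and only if $d(s,u)+d(u,t)=d(s,t)$; an edge lies on a $c$-shortest $s$–$t$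 walk if and only if it is tight; and an $s$–$t$ walk is $c$-shortest if and only if all its edges are tight. (3) There are $k$ pairwise edge-disjoint $s$–$t$ walks that consist of tight edges if and only if the network of the tight edges with unit capacities has an $s$–$t$ flow of value at least $k$. (4) There is an algorithm for a random access machine (unit cost; addition, subtraction, comparison and array access on integers; only addition, subtraction and comparison on real weights) that decides whether there are $k$ pairwise edge-disjoint all-criteria-shortest $s$–$t$ walks and, if so, outputs $k$ pairwise edge-disjoint all-criteria-shortest $s$–$t$ paths (without repeated nodes). It consists of two stages. The first stage computes, from $G$ (given as a list of edges) and the weights, the numbers $w(e)$ for all $e\in E$, $d(s,x)$ and $d(x,t)$ for all $x\in V$, and $\sum_i d_i(s,t)$, in time $O((q+1)|V||E|)$. The second stage decides and finds the paths from these data in time $O(\min(k|E|,|E|^{3/2}))$. The implied constants are absolute. -/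

import Mathlib

namespace KDisjoint

/-! ## A uniform-cost RAM

Programs are structured programs over a random access memory that consists of integer registers,
integer arrays, real registers and real arrays (each kind indexed by `ℕ`; a given program mentions
only finitely many registers and arrays).  On integers the machine can add, subtract (truncated at
`0`), compare and address arrays; on reals it can only add, subtract and compare, and the only real
constant is `0`.  Every operation that is carried out costs one step. -/

/-- The contents of the memory. -/
structure Mem where
  /-- integer registers -/
  nv : ℕ → ℕ
  /-- integer arrays: `na a i` is the `i`-th cell of array `a` -/
  na : ℕ → ℕ → ℕ
  /-- real registers -/
  rv : ℕ → ℝ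
  /-- real arrays: `ra a i` is the `i`-th cell of array `a` -/
  ra : ℕ → ℕ → ℝ

/-- Integer expressions. -/
inductive NExpr where
  | const (c : ℕ)
  | reg (i : ℕ)
  | cell (a : ℕ) (idx : NExpr)
  | add (x y : NExpr)
  | sub (x y : NExpr)

/-- Real expressions. -/
inductive RExpr where
  | zero
  | reg (i : ℕ)
  | cell (a : ℕ) (idx : NExpr)
  | add (x y : RExpr)
  | sub (x y : RExpr)

/-- Tests. -/
inductive BExpr where
  | nle (x y : NExpr)
  | rle (x y : RExpr)
  | not (b : BExpr)
  | and (b c : BExpr)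

/-- Programs. -/
inductive Prog where
  | skip
  | nset (i : ℕ) (x : NExpr)
  | nput (a : ℕ) (idx x : NExpr)
  | rset (i : ℕ) (x : RExpr)
  | rput (a : ℕ) (idx : NExpr) (x : RExpr)
  | seq (p r : Prog)
  | ite (b : BExpr) (p r : Prog)
  | loop (b : BExpr) (p : Prog)

/-- The value of an integer expression. -/
def NExpr.eval (σ : Mem) : NExpr → ℕ
  | .const c => c
  | .reg i => σ.nv i
  | .cell a x => σ.na a (x.eval σ)
  | .add x y => x.eval σ + y.eval σ
  | .sub x y => x.eval σ - y.eval σ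

/-- The number of steps for evaluating an integer expression. -/
def NExpr.cost : NExpr → ℕ
  | .const _ => 1
  | .reg _ => 1
  | .cell _ x => x.cost + 1
  | .add x y => x.cost + y.cost + 1
  | .sub x y => x.cost + y.cost + 1

/-- The value of a real expression. -/
def RExpr.eval (σ : Mem) : RExpr → ℝ
  | .zero => 0
  | .reg i => σ.rv i
  | .cell a x => σ.ra a (x.eval σ)
  | .add x y => x.eval σ + y.eval σ
  | .sub x y => x.eval σ - y.eval σ

/-- The number of steps for evaluating a real expression. -/
def RExpr.cost : RExpr → ℕ
  | .zero => 1
  | .reg _ => 1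
  | .cell _ x => x.cost + 1
  | .add x y => x.cost + y.cost + 1
  | .sub x y => x.cost + y.cost + 1

/-- The truth of a test. -/
def BExpr.holds (σ : Mem) : BExpr → Prop
  | .nle x y => x.eval σ ≤ y.eval σ
  | .rle x y => x.eval σ ≤ y.eval σ
  | .not b => ¬ b.holds σ
  | .and b c => b.holds σ ∧ c.holds σ

/-- The number of steps for evaluating a test. -/
def BExpr.cost : BExpr → ℕ
  | .nle x y => x.cost + y.cost + 1
  | .rle x y => x.cost + y.cost + 1
  | .not b => b.cost + 1
  | .and b c => b.cost + c.cost + 1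

/-- Write an integer register. -/
def Mem.setN (σ : Mem) (i v : ℕ) : Mem :=
  { σ with nv := Function.update σ.nv i v }

/-- Write a cell of an integer array. -/
def Mem.putN (σ : Mem) (a i v : ℕ) : Mem :=
  { σ with na := Function.update σ.na a (Function.update (σ.na a) i v) }

/-- Write a real register. -/
def Mem.setR (σ : Mem) (i : ℕ) (v : ℝ) : Mem :=
  { σ with rv := Function.update σ.rv i v }

/-- Write a cell of a real array. -/
def Mem.putR (σ : Mem) (a i : ℕ) (v : ℝ) : Mem :=
  { σ with ra := Function.update σ.ra a (Function.update (σ.ra a) i v) }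

/-- `Exec p σ σ' c`: started in memory `σ`, program `p` halts after exactly `c` steps, with
memory `σ'`. -/
inductive Exec : Prog → Mem → Mem → ℕ → Prop
  | skip (σ : Mem) : Exec .skip σ σ 1
  | nset (σ : Mem) (i : ℕ) (x : NExpr) :
      Exec (.nset i x) σ (σ.setN i (x.eval σ)) (x.cost + 1)
  | nput (σ : Mem) (a : ℕ) (idx x : NExpr) :
      Exec (.nput a idx x) σ (σ.putN a (idx.eval σ) (x.eval σ)) (idx.cost + x.cost + 1)
  | rset (σ : Mem) (i : ℕ) (x : RExpr) :
      Exec (.rset i x) σ (σ.setR i (x.eval σ)) (x.cost + 1)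
  | rput (σ : Mem) (a : ℕ) (idx : NExpr) (x : RExpr) :
      Exec (.rput a idx x) σ (σ.putR a (idx.eval σ) (x.eval σ)) (idx.cost + x.cost + 1)
  | seq {p r : Prog} {σ σ₁ σ₂ : Mem} {c₁ c₂ : ℕ} (h₁ : Exec p σ σ₁ c₁) (h₂ : Exec r σ₁ σ₂ c₂) :
      Exec (.seq p r) σ σ₂ (c₁ + c₂)
  | ite_true {b : BExpr} {p r : Prog} {σ σ' : Mem} {c : ℕ} (hb : b.holds σ)
      (h : Exec p σ σ' c) : Exec (.ite b p r) σ σ' (b.cost + 1 + c)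
  | ite_false {b : BExpr} {p r : Prog} {σ σ' : Mem} {c : ℕ} (hb : ¬ b.holds σ)
      (h : Exec r σ σ' c) : Exec (.ite b p r) σ σ' (b.cost + 1 + c)
  | loop_false {b : BExpr} {p : Prog} {σ : Mem} (hb : ¬ b.holds σ) :
      Exec (.loop b p) σ σ (b.cost + 1)
  | loop_true {b : BExpr} {p : Prog} {σ σ₁ σ₂ : Mem} {c₁ c₂ : ℕ} (hb : b.holds σ)
      (h₁ : Exec p σ σ₁ c₁) (h₂ : Exec (.loop b p) σ₁ σ₂ c₂) :
      Exec (.loop b p) σ σ₂ (b.cost + 1 + c₁ + c₂)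

/-! ## Instances of the problem -/

/-- A directed graph with nodes `Fin n` and edges `Fin m` (parallel edges and loops are allowed),
`q` real weight functions on the edges, a source, a destination and a number of paths. -/
structure Instance where
  n : ℕ
  m : ℕ
  q : ℕ
  src : Fin m → Fin n
  tgt : Fin m → Fin n
  w : Fin q → Fin m → ℝ
  s : Fin n
  t : Fin n
  k : ℕ

namespace Instance

variable (I : Instance)

/-- The edge list `P` is a walk from `u` to `v`. -/
def IsWalk (u v : Fin I.n) : List (Fin I.m) → Prop
  | [] => u = v
  | e :: P => I.src e = u ∧ IsWalk (I.tgt e) v P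

/-- The nodes visited by a walk from `u` with edge list `P`. -/
def nodes (u : Fin I.n) (P : List (Fin I.m)) : List (Fin I.n) :=
  u :: P.map I.tgt

/-- The length of an edge list with respect to a weight function. -/
def len (c : Fin I.m → ℝ) (P : List (Fin I.m)) : ℝ :=
  (P.map c).sum

/-- The lengths of all walks from `u` to `v`. -/
def lengths (c : Fin I.m → ℝ) (u v : Fin I.n) : Set ℝ :=
  {x | ∃ P, I.IsWalk u v P ∧ I.len c P = x}

/-- The distance from `u` to `v`. -/
noncomputable def dist (c : Fin I.m → ℝ) (u v : Fin I.n) : ℝ :=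
  sInf (I.lengths c u v)

/-- `P` is a shortest walk from `u` to `v`. -/
def IsShortest (c : Fin I.m → ℝ) (u v : Fin I.n) (P : List (Fin I.m)) : Prop :=
  I.IsWalk u v P ∧ ∀ R, I.IsWalk u v R → I.len c P ≤ I.len c R

/-- The aggregated weight. -/
def agg (e : Fin I.m) : ℝ :=
  ∑ i, I.w i e

/-- `P` is a walk from `s` to `t` that is shortest with respect to each criterion. -/
def IsAllShortest (P : List (Fin I.m)) : Prop :=
  I.IsWalk I.s I.t P ∧ ∀ i, I.IsShortest (I.w i) I.s I.t P

/-- No walk of the family shares an edge with another one. -/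
def EdgeDisjoint (P : Fin I.k → List (Fin I.m)) : Prop :=
  ∀ i j, i ≠ j → List.Disjoint (P i) (P j)

/-- A family of `k` edge-disjoint all-criteria-shortest walks from `s` to `t`. -/
def IsSolution (P : Fin I.k → List (Fin I.m)) : Prop :=
  (∀ j, I.IsAllShortest (P j)) ∧ I.EdgeDisjoint P

/-- The standing assumptions: `s ≠ t`, `k ≥ 1`, each node is reachable from `s`, `t` is reachable
from each node, and there is no negative cycle with respect to any of the weight functions. -/
structure Admissible : Prop where
  s_ne_t : I.s ≠ I.t
  one_le_k : 1 ≤ I.k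
  from_s : ∀ v, ∃ P, I.IsWalk I.s v P
  to_t : ∀ v, ∃ P, I.IsWalk v I.t P
  no_neg_cycle : ∀ i v P, I.IsWalk v v P → 0 ≤ I.len (I.w i) P

/-- The edge `e = (u, v)` is tight: `d(s,u) + w(u,v) + d(v,t) = d(s,t)` for the aggregated
weight `w`. -/
def Tight (e : Fin I.m) : Prop :=
  I.dist I.agg I.s (I.src e) + I.agg e + I.dist I.agg (I.tgt e) I.t = I.dist I.agg I.s I.t

/-- A (real-valued) flow from `s` to `t` in the network that consists of the tight edges, with unit
capacities. -/
structure IsFlow (f : Fin I.m → ℝ) : Prop where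
  nonneg : ∀ e, 0 ≤ f e
  le_one : ∀ e, f e ≤ 1
  supp : ∀ e, ¬ I.Tight e → f e = 0
  conserve : ∀ v, v ≠ I.s → v ≠ I.t →
    ∑ e with I.tgt e = v, f e = ∑ e with I.src e = v, f e

/-- The value of a flow: the net flow out of `s`. -/
def flowValue (f : Fin I.m → ℝ) : ℝ :=
  (∑ e with I.src e = I.s, f e) - (∑ e with I.tgt e = I.s, f e)

/-! ## Representation in the memory -/

/-- The memory holds the instance: the edge list and the table of weights (the rest of the memory
is arbitrary). -/
structure Holds (σ : Mem) : Prop where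
  n_eq : σ.nv 0 = I.n
  m_eq : σ.nv 1 = I.m
  q_eq : σ.nv 2 = I.q
  s_eq : σ.nv 3 = I.s
  t_eq : σ.nv 4 = I.t
  k_eq : σ.nv 5 = I.k
  src_eq : ∀ e : Fin I.m, σ.na 0 e = I.src e
  tgt_eq : ∀ e : Fin I.m, σ.na 1 e = I.tgt e
  w_eq : ∀ (i : Fin I.q) (e : Fin I.m), σ.ra 0 ((i : ℕ) * I.m + (e : ℕ)) = I.w i e

/-- The memory holds the instance and the results of the distance computations: the aggregated
weights, the distances from `s` and to `t` for the aggregated weight, and the sum over all criteria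
of the distances from `s` to `t` (the rest of the memory is arbitrary). -/
structure HoldsDist (σ : Mem) : Prop extends I.Holds σ where
  agg_eq : ∀ e : Fin I.m, σ.ra 1 e = I.agg e
  from_eq : ∀ v : Fin I.n, σ.ra 2 v = I.dist I.agg I.s v
  to_eq : ∀ v : Fin I.n, σ.ra 3 v = I.dist I.agg v I.t
  sum_eq : σ.rv 0 = ∑ i, I.dist (I.w i) I.s I.t

/-- The edge lists `P 0, …, P (k-1)` are stored one after the other in integer array `3`, and
integer array `2` tells where each of them starts. -/
def Written (P : Fin I.k → List (Fin I.m)) (σ : Mem) : Prop :=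
  σ.na 2 0 = 0 ∧ ∀ j : Fin I.k, σ.na 2 ((j : ℕ) + 1) = σ.na 2 (j : ℕ) + (P j).length ∧
    ∀ l : Fin (P j).length, σ.na 3 (σ.na 2 (j : ℕ) + (l : ℕ)) = (P j).get l

/-- The memory holds a correct answer: either `1` and a solution, all of whose walks are simple
paths, or `0`, and there is no solution. -/
def Answered (σ : Mem) : Prop :=
  (σ.nv 6 = 1 ∧ ∃ P, I.IsSolution P ∧ (∀ j, (I.nodes I.s (P j)).Nodup) ∧ I.Written P σ) ∨
    (σ.nv 6 = 0 ∧ ¬ ∃ P, I.IsSolution P)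

end Instance

end KDisjoint

/-! Reduction to one weight. On every `s`–`t` walk each `c_i` is at least `d_i`, so `∑ d_i` bounds
`c` from below, and a walk meets the sum exactly when it meets each bound (`isAllShortest_iff_len`).
A walk of tight edges never leaves the nodes with `d(s,u) + d(u,t) = d(s,t)`, so its length
telescopes to `d(s,t)` (`len_of_tight`); conversely a shortest walk cannot lose anything at one of
its edges (`tight_of_mem`). Hence, if `d(s,t) = ∑ d_i(s,t)`, the walks to be found are the `s`–`t`
walks of tight edges. These edges may form cycles of weight zero, so no step relies on acyclicity.

Walks and flows. Edge-disjoint walks give a flow after shortcutting. The converse is not proved by a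
separate integrality theorem: the second stage always ends with `k` disjoint walks or with a cut of
fewer than `k` tight edges (`runs_pathsProg`), and such a cut excludes a flow of value `k`
(`IsFlow.value_le_cutCard`). Thus the hard direction follows from the correctness of the algorithm.

First stage. The distances come from `q + 2` runs of the Bellman–Ford algorithm, one of them on the
reversed graph.

Second stage. Dinic's algorithm maintains a 0/1 flow on the tight edges. A phase computes levels in
the residual graph by breadth-first search and then a blocking flow by depth-first search, in time
`O(m)`. Each phase raises the value (`Blocked.value_lt`) and the residual distance from `s` to `t`
(`Blocked.far`), so there are at most `k` phases. After `L = ⌊√m⌋ + 1` phases that distance is at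
least `L`; the `L` layers of residual edges around `s` are disjoint and `m < L²`, so some layer has
fewer than `L` edges (`exists_cut_of_far`) and fewer than `L` units of flow are missing. So `2L`
phases also suffice.

Paths. A walk from `s` along flow edges, each deleted when used, can only get stuck at `t`.
Following from each node the edge by which it was left for the last time gives a simple path, since
the times of these departures increase (`WalkState.step`, `OutState.step`). The cost is charged to
the deleted edges, so all paths together take time `O(m)`.

Time bounds are proved with a ghost potential that pays for the iterations of a loop
(`exists_exec_loop`). -/

namespace KDisjoint

/-! ## Reading the memory after a write -/

namespace Mem

variable (σ : Mem) (i j a b v : ℕ) (x : ℝ)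

@[simp] theorem setN_nv_same : (σ.setN i v).nv i = v := by simp [setN]
@[simp] theorem setN_nv_ne (h : j ≠ i) : (σ.setN i v).nv j = σ.nv j := by simp [setN, h]
@[simp] theorem setN_na : (σ.setN i v).na = σ.na := rfl
@[simp] theorem setN_rv : (σ.setN i v).rv = σ.rv := rfl
@[simp] theorem setN_ra : (σ.setN i v).ra = σ.ra := rfl

@[simp] theorem putN_nv : (σ.putN a i v).nv = σ.nv := rfl
@[simp] theorem putN_na_same : (σ.putN a i v).na a = Function.update (σ.na a) i v := by
  simp [putN]
@[simp] theorem putN_na_ne (h : b ≠ a) : (σ.putN a i v).na b = σ.na b := by simp [putN, h]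
@[simp] theorem putN_rv : (σ.putN a i v).rv = σ.rv := rfl
@[simp] theorem putN_ra : (σ.putN a i v).ra = σ.ra := rfl

@[simp] theorem setR_nv : (σ.setR i x).nv = σ.nv := rfl
@[simp] theorem setR_na : (σ.setR i x).na = σ.na := rfl
@[simp] theorem setR_rv_same : (σ.setR i x).rv i = x := by simp [setR]
@[simp] theorem setR_rv_ne (h : j ≠ i) : (σ.setR i x).rv j = σ.rv j := by simp [setR, h]
@[simp] theorem setR_ra : (σ.setR i x).ra = σ.ra := rfl

@[simp] theorem putR_nv : (σ.putR a i x).nv = σ.nv := rfl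
@[simp] theorem putR_na : (σ.putR a i x).na = σ.na := rfl
@[simp] theorem putR_rv : (σ.putR a i x).rv = σ.rv := rfl
@[simp] theorem putR_ra_same : (σ.putR a i x).ra a = Function.update (σ.ra a) i x := by
  simp [putR]
@[simp] theorem putR_ra_ne (h : b ≠ a) : (σ.putR a i x).ra b = σ.ra b := by simp [putR, h]

end Mem

/-! ## The parts of the memory that a program may write -/

/-- The integer registers that a program may write. -/
def Prog.nvW : Prog → List ℕ
  | .nset i _ => [i]
  | .seq p r => p.nvW ++ r.nvW
  | .ite _ p r => p.nvW ++ r.nvW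
  | .loop _ p => p.nvW
  | _ => []

/-- The integer arrays that a program may write. -/
def Prog.naW : Prog → List ℕ
  | .nput a _ _ => [a]
  | .seq p r => p.naW ++ r.naW
  | .ite _ p r => p.naW ++ r.naW
  | .loop _ p => p.naW
  | _ => []

/-- The real registers that a program may write. -/
def Prog.rvW : Prog → List ℕ
  | .rset i _ => [i]
  | .seq p r => p.rvW ++ r.rvW
  | .ite _ p r => p.rvW ++ r.rvW
  | .loop _ p => p.rvW
  | _ => []

/-- The real arrays that a program may write. -/
def Prog.raW : Prog → List ℕ
  | .rput a _ _ => [a]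
  | .seq p r => p.raW ++ r.raW
  | .ite _ p r => p.raW ++ r.raW
  | .loop _ p => p.raW
  | _ => []

/-- The memories `σ` and `σ'` agree wherever the program `p` does not write. -/
structure Agree (p : Prog) (σ σ' : Mem) : Prop where
  nv : ∀ i, i ∉ p.nvW → σ'.nv i = σ.nv i
  na : ∀ a, a ∉ p.naW → σ'.na a = σ.na a
  rv : ∀ i, i ∉ p.rvW → σ'.rv i = σ.rv i
  ra : ∀ a, a ∉ p.raW → σ'.ra a = σ.ra a

theorem Agree.refl (p : Prog) (σ : Mem) : Agree p σ σ :=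
  ⟨fun _ _ => rfl, fun _ _ => rfl, fun _ _ => rfl, fun _ _ => rfl⟩

theorem Agree.trans {p : Prog} {σ σ₁ σ₂ : Mem} (h : Agree p σ σ₁) (h' : Agree p σ₁ σ₂) :
    Agree p σ σ₂ :=
  ⟨fun i hi => (h'.nv i hi).trans (h.nv i hi), fun i hi => (h'.na i hi).trans (h.na i hi),
    fun i hi => (h'.rv i hi).trans (h.rv i hi), fun i hi => (h'.ra i hi).trans (h.ra i hi)⟩

theorem Agree.mono {p r : Prog} {σ σ' : Mem} (h : Agree p σ σ') (h₁ : p.nvW ⊆ r.nvW)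
    (h₂ : p.naW ⊆ r.naW) (h₃ : p.rvW ⊆ r.rvW) (h₄ : p.raW ⊆ r.raW) : Agree r σ σ' :=
  ⟨fun i hi => h.nv i (fun h => hi (h₁ h)), fun i hi => h.na i (fun h => hi (h₂ h)),
    fun i hi => h.rv i (fun h => hi (h₃ h)), fun i hi => h.ra i (fun h => hi (h₄ h))⟩

/-- The frame rule. The sets of written locations are syntactic, so for a concrete program
membership is settled by `decide` and all other data survive its run. -/
theorem Exec.agree {p : Prog} {σ σ' : Mem} {c : ℕ} (h : Exec p σ σ' c) : Agree p σ σ' := by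
  induction h with
  | skip σ => exact .refl _ _
  | nset σ i x =>
    refine ⟨fun j hj => ?_, fun _ _ => rfl, fun _ _ => rfl, fun _ _ => rfl⟩
    simp only [Prog.nvW, List.mem_singleton] at hj
    simp [hj]
  | nput σ a idx x =>
    refine ⟨fun _ _ => rfl, fun j hj => ?_, fun _ _ => rfl, fun _ _ => rfl⟩
    simp only [Prog.naW, List.mem_singleton] at hj
    simp [hj]
  | rset σ i x =>
    refine ⟨fun _ _ => rfl, fun _ _ => rfl, fun j hj => ?_, fun _ _ => rfl⟩
    simp only [Prog.rvW, List.mem_singleton] at hj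
    simp [hj]
  | rput σ a idx x =>
    refine ⟨fun _ _ => rfl, fun _ _ => rfl, fun _ _ => rfl, fun j hj => ?_⟩
    simp only [Prog.raW, List.mem_singleton] at hj
    simp [hj]
  | seq _ _ ih₁ ih₂ =>
    exact (ih₁.mono (by simp [Prog.nvW]) (by simp [Prog.naW]) (by simp [Prog.rvW])
      (by simp [Prog.raW])).trans (ih₂.mono (by simp [Prog.nvW]) (by simp [Prog.naW])
        (by simp [Prog.rvW]) (by simp [Prog.raW]))
  | ite_true _ _ ih =>
    exact ih.mono (by simp [Prog.nvW]) (by simp [Prog.naW]) (by simp [Prog.rvW])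
      (by simp [Prog.raW])
  | ite_false _ _ ih =>
    exact ih.mono (by simp [Prog.nvW]) (by simp [Prog.naW]) (by simp [Prog.rvW])
      (by simp [Prog.raW])
  | loop_false _ => exact .refl _ _
  | loop_true _ _ _ ih₁ ih₂ =>
    exact Agree.trans (ih₁.mono (fun _ h => h) (fun _ h => h) (fun _ h => h) (fun _ h => h)) ih₂

/-! ## Running programs within a time bound -/

/-- Started in memory `σ`, program `p` halts within `B` steps, in a memory that satisfies `Q`. -/
def Runs (p : Prog) (σ : Mem) (B : ℕ) (Q : Mem → Prop) : Prop :=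
  ∃ σ' c, Exec p σ σ' c ∧ c ≤ B ∧ Q σ'

theorem Runs.mono {p : Prog} {σ : Mem} {B B' : ℕ} {Q Q' : Mem → Prop} (h : Runs p σ B Q)
    (hB : B ≤ B') (hQ : ∀ σ', Agree p σ σ' → Q σ' → Q' σ') : Runs p σ B' Q' := by
  obtain ⟨σ', c, he, hc, hq⟩ := h
  exact ⟨σ', c, he, hc.trans hB, hQ σ' he.agree hq⟩

theorem Runs.imp {p : Prog} {σ : Mem} {B : ℕ} {Q Q' : Mem → Prop} (h : Runs p σ B Q)
    (hQ : ∀ σ', Agree p σ σ' → Q σ' → Q' σ') : Runs p σ B Q' :=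
  h.mono le_rfl hQ

theorem Runs.seq {p r : Prog} {σ : Mem} {B B' : ℕ} {Q R : Mem → Prop} (h : Runs p σ B Q)
    (h' : ∀ σ', Agree p σ σ' → Q σ' → Runs r σ' B' R) : Runs (.seq p r) σ (B + B') R := by
  obtain ⟨σ₁, c₁, he₁, hc₁, hq₁⟩ := h
  obtain ⟨σ₂, c₂, he₂, hc₂, hq₂⟩ := h' σ₁ he₁.agree hq₁
  exact ⟨σ₂, c₁ + c₂, .seq he₁ he₂, add_le_add hc₁ hc₂, hq₂⟩

theorem Runs.ite {b : BExpr} {p r : Prog} {σ : Mem} {B : ℕ} {Q : Mem → Prop}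
    (h₁ : b.holds σ → Runs p σ B Q) (h₂ : ¬ b.holds σ → Runs r σ B Q) :
    Runs (.ite b p r) σ (b.cost + 1 + B) Q := by
  by_cases hb : b.holds σ
  · obtain ⟨σ', c, he, hc, hq⟩ := h₁ hb
    exact ⟨σ', _, .ite_true hb he, by omega, hq⟩
  · obtain ⟨σ', c, he, hc, hq⟩ := h₂ hb
    exact ⟨σ', _, .ite_false hb he, by omega, hq⟩

/-! ### Loop-free programs: weakest preconditions and step bounds -/

/-- The weakest precondition of `Q` for a program without loops. -/
def Prog.wp : Prog → (Mem → Prop) → Mem → Prop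
  | .skip, Q, σ => Q σ
  | .nset i x, Q, σ => Q (σ.setN i (x.eval σ))
  | .nput a idx x, Q, σ => Q (σ.putN a (idx.eval σ) (x.eval σ))
  | .rset i x, Q, σ => Q (σ.setR i (x.eval σ))
  | .rput a idx x, Q, σ => Q (σ.putR a (idx.eval σ) (x.eval σ))
  | .seq p r, Q, σ => p.wp (r.wp Q) σ
  | .ite b p r, Q, σ => (b.holds σ → p.wp Q σ) ∧ (¬ b.holds σ → r.wp Q σ)
  | .loop _ _, _, _ => False

/-- A bound for the number of steps of a program without loops. -/
def Prog.bound : Prog → ℕ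
  | .skip => 1
  | .nset _ x => x.cost + 1
  | .nput _ idx x => idx.cost + x.cost + 1
  | .rset _ x => x.cost + 1
  | .rput _ idx x => idx.cost + x.cost + 1
  | .seq p r => p.bound + r.bound
  | .ite b p r => b.cost + 1 + (p.bound + r.bound)
  | .loop _ _ => 0

/-- The value of `bound` at a loop is irrelevant, because `wp` is `False` there. For a branch both
alternatives are added up, which is crude but still a constant. -/
theorem Runs.of_wp {p : Prog} {σ : Mem} {Q : Mem → Prop} (h : p.wp Q σ) :
    Runs p σ p.bound Q := by
  induction p generalizing σ Q with
  | skip => exact ⟨σ, 1, .skip σ, le_rfl, h⟩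
  | nset i x => exact ⟨_, _, .nset σ i x, le_rfl, h⟩
  | nput a idx x => exact ⟨_, _, .nput σ a idx x, le_rfl, h⟩
  | rset i x => exact ⟨_, _, .rset σ i x, le_rfl, h⟩
  | rput a idx x => exact ⟨_, _, .rput σ a idx x, le_rfl, h⟩
  | seq p r ihp ihr => exact (ihp h).seq fun σ' _ h' => ihr h'
  | ite b p r ihp ihr =>
    exact Runs.ite (fun hb => (ihp (h.1 hb)).mono (Nat.le_add_right _ _) fun _ _ h => h)
      fun hb => (ihr (h.2 hb)).mono (Nat.le_add_left _ _) fun _ _ h => h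
  | loop b p _ => exact h.elim

/-! ### Loops and amortized cost -/

/-- The rule for loops: the ghost number `n` decreases in each iteration, and pays for it. -/
theorem exists_exec_loop {b : BExpr} {p : Prog} {σ₀ : Mem} {B : ℕ} (Inv : ℕ → Mem → Prop)
    (hstep : ∀ n σ, Agree (.loop b p) σ₀ σ → Inv n σ → b.holds σ →
      ∃ σ' c n', Exec p σ σ' c ∧ n' < n ∧ c ≤ (n - n') * B ∧ Inv n' σ')
    (n : ℕ) (h₀ : Inv n σ₀) :
    ∃ σ' c n', Exec (.loop b p) σ₀ σ' c ∧ n' ≤ n ∧ c ≤ (n - n' + 1) * (B + b.cost + 1) ∧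
      Inv n' σ' ∧ ¬ b.holds σ' := by
  suffices H : ∀ n σ, Agree (.loop b p) σ₀ σ → Inv n σ →
      ∃ σ' c n', Exec (.loop b p) σ σ' c ∧ n' ≤ n ∧ c ≤ (n - n' + 1) * (B + b.cost + 1) ∧
        Inv n' σ' ∧ ¬ b.holds σ' from H n σ₀ (.refl _ _) h₀
  intro n
  induction n using Nat.strong_induction_on with
  | _ n ih =>
    intro σ hσ hinv
    by_cases hb : b.holds σ
    · obtain ⟨σ₁, c₁, n₁, he₁, hn₁, hc₁, hi₁⟩ := hstep n σ hσ hinv hb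
      have ha : Agree (.loop b p) σ₀ σ₁ :=
        hσ.trans (he₁.agree.mono (fun _ h => h) (fun _ h => h) (fun _ h => h) (fun _ h => h))
      obtain ⟨σ₂, c₂, n₂, he₂, hn₂, hc₂, hi₂, hb₂⟩ := ih n₁ hn₁ σ₁ ha hi₁
      refine ⟨σ₂, _, n₂, .loop_true hb he₁ he₂, by omega, ?_, hi₂, hb₂⟩
      -- The drop from `n` to `n₁` is at least one, so it also pays for the test of this iteration;
      -- the extra `1` in the bound pays for the final, failing test.
      have h1 : n - n₂ + 1 = (n - n₁) + (n₁ - n₂ + 1) := by omega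
      rw [h1, Nat.add_mul]
      have h2 : (n - n₁) * (B + b.cost + 1) = (n - n₁) * B + (n - n₁) * (b.cost + 1) := by ring
      have h3 : 1 * (b.cost + 1) ≤ (n - n₁) * (b.cost + 1) :=
        Nat.mul_le_mul_right _ (by omega)
      omega
    · refine ⟨σ, _, n, .loop_false hb, le_rfl, ?_, hinv, hb⟩
      simp

theorem Runs.loop {b : BExpr} {p : Prog} {σ₀ : Mem} {B : ℕ} (Inv : ℕ → Mem → Prop)
    (hstep : ∀ n σ, Agree (.loop b p) σ₀ σ → Inv n σ → b.holds σ →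
      Runs p σ B fun σ' => ∃ n' < n, Inv n' σ')
    (n : ℕ) (h₀ : Inv n σ₀) :
    Runs (.loop b p) σ₀ ((n + 1) * (B + b.cost + 1))
      fun σ' => (∃ n', Inv n' σ') ∧ ¬ b.holds σ' := by
  obtain ⟨σ', c, n', he, hn, hc, hi, hb⟩ := exists_exec_loop (B := B) Inv (fun n σ hσ hi hb => by
    obtain ⟨σ', c, he, hc, n', hn', hi'⟩ := hstep n σ hσ hi hb
    refine ⟨σ', c, n', he, hn', hc.trans ?_, hi'⟩
    exact Nat.le_mul_of_pos_left _ (by omega)) n h₀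
  exact ⟨σ', c, he, hc.trans (Nat.mul_le_mul_right _ (by omega)), ⟨n', hi⟩, hb⟩

/-- The test `x < y`. -/
abbrev BExpr.nlt (x y : NExpr) : BExpr := .not (.nle y x)

/-- The test `x = y` for integers. -/
abbrev BExpr.neq (x y : NExpr) : BExpr := .and (.nle x y) (.nle y x)

/-- Run `body` with the values `0, 1, …` of register `x` below the value of register `y`. -/
def Prog.for (x y : ℕ) (body : Prog) : Prog :=
  .seq (.nset x (.const 0)) (.loop (.nlt (.reg x) (.reg y))
    (.seq body (.nset x (.add (.reg x) (.const 1)))))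

/-- The ghost number is the number of iterations still to come. The overhead `11` consists of `4`
steps for the increment, `5` for the test, and `2` for the initialization, generously charged to
each round. -/
theorem Runs.for {x y : ℕ} {body : Prog} {σ₀ : Mem} {B : ℕ} (Inv : ℕ → Mem → Prop)
    (hxy : y ≠ x) (hx : x ∉ body.nvW) (hy : y ∉ body.nvW) (h₀ : Inv 0 (σ₀.setN x 0))
    (hstep : ∀ i σ, i < σ₀.nv y → Agree (.for x y body) σ₀ σ → σ.nv x = i → Inv i σ →
      Runs body σ B fun σ' => Inv (i + 1) (σ'.setN x (i + 1))) :
    Runs (.for x y body) σ₀ ((σ₀.nv y + 1) * (B + 11)) fun σ' => Inv (σ₀.nv y) σ' := by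
  have h1 : Runs (.nset x (.const 0)) σ₀ 2 (fun σ => σ = σ₀.setN x 0) :=
    Runs.of_wp (p := .nset x (.const 0)) rfl
  refine (h1.seq (B' := (σ₀.nv y + 1) * ((B + 4) + (BExpr.nlt (.reg x) (.reg y)).cost + 1))
    fun σ₁ _ hσ₁ => ?_).mono ?_ fun _ _ h => h
  · subst hσ₁
    refine (Runs.loop (B := B + 4) (fun n σ => n ≤ σ₀.nv y ∧ σ.nv y = σ₀.nv y ∧
      σ.nv x = σ₀.nv y - n ∧ Inv (σ₀.nv y - n) σ) ?_ (σ₀.nv y) ?_).imp ?_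
    · rintro n σ hσ ⟨hn, hy', hx', hi⟩ hb
      simp only [BExpr.holds, NExpr.eval] at hb
      have ha : Agree (.for x y body) σ₀ σ := by
        refine Agree.trans (σ₁ := σ₀.setN x 0) ?_ (hσ.mono ?_ ?_ ?_ ?_)
        · refine ⟨fun i hi => ?_, fun _ _ => rfl, fun _ _ => rfl, fun _ _ => rfl⟩
          simp only [Prog.for, Prog.nvW, List.mem_append, List.mem_singleton] at hi
          have : i ≠ x := fun h => hi (.inl h)
          simp [this]
        all_goals simp [Prog.for, Prog.nvW, Prog.naW, Prog.rvW, Prog.raW]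
      refine (hstep _ σ (by omega) ha hx' hi).seq (B' := 4) fun σ₁ ha₁ hi₁ => ?_
      refine Runs.of_wp (p := .nset x (.add (.reg x) (.const 1))) ?_
      have e1 : σ₁.nv x = σ₀.nv y - n := (ha₁.nv x hx).trans hx'
      have e2 : σ₁.nv y = σ₀.nv y := (ha₁.nv y hy).trans hy'
      have e3 : σ₀.nv y - n + 1 = σ₀.nv y - (n - 1) := by omega
      refine ⟨n - 1, by omega, by omega, ?_, ?_, ?_⟩
      · simp [hxy, e2]
      · simp [NExpr.eval, e1, e3]
      · simpa [NExpr.eval, e1, e3] using hi₁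
    · simp [hxy, h₀]
    · rintro σ - ⟨⟨n, hn, hy', hx', hi⟩, hb⟩
      simp only [BExpr.holds, NExpr.eval, not_not] at hb
      have : σ₀.nv y - n = σ₀.nv y := by omega
      rwa [this] at hi
  · simp only [BExpr.cost, NExpr.cost]
    ring_nf
    omega

/-- The rule for `for` with a body without loops. -/
theorem Runs.for_wp {x y : ℕ} {body : Prog} {σ₀ : Mem} (Inv : ℕ → Mem → Prop)
    (hxy : y ≠ x) (hx : x ∉ body.nvW) (hy : y ∉ body.nvW)
    (h₀ : Inv 0 (σ₀.setN x 0))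
    (hstep : ∀ i σ, i < σ₀.nv y → Agree (.for x y body) σ₀ σ → σ.nv x = i → Inv i σ →
      body.wp (fun σ' => Inv (i + 1) (σ'.setN x (i + 1))) σ) :
    Runs (.for x y body) σ₀ ((σ₀.nv y + 1) * (body.bound + 11)) fun σ' => Inv (σ₀.nv y) σ' :=
  .for Inv hxy hx hy h₀ fun i σ hi ha hx hinv => .of_wp (hstep i σ hi ha hx hinv)

namespace Instance

/-! ## Walks -/

section Walks

variable {I : Instance} {u v x : Fin I.n} {P R : List (Fin I.m)} {c : Fin I.m → ℝ}

@[simp] theorem isWalk_nil : I.IsWalk u v [] ↔ u = v := Iff.rfl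

@[simp] theorem isWalk_cons {e : Fin I.m} :
    I.IsWalk u v (e :: P) ↔ I.src e = u ∧ I.IsWalk (I.tgt e) v P := Iff.rfl

theorem isWalk_append : I.IsWalk u v (P ++ R) ↔ ∃ x, I.IsWalk u x P ∧ I.IsWalk x v R := by
  induction P generalizing u with
  | nil => simp
  | cons e P ih => simp [ih, and_assoc]

theorem isWalk_concat {e : Fin I.m} :
    I.IsWalk u v (P ++ [e]) ↔ I.IsWalk u (I.src e) P ∧ I.tgt e = v := by
  rw [isWalk_append]
  constructor
  · rintro ⟨x, h, rfl, h'⟩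
    exact ⟨h, h'⟩
  · rintro ⟨h, h'⟩
    exact ⟨_, h, rfl, h'⟩

@[simp] theorem len_nil : I.len c [] = 0 := rfl

@[simp] theorem len_cons {e : Fin I.m} : I.len c (e :: P) = c e + I.len c P := by simp [len]

@[simp] theorem len_append : I.len c (P ++ R) = I.len c P + I.len c R := by simp [len]

theorem len_agg : I.len I.agg P = ∑ i, I.len (I.w i) P := by
  induction P with
  | nil => simp
  | cons e P ih => simp [ih, agg, Finset.sum_add_distrib]

/-- A walk is split at a node that it visits. -/
theorem IsWalk.split (h : I.IsWalk u v P) (hx : x ∈ I.nodes u P) :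
    ∃ X Z, P = X ++ Z ∧ I.IsWalk u x X ∧ I.IsWalk x v Z ∧ I.nodes x Z <:+ I.nodes u P := by
  induction P generalizing u with
  | nil =>
    obtain rfl : x = u := by simpa [nodes] using hx
    exact ⟨[], [], rfl, rfl, h, List.suffix_rfl⟩
  | cons e P ih =>
    by_cases hu : x = u
    · subst hu
      exact ⟨[], e :: P, rfl, rfl, h, List.suffix_rfl⟩
    · obtain ⟨X, Z, rfl, h₁, h₂, h₃⟩ := ih h.2 (by simpa [nodes, hu] using hx)
      exact ⟨e :: X, Z, rfl, ⟨h.1, h₁⟩, h₂, h₃.trans (List.suffix_cons _ _)⟩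

/-- Each walk contains a walk without repeated nodes that is not longer. -/
theorem IsWalk.exists_nodup (hc : ∀ v P, I.IsWalk v v P → 0 ≤ I.len c P) (h : I.IsWalk u v P) :
    ∃ R, I.IsWalk u v R ∧ R ⊆ P ∧ (I.nodes u R).Nodup ∧ I.len c R ≤ I.len c P := by
  induction P generalizing u with
  | nil => exact ⟨[], h, by simp, by simp [nodes], le_rfl⟩
  | cons e P ih =>
    obtain ⟨R, hR, hs, hn, hl⟩ := ih h.2
    by_cases hu : u ∈ I.nodes (I.tgt e) R
    · obtain ⟨X, Z, rfl, h₁, h₂, h₃⟩ := hR.split hu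
      refine ⟨Z, h₂, ?_, hn.sublist h₃.sublist, ?_⟩
      · exact fun a ha => List.mem_cons_of_mem _ (hs (List.mem_append_right X ha))
      -- The part that is cut off, `e :: X`, is a closed walk at `u`, so dropping it does not
      -- increase the length.
      · have := hc u (e :: X) ⟨h.1, h₁⟩
        simp only [len_append, len_cons] at this hl ⊢
        linarith
    · refine ⟨e :: R, ⟨h.1, hR⟩, List.cons_subset_cons _ hs, List.nodup_cons.2 ⟨hu, hn⟩, ?_⟩
      simpa using hl

theorem length_lt_of_nodup (h : (I.nodes u P).Nodup) : P.length < I.n := by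
  have := h.length_le_card
  simpa [nodes] using this

theorem nodup_of_nodes (h : (I.nodes u P).Nodup) : P.Nodup :=
  List.Nodup.of_map I.tgt (List.nodup_cons.1 h).2

/-- For a walk, the visited nodes are the tails of its edges and the last node. -/
theorem IsWalk.nodes_eq (h : I.IsWalk u v P) : I.nodes u P = P.map I.src ++ [v] := by
  induction P generalizing u with
  | nil => simpa [nodes] using h
  | cons e P ih =>
    obtain ⟨rfl, h⟩ := h
    simpa [nodes] using ih h

/-! ## Distances -/

/-- Without negative cycles, distances are attained by walks without repeated nodes. -/
theorem exists_dist_walk (hc : ∀ v P, I.IsWalk v v P → 0 ≤ I.len c P) (h : ∃ P, I.IsWalk u v P) :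
    ∃ P, I.IsWalk u v P ∧ ∀ R, I.IsWalk u v R → I.len c P ≤ I.len c R := by
  obtain ⟨P₀, h₀⟩ := h
  obtain ⟨R₀, hR₀, -, hn₀, -⟩ := h₀.exists_nodup hc
  -- Simple walks have fewer than `n` edges, so the minimum may be taken over a finite set of walks.
  have hfin : {P : List (Fin I.m) | I.IsWalk u v P ∧ P.length ≤ I.n}.Finite :=
    (List.finite_length_le (Fin I.m) I.n).subset fun P hP => hP.2
  obtain ⟨P, hP, hmin⟩ := Set.exists_min_image _ (I.len c) hfin
    ⟨R₀, hR₀, (length_lt_of_nodup hn₀).le⟩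
  refine ⟨P, hP.1, fun R hR => ?_⟩
  obtain ⟨R', hR', -, hn', hl⟩ := hR.exists_nodup hc
  exact (hmin R' ⟨hR', (length_lt_of_nodup hn').le⟩).trans hl

theorem isLeast_dist (hc : ∀ v P, I.IsWalk v v P → 0 ≤ I.len c P) (h : ∃ P, I.IsWalk u v P) :
    IsLeast (I.lengths c u v) (I.dist c u v) := by
  obtain ⟨P, hP, hmin⟩ := exists_dist_walk hc h
  have : IsLeast (I.lengths c u v) (I.len c P) := by
    refine ⟨⟨P, hP, rfl⟩, ?_⟩
    rintro _ ⟨R, hR, rfl⟩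
    exact hmin R hR
  rwa [dist, this.csInf_eq]

theorem isShortest_iff (h : IsLeast (I.lengths c u v) (I.dist c u v)) :
    I.IsShortest c u v P ↔ I.IsWalk u v P ∧ I.len c P = I.dist c u v := by
  constructor
  · rintro ⟨hP, hmin⟩
    obtain ⟨R, hR, hl⟩ := h.1
    exact ⟨hP, le_antisymm (hl ▸ hmin R hR) (h.2 ⟨P, hP, rfl⟩)⟩
  · rintro ⟨hP, hl⟩
    exact ⟨hP, fun R hR => hl ▸ h.2 ⟨R, hR, rfl⟩⟩

end Walks

/-! ## Reversal -/

/-- The instance with all edges reversed. -/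
abbrev rev (I : Instance) : Instance :=
  { I with src := I.tgt, tgt := I.src, s := I.t, t := I.s }

theorem isWalk_rev (I : Instance) {u v : Fin I.n} {P : List (Fin I.m)} :
    I.rev.IsWalk u v P.reverse ↔ I.IsWalk v u P := by
  induction P generalizing v with
  | nil => exact eq_comm
  | cons e P ih =>
    rw [List.reverse_cons]
    refine isWalk_concat.trans ?_
    rw [isWalk_cons, and_comm]
    exact and_congr Iff.rfl ih

theorem lengths_rev (I : Instance) (c : Fin I.m → ℝ) (u v : Fin I.n) :
    I.rev.lengths c u v = I.lengths c v u := by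
  ext x
  constructor
  · rintro ⟨P, hP, rfl⟩
    refine ⟨P.reverse, I.isWalk_rev.1 (by rwa [List.reverse_reverse]), ?_⟩
    simp [len, List.sum_reverse]
  · rintro ⟨P, hP, rfl⟩
    refine ⟨P.reverse, I.isWalk_rev.2 hP, ?_⟩
    simp [len, List.sum_reverse]

theorem dist_rev (I : Instance) (c : Fin I.m → ℝ) (u v : Fin I.n) :
    I.rev.dist c u v = I.dist c v u := by
  simp only [dist, lengths_rev]

/-! ## Consequences of the standing assumptions -/

namespace Admissible

variable {I : Instance} (hI : I.Admissible)

include hI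

theorem no_neg_cycle_agg (v : Fin I.n) (P : List (Fin I.m)) (h : I.IsWalk v v P) :
    0 ≤ I.len I.agg P := by
  rw [len_agg]
  exact Finset.sum_nonneg fun i _ => hI.no_neg_cycle i v P h

theorem isLeast_from (v : Fin I.n) : IsLeast (I.lengths I.agg I.s v) (I.dist I.agg I.s v) :=
  isLeast_dist hI.no_neg_cycle_agg (hI.from_s v)

theorem isLeast_to (v : Fin I.n) : IsLeast (I.lengths I.agg v I.t) (I.dist I.agg v I.t) :=
  isLeast_dist hI.no_neg_cycle_agg (hI.to_t v)

theorem isLeast_from_criterion (i : Fin I.q) (v : Fin I.n) :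
    IsLeast (I.lengths (I.w i) I.s v) (I.dist (I.w i) I.s v) :=
  isLeast_dist (hI.no_neg_cycle i) (hI.from_s v)

theorem isLeast_to_criterion (i : Fin I.q) (v : Fin I.n) :
    IsLeast (I.lengths (I.w i) v I.t) (I.dist (I.w i) v I.t) :=
  isLeast_dist (hI.no_neg_cycle i) (hI.to_t v)

theorem sum_dist_le_len {P : List (Fin I.m)} (hP : I.IsWalk I.s I.t P) :
    ∑ i, I.dist (I.w i) I.s I.t ≤ I.len I.agg P := by
  rw [len_agg]
  exact Finset.sum_le_sum fun i _ => (hI.isLeast_from_criterion i I.t).2 ⟨P, hP, rfl⟩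

theorem sum_dist_le : ∑ i, I.dist (I.w i) I.s I.t ≤ I.dist I.agg I.s I.t := by
  obtain ⟨P, hP, hl⟩ := (hI.isLeast_from I.t).1
  exact hl ▸ hI.sum_dist_le_len hP

/-- Termwise inequalities between two finite sums are all equalities as soon as the sums agree. -/
theorem isAllShortest_iff_len {P : List (Fin I.m)} :
    I.IsAllShortest P ↔ I.IsWalk I.s I.t P ∧ I.len I.agg P = ∑ i, I.dist (I.w i) I.s I.t := by
  refine and_congr_right fun hP => ?_
  have hle : ∀ i ∈ Finset.univ, I.dist (I.w i) I.s I.t ≤ I.len (I.w i) P :=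
    fun i _ => (hI.isLeast_from_criterion i I.t).2 ⟨P, hP, rfl⟩
  rw [len_agg, eq_comm, Finset.sum_eq_sum_iff_of_le hle]
  refine forall_congr' fun i => ?_
  rw [isShortest_iff (hI.isLeast_from_criterion i I.t)]
  simp [hP, eq_comm]

theorem dist_eq_sum_iff :
    I.dist I.agg I.s I.t = ∑ i, I.dist (I.w i) I.s I.t ↔ ∃ P, I.IsAllShortest P := by
  constructor
  · intro h
    obtain ⟨P, hP, hl⟩ := (hI.isLeast_from I.t).1
    exact ⟨P, hI.isAllShortest_iff_len.2 ⟨hP, hl.trans h⟩⟩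
  · rintro ⟨P, hP⟩
    rw [hI.isAllShortest_iff_len] at hP
    exact le_antisymm (hP.2 ▸ (hI.isLeast_from I.t).2 ⟨P, hP.1, rfl⟩) hI.sum_dist_le

theorem isAllShortest_iff (h : I.dist I.agg I.s I.t = ∑ i, I.dist (I.w i) I.s I.t)
    (P : List (Fin I.m)) : I.IsAllShortest P ↔ I.IsShortest I.agg I.s I.t P := by
  rw [hI.isAllShortest_iff_len, isShortest_iff (hI.isLeast_from I.t), h]

theorem dist_s_s : I.dist I.agg I.s I.s = 0 := by
  obtain ⟨P, hP, hl⟩ := (hI.isLeast_from I.s).1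
  exact le_antisymm ((hI.isLeast_from I.s).2 ⟨[], rfl, rfl⟩)
    (hl ▸ hI.no_neg_cycle_agg _ P hP)

theorem dist_triangle (u : Fin I.n) :
    I.dist I.agg I.s I.t ≤ I.dist I.agg I.s u + I.dist I.agg u I.t := by
  obtain ⟨P, hP, hl⟩ := (hI.isLeast_from u).1
  obtain ⟨R, hR, hl'⟩ := (hI.isLeast_to u).1
  rw [← hl, ← hl', ← len_append]
  exact (hI.isLeast_from I.t).2 ⟨_, isWalk_append.2 ⟨u, hP, hR⟩, rfl⟩

theorem dist_tgt_le (e : Fin I.m) :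
    I.dist I.agg I.s (I.tgt e) ≤ I.dist I.agg I.s (I.src e) + I.agg e := by
  obtain ⟨P, hP, hl⟩ := (hI.isLeast_from (I.src e)).1
  refine (hI.isLeast_from _).2 ⟨P ++ [e], isWalk_concat.2 ⟨hP, rfl⟩, ?_⟩
  simp [hl]

theorem node_iff (u : Fin I.n) :
    (∃ P, I.IsShortest I.agg I.s I.t P ∧ u ∈ I.nodes I.s P) ↔
      I.dist I.agg I.s u + I.dist I.agg u I.t = I.dist I.agg I.s I.t := by
  constructor
  · rintro ⟨P, hP, hu⟩
    rw [isShortest_iff (hI.isLeast_from I.t)] at hP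
    obtain ⟨X, Z, rfl, h₁, h₂, -⟩ := hP.1.split hu
    refine le_antisymm ?_ (hI.dist_triangle u)
    rw [← hP.2, len_append]
    exact add_le_add ((hI.isLeast_from u).2 ⟨X, h₁, rfl⟩) ((hI.isLeast_to u).2 ⟨Z, h₂, rfl⟩)
  · intro h
    obtain ⟨P, hP, hl⟩ := (hI.isLeast_from u).1
    obtain ⟨R, hR, hl'⟩ := (hI.isLeast_to u).1
    refine ⟨P ++ R, ?_, ?_⟩
    · rw [isShortest_iff (hI.isLeast_from I.t)]
      exact ⟨isWalk_append.2 ⟨u, hP, hR⟩, by rw [len_append, hl, hl', h]⟩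
    · have : u ∈ I.nodes I.s P := by rw [hP.nodes_eq]; simp
      simp only [nodes, List.map_append, List.mem_cons, List.mem_append] at this ⊢
      tauto

/-- The parts of `P` before and after `e` are at least as long as the respective distances, which
gives one inequality. The other one is the triangle inequality through the edge. -/
theorem tight_of_mem {P : List (Fin I.m)} (hP : I.IsShortest I.agg I.s I.t P) {e : Fin I.m}
    (he : e ∈ P) : I.Tight e := by
  rw [isShortest_iff (hI.isLeast_from I.t)] at hP
  obtain ⟨X, Z, rfl⟩ := List.append_of_mem he
  obtain ⟨x, h₁, rfl, h₂⟩ := isWalk_append.1 hP.1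
  have h1 := (hI.isLeast_from (I.src e)).2 ⟨X, h₁, rfl⟩
  have h2 := (hI.isLeast_to (I.tgt e)).2 ⟨Z, h₂, rfl⟩
  have h3 := hI.dist_triangle (I.tgt e)
  have h4 := hI.dist_tgt_le e
  have h5 := hP.2
  simp only [len_append, len_cons] at h5
  simp only [Tight]
  linarith

/-- The condition on `u` has to be carried along: together with tightness and `dist_tgt_le` it
passes to the head of the first edge, and `d(·,t)` drops by the weight of that edge. -/
theorem len_of_tight {u : Fin I.n} {P : List (Fin I.m)} (hP : I.IsWalk u I.t P)
    (hu : I.dist I.agg I.s u + I.dist I.agg u I.t = I.dist I.agg I.s I.t)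
    (ht : ∀ e ∈ P, I.Tight e) : I.len I.agg P = I.dist I.agg u I.t := by
  induction P generalizing u with
  | nil =>
    obtain rfl : u = I.t := hP
    simp only [len_nil]
    linarith
  | cons e P ih =>
    obtain ⟨rfl, hP⟩ := hP
    have h1 : I.Tight e := ht e (by simp)
    have h2 := hI.dist_triangle (I.tgt e)
    have h3 := hI.dist_tgt_le e
    simp only [Tight] at h1
    have h4 := ih hP (by linarith) fun e he => ht e (List.mem_cons_of_mem _ he)
    rw [len_cons, h4]
    linarith

theorem isShortest_iff_tight {P : List (Fin I.m)} (hP : I.IsWalk I.s I.t P) :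
    I.IsShortest I.agg I.s I.t P ↔ ∀ e ∈ P, I.Tight e := by
  refine ⟨fun h e he => hI.tight_of_mem h he, fun h => ?_⟩
  rw [isShortest_iff (hI.isLeast_from I.t)]
  exact ⟨hP, hI.len_of_tight hP (by rw [hI.dist_s_s, zero_add]) h⟩

theorem edge_iff (e : Fin I.m) : (∃ P, I.IsShortest I.agg I.s I.t P ∧ e ∈ P) ↔ I.Tight e := by
  refine ⟨fun ⟨P, hP, he⟩ => hI.tight_of_mem hP he, fun h => ?_⟩
  obtain ⟨P, hP, hl⟩ := (hI.isLeast_from (I.src e)).1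
  obtain ⟨R, hR, hl'⟩ := (hI.isLeast_to (I.tgt e)).1
  refine ⟨P ++ e :: R, ?_, by simp⟩
  rw [isShortest_iff (hI.isLeast_from I.t)]
  refine ⟨isWalk_append.2 ⟨_, hP, rfl, hR⟩, ?_⟩
  rw [len_append, len_cons, hl, hl', ← add_assoc]
  exact h

theorem exists_tgt_eq {v : Fin I.n} (hv : v ≠ I.s) : ∃ e, I.tgt e = v := by
  obtain ⟨P, hP⟩ := hI.from_s v
  rcases List.eq_nil_or_concat P with rfl | ⟨R, e, rfl⟩
  · exact absurd hP.symm hv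
  · rw [List.concat_eq_append, isWalk_concat] at hP
    exact ⟨e, hP.2⟩

theorem one_le_m : 1 ≤ I.m := by
  obtain ⟨e, -⟩ := hI.exists_tgt_eq hI.s_ne_t.symm
  exact e.pos

/-- Every node except `s` is reachable and hence the head of an edge, so `n - 1 ≤ m`. This turns
bounds in `n + m` into bounds in `m`. -/
theorem n_le : I.n ≤ 2 * I.m := by
  have h : Finset.univ.erase I.s ⊆ Finset.univ.image I.tgt := by
    intro v hv
    obtain ⟨e, he⟩ := hI.exists_tgt_eq (Finset.ne_of_mem_erase hv)
    exact Finset.mem_image.2 ⟨e, Finset.mem_univ _, he⟩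
  have h1 := Finset.card_le_card h
  have h2 : (Finset.univ.image I.tgt).card ≤ I.m := by
    simpa using Finset.card_image_le (s := Finset.univ) (f := I.tgt)
  rw [Finset.card_erase_of_mem (Finset.mem_univ _), Finset.card_univ, Fintype.card_fin] at h1
  have := hI.one_le_m
  omega

end Admissible

end Instance

namespace Instance

open Classical in
/-- The set of the edges that satisfy `p`. -/
noncomputable def edgesWhere (I : Instance) (p : Fin I.m → Prop) : Finset (Fin I.m) :=
  Finset.univ.filter p

@[simp] theorem mem_edgesWhere {I : Instance} {p : Fin I.m → Prop} {e : Fin I.m} :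
    e ∈ I.edgesWhere p ↔ p e := by
  simp [edgesWhere]

theorem card_edgesWhere_le (I : Instance) (p : Fin I.m → Prop) : (I.edgesWhere p).card ≤ I.m := by
  simpa using Finset.card_le_univ (I.edgesWhere p)

/-! ## Net flows and cuts -/

section Net

variable {R : Type*} [AddCommGroup R] (I : Instance)

/-- The net flow out of a node. -/
def net (f : Fin I.m → R) (x : Fin I.n) : R :=
  (∑ e with I.src e = x, f e) - ∑ e with I.tgt e = x, f e

variable {I}

theorem net_eq_sum (f : Fin I.m → R) (x : Fin I.n) :
    I.net f x = ∑ e, ((if I.src e = x then f e else 0) - if I.tgt e = x then f e else 0) := by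
  rw [net, Finset.sum_filter, Finset.sum_filter, Finset.sum_sub_distrib]

theorem net_add (f g : Fin I.m → R) (x : Fin I.n) :
    I.net (fun e => f e + g e) x = I.net f x + I.net g x := by
  simp only [net, Finset.sum_add_distrib]
  abel

theorem net_zero (x : Fin I.n) : I.net (fun _ => (0 : R)) x = 0 := by simp [net]

theorem net_sum {ι : Type*} (s : Finset ι) (f : ι → Fin I.m → R) (x : Fin I.n) :
    I.net (fun e => ∑ i ∈ s, f i e) x = ∑ i ∈ s, I.net (f i) x := by
  classical
  induction s using Finset.induction_on with
  | empty => simp [net_zero]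
  | insert i s hi ih => simp only [Finset.sum_insert hi, net_add, ih]

theorem net_single (e : Fin I.m) (c : R) (x : Fin I.n) :
    I.net (fun e' => if e' = e then c else 0) x =
      (if I.src e = x then c else 0) - if I.tgt e = x then c else 0 := by
  rw [net_eq_sum, Finset.sum_eq_single e]
  · simp
  · intro b _ hb; simp [hb]
  · simp

/-- In this form edges with both ends in `S` visibly cancel, and only those crossing the boundary of
`S` contribute. -/
theorem sum_net (f : Fin I.m → R) (S : Finset (Fin I.n)) :
    ∑ x ∈ S, I.net f x =
      ∑ e, ((if I.src e ∈ S then f e else 0) - if I.tgt e ∈ S then f e else 0) := by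
  simp only [net_eq_sum]
  rw [Finset.sum_comm]
  simp [Finset.sum_sub_distrib]

end Net

variable {I : Instance}

/-- The number of tight edges that leave a set of nodes. -/
noncomputable def cutCard (I : Instance) (S : Finset (Fin I.n)) : ℕ :=
  (I.edgesWhere fun e => I.Tight e ∧ I.src e ∈ S ∧ I.tgt e ∉ S).card

/-- Weak duality: by conservation the value is the net flow out of `S`, to which a tight edge
leaving `S` contributes at most `1` and any other edge at most `0`. -/
theorem IsFlow.value_le_cutCard {f : Fin I.m → ℝ} (hf : I.IsFlow f) {S : Finset (Fin I.n)}
    (hs : I.s ∈ S) (ht : I.t ∉ S) : I.flowValue f ≤ I.cutCard S := by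
  classical
  have h1 : I.flowValue f = ∑ x ∈ S, I.net f x := by
    rw [Finset.sum_eq_single I.s]
    · rfl
    · intro x hx hxs
      have := hf.conserve x hxs fun h => ht (h ▸ hx)
      simp [net, this]
    · exact fun h => absurd hs h
  rw [h1, sum_net, cutCard, edgesWhere, Finset.card_filter, Nat.cast_sum]
  refine Finset.sum_le_sum fun e _ => ?_
  have h2 := hf.nonneg e
  have h3 := hf.le_one e
  by_cases hT : I.Tight e
  · by_cases h4 : I.src e ∈ S <;> by_cases h5 : I.tgt e ∈ S <;> simp [hT, h4, h5, h2, h3]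
  · simp [hT, hf.supp e hT]

/-! ## Flows along walks -/

theorem net_count {u v : Fin I.n} {P : List (Fin I.m)} (h : I.IsWalk u v P) (x : Fin I.n) :
    I.net (fun e => (P.count e : ℝ)) x = (if u = x then 1 else 0) - if v = x then 1 else 0 := by
  induction P generalizing u with
  | nil =>
    obtain rfl : u = v := h
    simp [net_zero]
  | cons e P ih =>
    obtain ⟨rfl, h⟩ := h
    have : (fun e' => ((e :: P).count e' : ℝ)) =
        fun e' => (P.count e' : ℝ) + if e' = e then 1 else 0 := by
      ext e'
      by_cases h : e' = e
      · subst h; simp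
      · simp [h, Ne.symm h]
    rw [this, net_add, ih h, net_single]
    ring

/-- Edge-disjoint walks give a flow. -/
theorem exists_flow_of_walks (hst : I.s ≠ I.t) {P : Fin I.k → List (Fin I.m)}
    (hP : ∀ j, I.IsWalk I.s I.t (P j) ∧ ∀ e ∈ P j, I.Tight e) (hd : I.EdgeDisjoint P) :
    ∃ f, I.IsFlow f ∧ (I.k : ℝ) ≤ I.flowValue f := by
  have hR : ∀ j, ∃ R, I.IsWalk I.s I.t R ∧ R ⊆ P j ∧ R.Nodup := by
    intro j
    -- A walk may repeat an edge, which would violate the capacity. It is replaced by a simple walk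
    -- on the same edges; with weight zero there is no condition on cycles.
    obtain ⟨R, h₁, h₂, h₃, -⟩ := (hP j).1.exists_nodup (c := fun _ => 0) (by simp [len])
    exact ⟨R, h₁, h₂, nodup_of_nodes h₃⟩
  choose R hR₁ hR₂ hR₃ using hR
  have hnet : ∀ x, I.net (fun e => ∑ j, ((R j).count e : ℝ)) x =
      ∑ _j : Fin I.k, ((if I.s = x then 1 else 0) - if I.t = x then 1 else 0 : ℝ) := fun x => by
    rw [net_sum]
    exact Finset.sum_congr rfl fun j _ => net_count (hR₁ j) x
  refine ⟨fun e => ∑ j, ((R j).count e : ℝ), ⟨fun e => ?_, fun e => ?_, fun e he => ?_,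
    fun v hs ht => ?_⟩, ?_⟩
  · positivity
  · by_cases h : ∃ j, e ∈ R j
    · obtain ⟨j, hj⟩ := h
      rw [Finset.sum_eq_single j]
      · exact_mod_cast List.nodup_iff_count_le_one.1 (hR₃ j) e
      · intro i _ hij
        have : e ∉ R i := fun hi => hd i j hij (hR₂ i hi) (hR₂ j hj)
        simp [List.count_eq_zero_of_not_mem this]
      · simp
    · push Not at h
      simp [List.count_eq_zero_of_not_mem (h _)]
  · refine Finset.sum_eq_zero fun j _ => ?_
    have : e ∉ R j := fun h => he ((hP j).2 e (hR₂ j h))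
    simp [List.count_eq_zero_of_not_mem this]
  · have := hnet v
    simp only [Ne.symm hs, Ne.symm ht, net] at this
    simp only [if_false, sub_self, Finset.sum_const_zero] at this
    linarith
  · have := hnet I.s
    simp only [net, Ne.symm hst] at this
    simp [flowValue, this]

/-! ## Integral flows and residual graphs -/

/-- The residual graph: the edges with flow are reversed. -/
abbrev resid (I : Instance) (f : ℕ → ℕ) : Instance :=
  { I with
    src := fun e => if f e = 0 then I.src e else I.tgt e
    tgt := fun e => if f e = 0 then I.tgt e else I.src e }

theorem resid_src_congr {f f' : ℕ → ℕ} {e : Fin I.m} (h : f e = f' e) :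
    (I.resid f).src e = (I.resid f').src e ∧ (I.resid f).tgt e = (I.resid f').tgt e := by
  simp [h]

theorem resid_src_swap {f f' : ℕ → ℕ} {e : Fin I.m} (h : f e ≠ f' e) (h₁ : f e ≤ 1)
    (h₂ : f' e ≤ 1) :
    (I.resid f).src e = (I.resid f').tgt e ∧ (I.resid f).tgt e = (I.resid f').src e := by
  have : f e = 0 ∧ f' e = 1 ∨ f e = 1 ∧ f' e = 0 := by omega
  rcases this with ⟨h, h'⟩ | ⟨h, h'⟩ <;> simp [h, h']

/-- `f` takes the values `0` and `1` on the edges, and `1` only on tight edges. -/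
structure IsUnit (I : Instance) (f : ℕ → ℕ) : Prop where
  le_one : ∀ e : Fin I.m, f e ≤ 1
  supp : ∀ e : Fin I.m, f e ≠ 0 → I.Tight e

/-- The net flow out of `x` is that of a flow of value `v` from `s` to `t`. -/
def HasValue (I : Instance) (f : ℕ → ℕ) (v : ℕ) : Prop :=
  ∀ x, I.net (fun e => (f e : ℤ)) x =
    (if I.s = x then (v : ℤ) else 0) - if I.t = x then (v : ℤ) else 0

theorem IsUnit.toggle {f : ℕ → ℕ} (hf : I.IsUnit f) {e : Fin I.m} (he : I.Tight e) :
    I.IsUnit (Function.update f e (1 - f e)) := by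
  refine ⟨fun e' => ?_, fun e' h => ?_⟩ <;> by_cases h' : e' = e
  · subst h'; simp
  · rw [Function.update_of_ne (by simpa [Fin.val_inj] using h')]
    exact hf.le_one e'
  · exact h' ▸ he
  · rw [Function.update_of_ne (by simpa [Fin.val_inj] using h')] at h
    exact hf.supp e' h

/-- Toggling changes the flow on `e` by `1 - 2 f(e) = ±1`, which is one unit sent along `e` in its
residual direction. -/
theorem net_toggle {f : ℕ → ℕ} (e : Fin I.m) (he : f e ≤ 1) (x : Fin I.n) :
    I.net (fun e' => (Function.update f e (1 - f e) e' : ℤ)) x =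
      I.net (fun e' => (f e' : ℤ)) x + (if (I.resid f).src e = x then 1 else 0) -
        if (I.resid f).tgt e = x then 1 else 0 := by
  have : (fun e' : Fin I.m => (Function.update f e (1 - f e) e' : ℤ)) =
      fun e' : Fin I.m => (f e' : ℤ) + if e' = e then (1 - 2 * f e : ℤ) else 0 := by
    ext e'
    by_cases h : e' = e
    · subst h
      simp only [Function.update_self, if_true]
      omega
    · rw [Function.update_of_ne (by simpa [Fin.val_inj] using h)]
      simp [h]
  rw [this, net_add, net_single]
  have : f e = 0 ∨ f e = 1 := by omega
  rcases this with h | h <;> simp only [h] <;> split_ifs <;> simp_all [sub_eq_add_neg]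

/-- Compared edge by edge. An edge leaving `S` is counted either in the flow or as a residual edge.
An edge entering `S` with flow is a residual edge that leaves `S`, and it cancels its contribution
`-1` to the value. -/
theorem cutCard_eq {f : ℕ → ℕ} (hf : I.IsUnit f) {v : ℕ} (hv : I.HasValue f v)
    {S : Finset (Fin I.n)} (hs : I.s ∈ S) (ht : I.t ∉ S) :
    I.cutCard S = v + (I.edgesWhere fun e => I.Tight e ∧ (I.resid f).src e ∈ S ∧
      (I.resid f).tgt e ∉ S).card := by
  classical
  have h1 : (v : ℤ) = ∑ x ∈ S, I.net (fun e => (f e : ℤ)) x := by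
    rw [Finset.sum_eq_single I.s]
    · have : I.t ≠ I.s := fun h => ht (h ▸ hs)
      simp [hv I.s, this]
    · intro x hx hxs
      have : I.t ≠ x := fun h => ht (h ▸ hx)
      simp [hv x, this, Ne.symm hxs]
    · exact fun h => absurd hs h
  zify
  rw [h1, sum_net, cutCard, edgesWhere, Finset.card_filter, edgesWhere, Finset.card_filter]
  push_cast
  rw [← Finset.sum_add_distrib]
  refine Finset.sum_congr rfl fun e _ => ?_
  have h2 := hf.le_one e
  have h3 := hf.supp e
  have h4 : f e = 0 ∨ f e = 1 := by omega
  by_cases hT : I.Tight e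
  · rcases h4 with h4 | h4 <;> by_cases h5 : I.src e ∈ S <;> by_cases h6 : I.tgt e ∈ S <;>
      simp [hT, h4, h5, h6]
  · have h7 : f e = 0 := by by_contra h; exact hT (h3 h)
    simp [hT, h7]

theorem value_le_cutCard {f : ℕ → ℕ} (hf : I.IsUnit f) {v : ℕ} (hv : I.HasValue f v)
    {S : Finset (Fin I.n)} (hs : I.s ∈ S) (ht : I.t ∉ S) : v ≤ I.cutCard S :=
  cutCard_eq hf hv hs ht ▸ Nat.le_add_right _ _

/-- If the destination is far from the source in the residual graph, then the flow is almost
maximal. -/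
theorem exists_cut_of_far {f : ℕ → ℕ} (hf : I.IsUnit f) {v : ℕ} (hv : I.HasValue f v) {L : ℕ}
    (hL : I.m < L * L)
    (hfar : ∀ P, (I.resid f).IsWalk I.s I.t P → (∀ e ∈ P, I.Tight e) → L ≤ P.length) :
    ∃ S, I.s ∈ S ∧ I.t ∉ S ∧ I.cutCard S < v + L := by
  classical
  by_contra! hcon
  -- `S i` is the ball of radius `i` around `s` in the residual graph, and `D i` the set of residual
  -- edges that leave it. If all these cuts were large, the `L` sets `D 0, …, D (L - 1)` would have
  -- at least `L` edges each.
  let S : ℕ → Finset (Fin I.n) := fun i => Finset.univ.filter fun x =>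
    ∃ P, (I.resid f).IsWalk I.s x P ∧ (∀ e ∈ P, I.Tight e) ∧ P.length ≤ i
  let D : ℕ → Finset (Fin I.m) := fun i => I.edgesWhere fun e =>
    I.Tight e ∧ (I.resid f).src e ∈ S i ∧ (I.resid f).tgt e ∉ S i
  have hS : ∀ {i j}, i ≤ j → S i ⊆ S j := by
    intro i j hij x hx
    simp only [S, Finset.mem_filter, Finset.mem_univ, true_and] at hx ⊢
    obtain ⟨P, h₁, h₂, h₃⟩ := hx
    exact ⟨P, h₁, h₂, h₃.trans hij⟩
  have hnext : ∀ i, ∀ e ∈ D i, (I.resid f).tgt e ∈ S (i + 1) := by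
    intro i e he
    simp only [D, S, mem_edgesWhere, Finset.mem_filter, Finset.mem_univ, true_and] at he ⊢
    obtain ⟨hT, ⟨P, h₁, h₂, h₃⟩, -⟩ := he
    refine ⟨P ++ [e], isWalk_concat.2 ⟨h₁, rfl⟩, ?_, by simpa using h₃⟩
    intro e' he'
    rcases List.mem_append.1 he' with h | h
    · exact h₂ e' h
    · rw [List.mem_singleton.1 h]
      exact hT
  -- The head of an edge of `D i` already lies in the next ball, so the edge leaves no larger ball.
  have hlt : ∀ i j, i < j → Disjoint (D i) (D j) := by
    intro i j hij
    refine Finset.disjoint_left.2 fun e hi hj => ?_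
    exact (mem_edgesWhere.1 hj).2.2 (hS hij (hnext i e hi))
  have hdis : ∀ i ∈ Finset.range L, ∀ j ∈ Finset.range L, i ≠ j → Disjoint (D i) (D j) := by
    intro i _ j _ hij
    rcases lt_or_gt_of_ne hij with h | h
    · exact hlt i j h
    · exact (hlt j i h).symm
  have hcard : ∀ i ∈ Finset.range L, L ≤ (D i).card := by
    intro i hi
    have hs : I.s ∈ S i := by
      simp only [S, Finset.mem_filter, Finset.mem_univ, true_and]
      exact ⟨[], rfl, by simp, by simp⟩
    have ht : I.t ∉ S i := by
      simp only [S, Finset.mem_filter, Finset.mem_univ, true_and]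
      rintro ⟨P, h₁, h₂, h₃⟩
      have := hfar P h₁ h₂
      have := Finset.mem_range.1 hi
      omega
    have h1 := hcon (S i) hs ht
    rw [cutCard_eq hf hv hs ht] at h1
    exact Nat.le_of_add_le_add_left h1
  have h1 : ((Finset.range L).biUnion D).card ≤ I.m := by
    simpa using Finset.card_le_univ ((Finset.range L).biUnion D)
  rw [Finset.card_biUnion hdis] at h1
  have h2 := Finset.card_nsmul_le_sum _ _ _ hcard
  simp only [Finset.card_range, smul_eq_mul] at h2
  omega

/-- After a blocking flow, the destination is farther from the source than before. `lev` are the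
levels before (`0` for nodes that are not reachable), and the edges where `f` and `f'` differ go
to the next level. -/
theorem le_length_of_blocking {f f' : ℕ → ℕ} (hf : I.IsUnit f) (hf' : I.IsUnit f')
    {lev : Fin I.n → ℕ} (hs : lev I.s = 1)
    (hlev : ∀ e, I.Tight e → lev ((I.resid f).src e) ≠ 0 →
      lev ((I.resid f).tgt e) ≠ 0 ∧ lev ((I.resid f).tgt e) ≤ lev ((I.resid f).src e) + 1)
    (hflip : ∀ e : Fin I.m, f' e ≠ f e → lev ((I.resid f).src e) ≠ 0 ∧
      lev ((I.resid f).tgt e) = lev ((I.resid f).src e) + 1)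
    {X : Set (Fin I.n)} (hsX : I.s ∈ X) (htX : I.t ∉ X)
    (hX : ∀ e, I.Tight e → f' e = f e → (I.resid f).src e ∈ X →
      lev ((I.resid f).tgt e) = lev ((I.resid f).src e) + 1 → (I.resid f).tgt e ∈ X)
    {P : List (Fin I.m)} (hP : (I.resid f').IsWalk I.s I.t P) (hT : ∀ e ∈ P, I.Tight e) :
    lev I.t ≤ P.length := by
  -- An unchanged edge climbs at most one level, and a changed edge is now reversed and descends
  -- one. So the level (which starts at `1`) is at most the number of steps plus one, and equality
  -- forces every step to be an unchanged climbing edge, which keeps the walk in `X`. Since `t` is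
  -- not in `X`, one step is lost.
  suffices H : ∀ P v, (I.resid f').IsWalk I.s v P → (∀ e ∈ P, I.Tight e) →
      lev v ≠ 0 ∧ lev v ≤ P.length + 1 ∧ (lev v = P.length + 1 → v ∈ X) by
    obtain ⟨-, h2, h3⟩ := H P I.t hP hT
    by_contra hlt
    exact htX (h3 (by omega))
  intro P
  induction P using List.reverseRecOn with
  | nil =>
    rintro v rfl -
    exact ⟨by omega, by simp [hs], fun _ => hsX⟩
  | append_singleton P e ih =>
    intro v hv hT
    obtain ⟨hv', rfl⟩ := isWalk_concat.1 hv
    have hTe : I.Tight e := hT e (by simp)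
    obtain ⟨h1, h2, h3⟩ := ih _ hv' fun e he => hT e (List.mem_append_left _ he)
    rw [List.length_append, List.length_singleton]
    by_cases h : f' e = f e
    · obtain ⟨e1, e2⟩ := resid_src_congr (I := I) h
      rw [e1] at h1 h2 h3
      rw [e2]
      obtain ⟨h4, h5⟩ := hlev e hTe h1
      exact ⟨h4, by omega, fun h6 => hX e hTe h (h3 (by omega)) (by omega)⟩
    · obtain ⟨e1, e2⟩ := resid_src_swap (I := I) h (hf'.le_one e) (hf.le_one e)
      rw [e1] at h1 h2 h3
      rw [e2]
      obtain ⟨h4, h5⟩ := hflip e h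
      exact ⟨h4, by omega, fun h6 => by omega⟩

/-- A set of nodes that no residual edge leaves is a minimum cut. -/
theorem cutCard_eq_value {f : ℕ → ℕ} (hf : I.IsUnit f) {v : ℕ} (hv : I.HasValue f v)
    {S : Finset (Fin I.n)} (hs : I.s ∈ S) (ht : I.t ∉ S)
    (hS : ∀ e, I.Tight e → (I.resid f).src e ∈ S → (I.resid f).tgt e ∈ S) :
    I.cutCard S = v := by
  rw [cutCard_eq hf hv hs ht, Nat.add_eq_left, Finset.card_eq_zero,
    Finset.eq_empty_iff_forall_notMem]
  intro e he
  obtain ⟨h1, h2, h3⟩ := mem_edgesWhere.1 he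
  exact h3 (hS e h1 h2)

end Instance

/-! ## The distance computations

Integer registers `7` to `12` and integer array `4` are used as working memory. -/

/-- Compute the aggregated weights. -/
def aggProg : Prog :=
  .seq (.for 8 1 (.rput 1 (.reg 8) .zero)) <| .seq (.nset 9 (.const 0)) <|
    .for 7 2 <| .seq
      (.for 8 1 (.rput 1 (.reg 8) (.add (.cell 1 (.reg 8)) (.cell 0 (.add (.reg 9) (.reg 8))))))
      (.nset 9 (.add (.reg 9) (.reg 1)))

/-- Relax the edge with the number in register `8`. The tails and heads of the edges are in the
integer arrays `sa` and `ta`, their weights are in real array `wa` from the index in register `off`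
on, and the tentative distances are in real array `oa`. Integer array `4` tells which nodes have
been reached. -/
def relaxProg (sa ta wa off oa : ℕ) : Prog :=
  .ite (.nle (.const 1) (.cell 4 (.cell sa (.reg 8))))
    (.ite (.and (.nle (.const 1) (.cell 4 (.cell ta (.reg 8))))
        (.rle (.cell oa (.cell ta (.reg 8)))
          (.add (.cell oa (.cell sa (.reg 8))) (.cell wa (.add (.reg off) (.reg 8))))))
      .skip
      (.seq (.rput oa (.cell ta (.reg 8))
          (.add (.cell oa (.cell sa (.reg 8))) (.cell wa (.add (.reg off) (.reg 8)))))
        (.nput 4 (.cell ta (.reg 8)) (.const 1))))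
    .skip

/-- The algorithm of Bellman and Ford, started at the node in register `root`. -/
def bellmanFord (sa ta wa off root oa : ℕ) : Prog :=
  .seq (.for 11 0 (.nput 4 (.reg 11) (.const 0))) <| .seq
    (.seq (.nput 4 (.reg root) (.const 1)) (.rput oa (.reg root) .zero)) <|
    .for 10 0 (.for 8 1 (relaxProg sa ta wa off oa))

/-- The first stage of the algorithm. -/
def distancesProg : Prog :=
  .seq aggProg <| .seq (.nset 12 (.const 0)) <| .seq (bellmanFord 0 1 1 12 3 2) <|
    .seq (bellmanFord 1 0 1 12 4 3) <| .seq (.seq (.rset 0 .zero) (.nset 9 (.const 0))) <|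
    .for 7 2 <| .seq (bellmanFord 0 1 0 9 3 4) <|
      .seq (.rset 0 (.add (.reg 0) (.cell 4 (.reg 4)))) (.nset 9 (.add (.reg 9) (.reg 1)))

namespace Instance

theorem Holds.congr {I : Instance} {σ σ' : Mem} (h : I.Holds σ)
    (hnv : ∀ i ≤ 5, σ'.nv i = σ.nv i) (h₀ : σ'.na 0 = σ.na 0) (h₁ : σ'.na 1 = σ.na 1)
    (hr : σ'.ra 0 = σ.ra 0) : I.Holds σ' where
  n_eq := (hnv 0 (by omega)).trans h.n_eq
  m_eq := (hnv 1 (by omega)).trans h.m_eq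
  q_eq := (hnv 2 (by omega)).trans h.q_eq
  s_eq := (hnv 3 (by omega)).trans h.s_eq
  t_eq := (hnv 4 (by omega)).trans h.t_eq
  k_eq := (hnv 5 (by omega)).trans h.k_eq
  src_eq e := by rw [h₀, h.src_eq]
  tgt_eq e := by rw [h₁, h.tgt_eq]
  w_eq i e := by rw [hr, h.w_eq]

theorem Holds.of_agree {I : Instance} {p : Prog} {σ σ' : Mem} (h : I.Holds σ) (ha : Agree p σ σ')
    (hnv : ∀ i ≤ 5, i ∉ p.nvW) (h₀ : 0 ∉ p.naW) (h₁ : 1 ∉ p.naW) (hr : 0 ∉ p.raW) : I.Holds σ' :=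
  h.congr (fun i hi => ha.nv i (hnv i hi)) (ha.na 0 h₀) (ha.na 1 h₁) (ha.ra 0 hr)

/-! ### Aggregated weights -/

theorem runs_aggProg {I : Instance} {σ : Mem} (h : I.Holds σ) :
    Runs aggProg σ (100 * ((I.q + 1) * (I.m + 1))) fun σ' => ∀ e : Fin I.m, σ'.ra 1 e = I.agg e := by
  have hm := h.m_eq
  have hq := h.q_eq
  have h1 : Runs (.for 8 1 (.rput 1 (.reg 8) .zero)) σ ((I.m + 1) * (3 + 11))
      (fun σ' => ∀ e : Fin I.m, (e : ℕ) < I.m → σ'.ra 1 e = 0) := by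
    have := Runs.for_wp (x := 8) (y := 1) (body := .rput 1 (.reg 8) .zero) (σ₀ := σ)
      (fun i σ' => ∀ e : Fin I.m, (e : ℕ) < i → σ'.ra 1 e = 0) (by decide) (by decide)
      (by decide) (by simp) (by
        intro i σ' hi _ hx hinv e he
        simp only [NExpr.eval, RExpr.eval, Mem.setN_ra, Mem.putR_ra_same, hx]
        by_cases hei : (e : ℕ) = i
        · simp [hei]
        · rw [Function.update_of_ne hei]
          exact hinv e (by omega))
    rw [hm] at this
    exact this
  refine (h1.seq (B' := 2 + (I.q + 1) * ((I.m + 1) * (9 + 11) + 4 + 11))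
    fun σ₁ ha₁ hz => ?_).mono ?_ fun _ _ h => h
  · refine Runs.seq (Q := fun σ₂ => σ₂ = σ₁.setN 9 0) (B := 2) (Runs.of_wp (p := .nset 9 _) rfl)
      fun σ₂ _ hσ₂ => ?_
    have hh₂ : I.Holds σ₂ := by
      refine (h.of_agree ha₁ (by decide) (by decide) (by decide) (by decide)).congr ?_ ?_ ?_ ?_
      all_goals subst hσ₂; try rfl
      intro i hi
      rw [Mem.setN_nv_ne _ _ _ _ (by omega)]
    have hz₂ : ∀ e : Fin I.m, σ₂.ra 1 e = 0 := fun e => by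
      subst hσ₂
      exact hz e e.2
    have h9 : σ₂.nv 9 = 0 := by subst hσ₂; simp
    clear hσ₂
    -- Register `9` holds the offset `i * m` of row `i` of the weight table; it is updated by
    -- addition, as the machine cannot multiply.
    have key := Runs.for (x := 7) (y := 2) (σ₀ := σ₂) (B := (I.m + 1) * (9 + 11) + 4)
      (body := .seq (.for 8 1 (.rput 1 (.reg 8)
        (.add (.cell 1 (.reg 8)) (.cell 0 (.add (.reg 9) (.reg 8))))))
        (.nset 9 (.add (.reg 9) (.reg 1))))
      (fun i σ' => σ'.nv 9 = i * I.m ∧ ∀ e : Fin I.m, σ'.ra 1 e =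
        ∑ i' : Fin I.q, if (i' : ℕ) < i then I.w i' e else 0) (by decide) (by decide) (by decide)
      (by simp [h9, hz₂]) (by
        rintro i σ₃ hi ha hx ⟨h9', hs⟩
        rw [hh₂.q_eq] at hi
        have hh₃ : I.Holds σ₃ := hh₂.of_agree ha (by decide) (by decide) (by decide) (by decide)
        have hin := Runs.for_wp (x := 8) (y := 1) (body := .rput 1 (.reg 8)
            (.add (.cell 1 (.reg 8)) (.cell 0 (.add (.reg 9) (.reg 8))))) (σ₀ := σ₃)
          (fun l σ' => ∀ e : Fin I.m, σ'.ra 1 e =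
            σ₃.ra 1 e + if (e : ℕ) < l then I.w ⟨i, hi⟩ e else 0) (by decide) (by decide)
          (by decide) (by simp) (by
            intro l σ' hl ha' hx' hinv e
            rw [hh₃.m_eq] at hl
            have e1 : σ'.nv 9 = i * I.m := (ha'.nv 9 (by decide)).trans h9'
            have e2 : σ'.ra 0 = σ₃.ra 0 := ha'.ra 0 (by decide)
            simp only [NExpr.eval, RExpr.eval, Mem.setN_ra, Mem.putR_ra_same, hx', e1, e2]
            by_cases hel : (e : ℕ) = l
            · subst hel
              have := hh₃.w_eq ⟨i, hi⟩ e
              simp only at this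
              simp [this, hinv e]
            · rw [Function.update_of_ne hel, hinv e]
              have : (e : ℕ) < l + 1 ↔ (e : ℕ) < l := by omega
              simp [this])
        rw [hh₃.m_eq] at hin
        refine hin.seq (B' := 4) fun σ₄ ha₄ hi₄ =>
          Runs.of_wp (p := .nset 9 (.add (.reg 9) (.reg 1))) ?_
        have e1 : σ₄.nv 9 = i * I.m := (ha₄.nv 9 (by decide)).trans h9'
        have e2 : σ₄.nv 1 = I.m := (ha₄.nv 1 (by decide)).trans hh₃.m_eq
        refine ⟨?_, fun e => ?_⟩
        · simp [NExpr.eval, e1, e2]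
          ring
        · simp only [Mem.setN_ra, hi₄, hs, Fin.is_lt, if_true]
          have : ∀ i' : Fin I.q, (if (i' : ℕ) < i + 1 then I.w i' e else 0) =
              (if (i' : ℕ) < i then I.w i' e else 0) + if i' = ⟨i, hi⟩ then I.w i' e else 0 := by
            intro i'
            rcases lt_trichotomy (i' : ℕ) i with h | h | h
            · have h' : i' ≠ ⟨i, hi⟩ := fun h' => by simp [h'] at h
              simp [h, h', Nat.lt_succ_of_lt h]
            · have h' : i' = ⟨i, hi⟩ := Fin.ext h
              simp [h']
            · have h' : i' ≠ ⟨i, hi⟩ := fun h' => by simp [h'] at h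
              have h1 : ¬ (i' : ℕ) < i + 1 := by omega
              have h2 : ¬ (i' : ℕ) < i := by omega
              simp [h', h1, h2]
          simp only [this, Finset.sum_add_distrib]
          simp)
    rw [hh₂.q_eq] at key
    refine key.imp fun σ' _ hσ' e => ?_
    rw [hσ'.2 e]
    simp [agg]
  · ring_nf
    omega

/-! ### The algorithm of Bellman and Ford -/

/-- The state of the algorithm of Bellman and Ford after `r` rounds, when `i` edges have been
relaxed in the current round. -/
structure BFState (J : Instance) (c : Fin J.m → ℝ) (flag : ℕ → ℕ) (D : ℕ → ℝ) (r i : ℕ) :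
    Prop where
  sound : ∀ v : Fin J.n, flag v ≠ 0 → D v ∈ J.lengths c J.s v
  round : ∀ (v : Fin J.n) P, J.IsWalk J.s v P → P.length ≤ r → flag v ≠ 0 ∧ D v ≤ J.len c P
  part : ∀ e : Fin J.m, (e : ℕ) < i → ∀ P, J.IsWalk J.s (J.src e) P → P.length ≤ r →
    flag (J.tgt e) ≠ 0 ∧ D (J.tgt e) ≤ J.len c P + c e

namespace BFState

variable {J : Instance} {c : Fin J.m → ℝ} {flag : ℕ → ℕ} {D : ℕ → ℝ} {r : ℕ}

/-- Relaxation works in place, so tentative distances may be better than those of walks with `r`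
edges. Only upper bounds are maintained besides soundness, and these survive since tentative
distances never increase. -/
theorem of_mono {e : Fin J.m} (h : J.BFState c flag D r e) {flag' : ℕ → ℕ} {D' : ℕ → ℝ}
    (hs : ∀ v : Fin J.n, flag' v ≠ 0 → D' v ∈ J.lengths c J.s v)
    (hmono : ∀ v : Fin J.n, flag v ≠ 0 → flag' v ≠ 0 ∧ D' v ≤ D v)
    (he : flag (J.src e) ≠ 0 → flag' (J.tgt e) ≠ 0 ∧ D' (J.tgt e) ≤ D (J.src e) + c e) :
    J.BFState c flag' D' r (e + 1) := by
  refine ⟨hs, fun v P hP hl => ?_, fun e' he' P hP hl => ?_⟩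
  · obtain ⟨h1, h2⟩ := h.round v P hP hl
    obtain ⟨h3, h4⟩ := hmono v h1
    exact ⟨h3, h4.trans h2⟩
  · by_cases hee : e' = e
    · subst hee
      obtain ⟨h1, h2⟩ := h.round _ P hP hl
      obtain ⟨h3, h4⟩ := he h1
      exact ⟨h3, by linarith⟩
    · have : (e' : ℕ) ≠ e := fun h => hee (Fin.ext h)
      obtain ⟨h1, h2⟩ := h.part e' (by omega) P hP hl
      obtain ⟨h3, h4⟩ := hmono _ h1
      exact ⟨h3, h4.trans h2⟩

/-- A walk with `r + 1` edges is a walk with `r` edges followed by an edge that was relaxed in this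
round. -/
theorem next_round (h : J.BFState c flag D r J.m) : J.BFState c flag D (r + 1) 0 := by
  refine ⟨h.sound, fun v P hP hl => ?_, fun e he => by omega⟩
  rcases List.eq_nil_or_concat P with rfl | ⟨R, e, rfl⟩
  · exact h.round v [] hP (by simp)
  · rw [List.concat_eq_append] at hP hl ⊢
    obtain ⟨hR, rfl⟩ := isWalk_concat.1 hP
    have := h.part e e.2 R hR (by simpa using hl)
    simpa using this

/-- After `n` rounds all simple walks are taken into account, and one of them is shortest. Soundness
gives the other inequality. -/
theorem eq_dist (hc : ∀ v P, J.IsWalk v v P → 0 ≤ J.len c P) (hr : ∀ v, ∃ P, J.IsWalk J.s v P)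
    (h : J.BFState c flag D J.n 0) (v : Fin J.n) : D v = J.dist c J.s v := by
  have hl := isLeast_dist hc (hr v)
  obtain ⟨P, hP⟩ := hr v
  obtain ⟨P', hP', -, hn', -⟩ := hP.exists_nodup hc
  have h1 := h.sound v (h.round v P' hP' (length_lt_of_nodup hn').le).1
  refine le_antisymm ?_ (hl.2 h1)
  obtain ⟨R, hR, hRl⟩ := hl.1
  obtain ⟨R', hR', -, hn, hl'⟩ := hR.exists_nodup hc
  exact (h.round v R' hR' (length_lt_of_nodup hn).le).2.trans (hRl ▸ hl')

end BFState

/-- The arrays are parameters so that exchanging tails and heads gives distances to `t`, and an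
offset selects a single criterion. The inequalities and exclusions keep the input apart from what
the program writes. -/
theorem runs_bellmanFord {J : Instance} {c : Fin J.m → ℝ}
    (hc : ∀ v P, J.IsWalk v v P → 0 ≤ J.len c P) (hr : ∀ v, ∃ P, J.IsWalk J.s v P)
    (hm1 : 1 ≤ J.m) {sa ta wa off root oa o : ℕ} (hsa : sa ≠ 4) (hta : ta ≠ 4) (hwa : wa ≠ oa)
    (hoff : off ∉ [8, 10, 11]) (hroot : root ∉ [8, 10, 11]) {σ : Mem}
    (hn : σ.nv 0 = J.n) (hm : σ.nv 1 = J.m) (hs : σ.nv root = J.s) (ho : σ.nv off = o)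
    (hsrc : ∀ e : Fin J.m, σ.na sa e = J.src e) (htgt : ∀ e : Fin J.m, σ.na ta e = J.tgt e)
    (hw : ∀ e : Fin J.m, σ.ra wa (o + e) = c e) :
    Runs (bellmanFord sa ta wa off root oa) σ (500 * (J.n * J.m))
      fun σ' => ∀ v : Fin J.n, σ'.ra oa v = J.dist c J.s v := by
  simp only [List.mem_cons, List.not_mem_nil, or_false, not_or] at hoff hroot
  have hn1 : 1 ≤ J.n := J.s.pos
  have h1 : Runs (.for 11 0 (.nput 4 (.reg 11) (.const 0))) σ ((J.n + 1) * (3 + 11))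
      (fun σ' => ∀ v : Fin J.n, (v : ℕ) < J.n → σ'.na 4 v = 0) := by
    have := Runs.for_wp (x := 11) (y := 0) (body := .nput 4 (.reg 11) (.const 0)) (σ₀ := σ)
      (fun i σ' => ∀ v : Fin J.n, (v : ℕ) < i → σ'.na 4 v = 0) (by decide) (by decide)
      (by decide) (by simp) (by
        intro i σ' hi _ hx hinv v hv
        simp only [NExpr.eval, Mem.setN_na, Mem.putN_na_same, hx]
        by_cases hei : (v : ℕ) = i
        · simp [hei]
        · rw [Function.update_of_ne hei]
          exact hinv v (by omega))
    rw [hn] at this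
    exact this
  refine (h1.seq (B' := (3 + 3) + (J.n + 1) * ((J.m + 1) * (42 + 11) + 11))
    fun σ₁ ha₁ hz => ?_).mono ?_ fun _ _ h => h
  · have e1 : σ₁.nv root = J.s := by
      rw [ha₁.nv root (by simp [Prog.for, Prog.nvW]; omega), hs]
    refine Runs.seq (Q := fun σ₂ => σ₂ = (σ₁.putN 4 J.s 1).putR oa J.s 0) (B := 3 + 3)
      (Runs.of_wp (p := .seq (.nput 4 (.reg root) (.const 1)) (.rput oa (.reg root) .zero))
        (by simp [Prog.wp, NExpr.eval, RExpr.eval, e1])) fun σ₂ ha₂ hσ₂ => ?_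
    have f0 : σ₂.nv 0 = J.n := by
      rw [ha₂.nv 0 (by simp [Prog.nvW]), ha₁.nv 0 (by decide), hn]
    have f1 : σ₂.nv 1 = J.m := by
      rw [ha₂.nv 1 (by simp [Prog.nvW]), ha₁.nv 1 (by decide), hm]
    have f2 : σ₂.nv off = o := by
      rw [ha₂.nv off (by simp [Prog.nvW]), ha₁.nv off (by simp [Prog.for, Prog.nvW]; omega), ho]
    have f3 : σ₂.na sa = σ.na sa := by
      rw [ha₂.na sa (by simp [Prog.naW, hsa]), ha₁.na sa (by simp [Prog.for, Prog.naW, hsa])]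
    have f4 : σ₂.na ta = σ.na ta := by
      rw [ha₂.na ta (by simp [Prog.naW, hta]), ha₁.na ta (by simp [Prog.for, Prog.naW, hta])]
    have f5 : σ₂.ra wa = σ.ra wa := by
      rw [ha₂.ra wa (by simp [Prog.raW, hwa]), ha₁.ra wa (by simp [Prog.for, Prog.raW])]
    have hinit : J.BFState c (σ₂.na 4) (σ₂.ra oa) 0 0 := by
      subst hσ₂
      have hz' : ∀ v : Fin J.n, v ≠ J.s → Function.update (σ₁.na 4) (J.s : ℕ) 1 (v : ℕ) = 0 := by
        intro v hv
        rw [Function.update_of_ne (by simpa [Fin.val_inj] using hv)]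
        exact hz v v.2
      refine ⟨fun v hv => ?_, fun v P hP hl => ?_, fun e he => by omega⟩
      · by_cases hvs : v = J.s
        · subst hvs
          exact ⟨[], rfl, by simp⟩
        · simp [hz' v hvs] at hv
      · obtain rfl : P = [] := List.length_eq_zero_iff.1 (by omega)
        obtain rfl : J.s = v := hP
        simp
    clear hσ₂
    have key := Runs.for (x := 10) (y := 0) (σ₀ := σ₂) (B := (J.m + 1) * (42 + 11))
      (body := .for 8 1 (relaxProg sa ta wa off oa))
      (fun r σ' => J.BFState c (σ'.na 4) (σ'.ra oa) r 0) (by decide)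
      (by simp [Prog.for, Prog.nvW, relaxProg]) (by simp [Prog.for, Prog.nvW, relaxProg])
      (by simpa using hinit) (by
        intro r σ₃ _ ha₃ _ hinv
        have hin := Runs.for_wp (x := 8) (y := 1) (body := relaxProg sa ta wa off oa) (σ₀ := σ₃)
          (fun i σ' => J.BFState c (σ'.na 4) (σ'.ra oa) r i) (by decide)
          (by simp [Prog.nvW, relaxProg]) (by simp [Prog.nvW, relaxProg]) (by simpa using hinv) (by
            intro i σ₄ hi ha₄ hx hinv
            rw [ha₃.nv 1 (by simp [Prog.for, Prog.nvW, relaxProg]), f1] at hi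
            have g1 : σ₄.nv off = o := by
              rw [ha₄.nv off (by simp [Prog.for, Prog.nvW, relaxProg]; omega),
                ha₃.nv off (by simp [Prog.for, Prog.nvW, relaxProg]; omega), f2]
            have g2 : σ₄.na sa = σ.na sa := by
              rw [ha₄.na sa (by simp [Prog.for, Prog.naW, relaxProg, hsa]),
                ha₃.na sa (by simp [Prog.for, Prog.naW, relaxProg, hsa]), f3]
            have g3 : σ₄.na ta = σ.na ta := by
              rw [ha₄.na ta (by simp [Prog.for, Prog.naW, relaxProg, hta]),
                ha₃.na ta (by simp [Prog.for, Prog.naW, relaxProg, hta]), f4]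
            have g4 : σ₄.ra wa = σ.ra wa := by
              rw [ha₄.ra wa (by simp [Prog.for, Prog.raW, relaxProg, hwa]),
                ha₃.ra wa (by simp [Prog.for, Prog.raW, relaxProg, hwa]), f5]
            obtain ⟨e, rfl⟩ : ∃ e : Fin J.m, (e : ℕ) = i := ⟨⟨i, hi⟩, rfl⟩
            have g5 := hsrc e
            have g6 := htgt e
            have g7 := hw e
            simp only [relaxProg, Prog.wp, BExpr.holds, NExpr.eval, RExpr.eval, hx, g1, g2, g3,
              g4, g5, g6, g7]
            refine ⟨fun c1 => ⟨fun c2 => ?_, fun c2 => ?_⟩, fun c1 => ?_⟩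
            · simp only [Mem.setN_na, Mem.setN_ra]
              exact hinv.of_mono hinv.sound (fun v hv => ⟨hv, le_rfl⟩)
                fun _ => ⟨by omega, c2.2⟩
            · simp only [Mem.setN_na, Mem.setN_ra, Mem.putN_na_same, Mem.putR_na, Mem.putN_ra,
                Mem.putR_ra_same, Mem.putR_nv, hx, g3, g6]
              refine hinv.of_mono (fun v hv => ?_) (fun v hv => ?_) fun _ => by simp
              · by_cases hvt : v = J.tgt e
                · subst hvt
                  obtain ⟨P, hP, hl⟩ := hinv.sound (J.src e) (by omega)
                  exact ⟨P ++ [e], isWalk_concat.2 ⟨hP, rfl⟩, by simp [hl]⟩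
                · have : (v : ℕ) ≠ J.tgt e := by simpa [Fin.val_inj] using hvt
                  rw [Function.update_of_ne this] at hv ⊢
                  exact hinv.sound v hv
              · by_cases hvt : v = J.tgt e
                · subst hvt
                  simp only [Function.update_self, ne_eq, one_ne_zero, not_false_eq_true, true_and]
                  by_contra hlt
                  exact c2 ⟨by omega, (not_le.1 hlt).le⟩
                · have : (v : ℕ) ≠ J.tgt e := by simpa [Fin.val_inj] using hvt
                  rw [Function.update_of_ne this, Function.update_of_ne this]
                  exact ⟨hv, le_rfl⟩
            · simp only [Mem.setN_na, Mem.setN_ra]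
              exact hinv.of_mono hinv.sound (fun v hv => ⟨hv, le_rfl⟩)
                fun h => absurd h (by omega))
        rw [ha₃.nv 1 (by simp [Prog.for, Prog.nvW, relaxProg]), f1] at hin
        refine Runs.mono hin le_rfl fun σ' _ h => ?_
        simpa using h.next_round)
    rw [f0] at key
    exact key.imp fun σ' _ h => h.eq_dist hc hr
  · have h1 : J.n ≤ J.n * J.m := Nat.le_mul_of_pos_right _ hm1
    have h2 : J.m ≤ J.n * J.m := Nat.le_mul_of_pos_left _ hn1
    ring_nf at h1 h2 ⊢
    omega

/-! ### The first stage -/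

theorem runs_distancesProg {I : Instance} (hI : I.Admissible) {σ : Mem} (h : I.Holds σ) :
    Runs distancesProg σ (3000 * ((I.q + 1) * I.n * I.m)) I.HoldsDist := by
  have hm1 := hI.one_le_m
  have hn1 : 1 ≤ I.n := I.s.pos
  refine Runs.mono (B := 100 * ((I.q + 1) * (I.m + 1)) + (2 + (500 * (I.n * I.m) +
    (500 * (I.n * I.m) + (4 + (I.q + 1) * (500 * (I.n * I.m) + (5 + 4) + 11))))))
    (Q := I.HoldsDist) ?_ ?_ fun _ _ h => h
  swap
  · have h1 : (I.q + 1) * I.m ≤ (I.q + 1) * I.n * I.m := by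
      rw [mul_assoc]; exact Nat.mul_le_mul_left _ (Nat.le_mul_of_pos_left _ hn1)
    have h2 : I.q + 1 ≤ (I.q + 1) * I.m := Nat.le_mul_of_pos_right _ hm1
    ring_nf at h1 h2 ⊢
    omega
  refine (runs_aggProg h).seq fun σ₁ ha₁ hagg₁ => ?_
  have hh₁ := h.of_agree ha₁ (by decide) (by decide) (by decide) (by decide)
  refine Runs.seq (Q := fun σ' => σ'.nv 12 = 0) (Runs.of_wp (p := .nset 12 _)
    (by simp [Prog.wp, NExpr.eval])) fun σ₂ ha₂ h12 => ?_
  have hh₂ := hh₁.of_agree ha₂ (by decide) (by decide) (by decide) (by decide)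
  have hagg₂ : ∀ e : Fin I.m, σ₂.ra 1 e = I.agg e := by
    rw [ha₂.ra 1 (by decide)]; exact hagg₁
  refine (runs_bellmanFord (J := I) (c := I.agg) hI.no_neg_cycle_agg hI.from_s hm1 (by decide)
    (by decide) (by decide) (by decide) (by decide) hh₂.n_eq hh₂.m_eq hh₂.s_eq h12 hh₂.src_eq
    hh₂.tgt_eq (by simpa using hagg₂)).seq fun σ₃ ha₃ hfrom₃ => ?_
  have hh₃ := hh₂.of_agree ha₃ (by decide) (by decide) (by decide) (by decide)
  have hagg₃ : ∀ e : Fin I.m, σ₃.ra 1 e = I.agg e := by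
    rw [ha₃.ra 1 (by decide)]; exact hagg₂
  have h12' : σ₃.nv 12 = 0 := (ha₃.nv 12 (by decide)).trans h12
  -- Distances to `t` are distances from `t` in the reversed graph, whose arrays of tails and heads
  -- are the same two arrays exchanged.
  refine (runs_bellmanFord (J := I.rev) (c := I.agg) (fun v P hP => ?_) (fun v => ?_) hm1
    (by decide) (by decide) (by decide) (by decide) (by decide) hh₃.n_eq hh₃.m_eq hh₃.t_eq h12'
    hh₃.tgt_eq hh₃.src_eq (by simpa using hagg₃)).seq fun σ₄ ha₄ hto₄ => ?_
  · have : I.IsWalk v v P.reverse := I.isWalk_rev.1 (by rwa [List.reverse_reverse])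
    have h1 := hI.no_neg_cycle_agg v _ this
    simpa [len, List.sum_reverse] using h1
  · obtain ⟨P, hP⟩ := hI.to_t v
    exact ⟨P.reverse, I.isWalk_rev.2 hP⟩
  have hh₄ := hh₃.of_agree ha₄ (by decide) (by decide) (by decide) (by decide)
  refine Runs.seq (Q := fun σ' => σ'.nv 9 = 0 ∧ σ'.rv 0 = 0) (B := 4)
    (Runs.of_wp (p := .seq (.rset 0 .zero) (.nset 9 _))
    (by simp [Prog.wp, NExpr.eval, RExpr.eval])) fun σ₅ ha₅ h5 => ?_
  have hh₅ := hh₄.of_agree ha₅ (by decide) (by decide) (by decide) (by decide)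
  have key := Runs.for (x := 7) (y := 2) (σ₀ := σ₅) (B := 500 * (I.n * I.m) + (5 + 4))
    (body := .seq (bellmanFord 0 1 0 9 3 4) <|
      .seq (.rset 0 (.add (.reg 0) (.cell 4 (.reg 4)))) (.nset 9 (.add (.reg 9) (.reg 1))))
    (fun i σ' => σ'.nv 9 = i * I.m ∧ σ'.rv 0 =
      ∑ i' : Fin I.q, if (i' : ℕ) < i then I.dist (I.w i') I.s I.t else 0)
    (by decide) (by decide) (by decide) (by simp [h5]) (by
      rintro i σ₆ hi ha₆ hx ⟨h9, hs⟩
      rw [hh₅.q_eq] at hi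
      have hh₆ := hh₅.of_agree ha₆ (by decide) (by decide) (by decide) (by decide)
      refine (runs_bellmanFord (J := I) (c := I.w ⟨i, hi⟩) (hI.no_neg_cycle _) hI.from_s hm1
        (by decide) (by decide) (by decide) (by decide) (by decide) hh₆.n_eq hh₆.m_eq hh₆.s_eq h9
        hh₆.src_eq hh₆.tgt_eq (hh₆.w_eq ⟨i, hi⟩)).seq fun σ₇ ha₇ hd => ?_
      have hh₇ := hh₆.of_agree ha₇ (by decide) (by decide) (by decide) (by decide)
      refine Runs.of_wp (p := .seq (.rset 0 _) (.nset 9 _)) ?_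
      have e1 : σ₇.nv 9 = i * I.m := (ha₇.nv 9 (by decide)).trans h9
      have e2 : σ₇.rv 0 = σ₆.rv 0 := ha₇.rv 0 (by decide)
      refine ⟨?_, ?_⟩
      · simp [NExpr.eval, e1, hh₇.m_eq]
        ring
      · simp only [NExpr.eval, RExpr.eval, Mem.setN_rv, Mem.setR_rv_same, hh₇.t_eq, hd,
          e2, hs]
        have : ∀ i' : Fin I.q, (if (i' : ℕ) < i + 1 then I.dist (I.w i') I.s I.t else 0) =
            (if (i' : ℕ) < i then I.dist (I.w i') I.s I.t else 0) +
              if i' = ⟨i, hi⟩ then I.dist (I.w i') I.s I.t else 0 := by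
          intro i'
          rcases lt_trichotomy (i' : ℕ) i with h | h | h
          · have h' : i' ≠ ⟨i, hi⟩ := fun h' => by simp [h'] at h
            simp [h, h', Nat.lt_succ_of_lt h]
          · have h' : i' = ⟨i, hi⟩ := Fin.ext h
            simp [h']
          · have h' : i' ≠ ⟨i, hi⟩ := fun h' => by simp [h'] at h
            have h1 : ¬ (i' : ℕ) < i + 1 := by omega
            have h2 : ¬ (i' : ℕ) < i := by omega
            simp [h', h1, h2]
        simp only [this, Finset.sum_add_distrib]
        simp)
  rw [hh₅.q_eq] at key
  refine key.imp fun σ' ha hσ' => ?_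
  refine ⟨hh₅.of_agree ha (by decide) (by decide) (by decide) (by decide), fun e => ?_,
    fun v => ?_, fun v => ?_, ?_⟩
  · rw [ha.ra 1 (by decide), ha₅.ra 1 (by decide), ha₄.ra 1 (by decide), hagg₃]
  · rw [ha.ra 2 (by decide), ha₅.ra 2 (by decide), ha₄.ra 2 (by decide), hfrom₃]
  · rw [ha.ra 3 (by decide), ha₅.ra 3 (by decide), hto₄, dist_rev]
  · simpa using hσ'.2

end Instance

/-! ## Adjacency lists

The edges `e` with `act e` are distributed to linked lists, one for each value of `T e`. The list
of node `x` starts with edge `hd x - 1`, and edge `e` is followed by edge `nxt e - 1`; the value `0`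
stands for the end of a list. The lists are in decreasing order, so that the edges that are left
over when the first elements of the lists have been removed are those with `e < hd (T e)`. -/

/-- The linked lists with first elements `hd` and successors `nxt` consist of all active edges up
to the first elements. -/
structure Linked {m n : ℕ} (act : Fin m → Prop) (T : Fin m → Fin n) (hd nxt : ℕ → ℕ) : Prop where
  head : ∀ x : Fin n, hd x ≠ 0 → ∃ e, act e ∧ T e = x ∧ hd x = e + 1
  next : ∀ e, act e → nxt e ≠ 0 → ∃ e', act e' ∧ T e' = T e ∧ nxt e = e' + 1
  le : ∀ e, act e → nxt e ≤ e
  gap : ∀ e e', act e → act e' → T e' = T e → e' < e → (e' : ℕ) < nxt e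

theorem update_fin_ne {n : ℕ} {α : Type*} (f : ℕ → α) {x y : Fin n} (h : y ≠ x) (a : α) :
    Function.update f (x : ℕ) a y = f y :=
  Function.update_of_ne (by simpa [Fin.val_inj] using h) _ _

namespace Linked

variable {m n : ℕ} {act : Fin m → Prop} {T : Fin m → Fin n} {hd nxt : ℕ → ℕ}

/-- Insert an edge in front of its list. -/
theorem insert {e : Fin m} (h : Linked (fun e' => act e' ∧ e' < e) T hd nxt)
    (hfull : ∀ e', act e' → e' < e → (e' : ℕ) < hd (T e')) (he : act e) :
    Linked (fun e' => act e' ∧ (e' : ℕ) < e + 1) T (Function.update hd (T e) (e + 1))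
      (Function.update nxt e (hd (T e))) ∧
    ∀ e', act e' → (e' : ℕ) < e + 1 → (e' : ℕ) < Function.update hd (T e) (e + 1 : ℕ) (T e') := by
  have hcase : ∀ e' : Fin m, (e' : ℕ) < e + 1 → e' ≠ e → e' < e := by
    intro e' h1 h2
    have : (e' : ℕ) ≠ e := fun h => h2 (Fin.ext h)
    exact Fin.lt_def.2 (by omega)
  refine ⟨⟨fun x hx => ?_, fun e₁ he₁ hn => ?_, fun e₁ he₁ => ?_, fun e₁ e₂ he₁ he₂ hT hlt => ?_⟩,
    fun e₁ he₁ hlt => ?_⟩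
  · by_cases hxe : x = T e
    · subst hxe
      exact ⟨e, ⟨he, by omega⟩, rfl, by simp⟩
    · rw [update_fin_ne _ hxe] at hx ⊢
      obtain ⟨e', ⟨h1, h2⟩, h3, h4⟩ := h.head x hx
      exact ⟨e', ⟨h1, Nat.lt_succ_of_lt h2⟩, h3, h4⟩
  · by_cases hee : e₁ = e
    · subst hee
      rw [Function.update_self] at hn ⊢
      obtain ⟨e', ⟨h1, h2⟩, h3, h4⟩ := h.head _ hn
      exact ⟨e', ⟨h1, Nat.lt_succ_of_lt h2⟩, h3, h4⟩
    · rw [update_fin_ne _ hee] at hn ⊢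
      obtain ⟨e', ⟨h1, h2⟩, h3, h4⟩ := h.next e₁ ⟨he₁.1, hcase _ he₁.2 hee⟩ hn
      exact ⟨e', ⟨h1, Nat.lt_succ_of_lt h2⟩, h3, h4⟩
  · by_cases hee : e₁ = e
    · subst hee
      rw [Function.update_self]
      by_cases h0 : hd (T e₁) = 0
      · omega
      · obtain ⟨e', ⟨h1, h2⟩, h3, h4⟩ := h.head _ h0
        have := Fin.lt_def.1 h2
        omega
    · rw [update_fin_ne _ hee]
      exact h.le e₁ ⟨he₁.1, hcase _ he₁.2 hee⟩
  · by_cases hee : e₁ = e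
    · subst hee
      rw [Function.update_self, ← hT]
      exact hfull e₂ he₂.1 hlt
    · rw [update_fin_ne _ hee]
      have h1 := hcase _ he₁.2 hee
      exact h.gap e₁ e₂ ⟨he₁.1, h1⟩ ⟨he₂.1, hlt.trans h1⟩ hT hlt
  · by_cases hT : T e₁ = T e
    · rw [hT, Function.update_self]
      exact hlt
    · rw [update_fin_ne _ hT]
      refine hfull e₁ he₁ (hcase _ hlt fun h => hT (by rw [h]))

/-- Remove the first element of a list. -/
theorem consume (h : Linked act T hd nxt) {x : Fin n} (hx : hd x ≠ 0) :
    ∃ e, act e ∧ T e = x ∧ hd x = e + 1 ∧ Linked act T (Function.update hd x (nxt e)) nxt ∧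
      ∀ e', act e' → ((e' : ℕ) < Function.update hd x (nxt e) (T e') ↔
        (e' : ℕ) < hd (T e') ∧ e' ≠ e) := by
  obtain ⟨e, he, hT, hxe⟩ := h.head x hx
  refine ⟨e, he, hT, hxe, ⟨fun y hy => ?_, h.next, h.le, h.gap⟩, fun e' he' => ?_⟩
  · by_cases hyx : y = x
    · subst hyx
      rw [Function.update_self] at hy ⊢
      rw [← hT]
      exact h.next e he hy
    · rw [update_fin_ne _ hyx] at hy ⊢
      exact h.head y hy
  -- `le` shows that the new head lies beyond `e`, and `gap` that no other edge has been lost.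
  · by_cases hyx : T e' = x
    · rw [hyx, Function.update_self, hxe]
      constructor
      · intro hlt
        have := h.le e he
        exact ⟨by omega, fun hh => by subst hh; omega⟩
      · rintro ⟨h1, h2⟩
        have : (e' : ℕ) ≠ e := fun h => h2 (Fin.ext h)
        exact h.gap e e' he he' (hyx.trans hT.symm) (Fin.lt_def.2 (by omega))
    · rw [update_fin_ne _ hyx]
      exact ⟨fun h1 => ⟨h1, fun h2 => hyx (by rw [h2, hT])⟩, fun h1 => h1.1⟩

end Linked

namespace Instance

/-- The active edges that have not yet been removed from the lists. -/
noncomputable def remaining (I : Instance) (act : Fin I.m → Prop) (T : Fin I.m → Fin I.n)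
    (hd : ℕ → ℕ) : Finset (Fin I.m) :=
  I.edgesWhere fun e => act e ∧ (e : ℕ) < hd (T e)

theorem mem_remaining {I : Instance} {act : Fin I.m → Prop} {T : Fin I.m → Fin I.n}
    {hd : ℕ → ℕ} {e : Fin I.m} : e ∈ I.remaining act T hd ↔ act e ∧ (e : ℕ) < hd (T e) := by
  simp [remaining]

theorem remaining_consume {I : Instance} {act : Fin I.m → Prop} {T : Fin I.m → Fin I.n}
    {hd hd' : ℕ → ℕ} {e : Fin I.m}
    (h : ∀ e', act e' → ((e' : ℕ) < hd' (T e') ↔ (e' : ℕ) < hd (T e') ∧ e' ≠ e)) :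
    I.remaining act T hd' = (I.remaining act T hd).erase e := by
  ext e'
  simp only [mem_remaining, Finset.mem_erase]
  constructor
  · rintro ⟨h1, h2⟩
    have := (h e' h1).1 h2
    exact ⟨this.2, h1, this.1⟩
  · rintro ⟨h1, h2, h3⟩
    exact ⟨h2, (h e' h2).2 ⟨h3, h1⟩⟩

/-- The number of remaining edges is the potential that pays for both searches and for the
extraction of the paths. -/
theorem card_remaining_consume {I : Instance} {act : Fin I.m → Prop} {T : Fin I.m → Fin I.n}
    {hd hd' : ℕ → ℕ} {e : Fin I.m} (he : act e) (hlt : (e : ℕ) < hd (T e))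
    (h : ∀ e', act e' → ((e' : ℕ) < hd' (T e') ↔ (e' : ℕ) < hd (T e') ∧ e' ≠ e)) :
    (I.remaining act T hd').card + 1 = (I.remaining act T hd).card := by
  rw [remaining_consume h, Finset.card_erase_add_one (mem_remaining.2 ⟨he, hlt⟩)]

end Instance

/-- Put the edges that are marked in array `act` into lists according to array `T`. -/
def linkProg (act T : ℕ) : Prog :=
  .seq (.for 7 0 (.nput 9 (.reg 7) (.const 0))) <| .for 7 1 <|
    .ite (.nle (.const 1) (.cell act (.reg 7)))
      (.seq (.nput 10 (.reg 7) (.cell 9 (.cell T (.reg 7))))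
        (.nput 9 (.cell T (.reg 7)) (.add (.reg 7) (.const 1))))
      .skip

/-- Write `0` to the cells of array `a` that belong to nodes. -/
theorem runs_clear {a N : ℕ} {σ : Mem} (hN : σ.nv 0 = N) :
    Runs (.for 7 0 (.nput a (.reg 7) (.const 0))) σ ((N + 1) * 14)
      fun σ' => ∀ i < N, σ'.na a i = 0 := by
  have := Runs.for_wp (x := 7) (y := 0) (body := .nput a (.reg 7) (.const 0)) (σ₀ := σ)
    (fun i σ' => ∀ j < i, σ'.na a j = 0) (by decide) (by simp [Prog.nvW]) (by simp [Prog.nvW])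
    (by simp) (by
      intro i σ' hi _ hx hinv j hj
      simp only [NExpr.eval, Mem.setN_na, Mem.putN_na_same, hx]
      by_cases hji : j = i
      · simp [hji]
      · rw [Function.update_of_ne hji]
        exact hinv j (by omega))
  rw [hN] at this
  exact this

/-- Edges are inserted in front in increasing order, so the lists are decreasing and, at the
beginning, every active edge is below the head of its list. -/
theorem runs_linkProg {n m : ℕ} {act : Fin m → Prop} {T : Fin m → Fin n} {a b : ℕ}
    (ha : a ∉ [9, 10]) (hb : b ∉ [9, 10]) {σ : Mem} (hn : σ.nv 0 = n) (hm : σ.nv 1 = m)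
    (hact : ∀ e : Fin m, 1 ≤ σ.na a e ↔ act e) (hT : ∀ e : Fin m, σ.na b e = T e) :
    Runs (linkProg a b) σ (50 * (n + m + 1)) fun σ' =>
      Linked act T (σ'.na 9) (σ'.na 10) ∧ ∀ e, act e → (e : ℕ) < σ'.na 9 (T e) := by
  simp only [List.mem_cons, List.not_mem_nil, or_false, not_or] at ha hb
  refine Runs.mono (B := (n + 1) * 14 + (m + 1) * (20 + 11)) (Q := fun σ' =>
    Linked act T (σ'.na 9) (σ'.na 10) ∧ ∀ e, act e → (e : ℕ) < σ'.na 9 (T e)) ?_ (by omega)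
    fun _ _ h => h
  refine (runs_clear hn).seq fun σ₁ ha₁ hz => ?_
  have key := Runs.for_wp (x := 7) (y := 1) (body := .ite (.nle (.const 1) (.cell a (.reg 7)))
      (.seq (.nput 10 (.reg 7) (.cell 9 (.cell b (.reg 7))))
        (.nput 9 (.cell b (.reg 7)) (.add (.reg 7) (.const 1)))) .skip) (σ₀ := σ₁)
    (fun i σ' => Linked (fun e => act e ∧ (e : ℕ) < i) T (σ'.na 9) (σ'.na 10) ∧
      ∀ e, act e → (e : ℕ) < i → (e : ℕ) < σ'.na 9 (T e)) (by decide) (by simp [Prog.nvW])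
    (by simp [Prog.nvW]) ⟨⟨fun x hx => by simp [hz x x.2] at hx, by simp, by simp, by simp⟩, by simp⟩
    (by
      rintro i σ₂ hi ha₂ hx ⟨hl, hf⟩
      rw [ha₁.nv 1 (by simp [Prog.for, Prog.nvW]), hm] at hi
      obtain ⟨e, rfl⟩ : ∃ e : Fin m, (e : ℕ) = i := ⟨⟨i, hi⟩, rfl⟩
      have g1 : σ₂.na a = σ.na a := by
        rw [ha₂.na a (by simp [Prog.for, Prog.naW]; omega),
          ha₁.na a (by simp [Prog.for, Prog.naW]; omega)]
      have g2 : σ₂.na b = σ.na b := by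
        rw [ha₂.na b (by simp [Prog.for, Prog.naW]; omega),
          ha₁.na b (by simp [Prog.for, Prog.naW]; omega)]
      simp only [Prog.wp, BExpr.holds, NExpr.eval, hx, g1, hact e]
      refine ⟨fun h => ?_, fun h => ?_⟩
      · have := hl.insert (e := e) (fun e' h1 h2 => hf e' h1 h2) h
        simpa [hx, g2, hT e, hb] using this
      · have hiff : ∀ e' : Fin m, act e' → ((e' : ℕ) < e + 1 ↔ (e' : ℕ) < e) := by
          intro e' he'
          have : (e' : ℕ) ≠ e := fun hh => h (Fin.ext hh ▸ he')
          omega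
        have hfun : (fun e' : Fin m => act e' ∧ (e' : ℕ) < e + 1) =
            fun e' : Fin m => act e' ∧ (e' : ℕ) < e := by
          ext e'
          exact and_congr_right fun h => hiff e' h
        simp only [Mem.setN_na, hfun]
        exact ⟨hl, fun e' he' hlt => hf e' he' ((hiff e' he').1 hlt)⟩)
  rw [ha₁.nv 1 (by simp [Prog.for, Prog.nvW]), hm] at key
  refine key.mono ?_ fun σ' _ h => ?_
  · exact Nat.mul_le_mul_left _ (by simp [Prog.bound, BExpr.cost, NExpr.cost])
  · simpa using h

/-! ## Breadth-first search -/

/-- The main loop of breadth-first search: scan the lists of the nodes in the queue. -/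
def bfsLoop : Prog :=
  .loop (.nlt (.reg 9) (.reg 10)) <| .seq (.nset 8 (.cell 11 (.reg 9))) <|
    .ite (.nle (.cell 9 (.reg 8)) (.const 0)) (.nset 9 (.add (.reg 9) (.const 1))) <|
      .seq (.nset 11 (.sub (.cell 9 (.reg 8)) (.const 1))) <|
      .seq (.nput 9 (.reg 8) (.cell 10 (.reg 11))) <|
      .ite (.nle (.cell 5 (.cell 8 (.reg 11))) (.const 0))
        (.seq (.nput 5 (.cell 8 (.reg 11)) (.add (.cell 5 (.reg 8)) (.const 1))) <|
          .seq (.nput 11 (.reg 10) (.cell 8 (.reg 11))) (.nset 10 (.add (.reg 10) (.const 1))))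
        .skip

/-- Breadth-first search from the node in register `3`: put the levels (`1` for the first node, `0`
for nodes that are not reachable) into array `5`. The heads of the edges are in array `8`. -/
def bfsProg : Prog :=
  .seq (.for 7 0 (.nput 5 (.reg 7) (.const 0))) <| .seq
    (.seq (.nput 5 (.reg 3) (.const 1)) <| .seq (.nput 11 (.const 0) (.reg 3)) <|
      .seq (.nset 9 (.const 0)) (.nset 10 (.const 1)))
    bfsLoop

namespace Instance

/-- The levels `lev` are those of a breadth-first search from `s` in the active edges. -/
structure IsLevel (J : Instance) (act : Fin J.m → Prop) (lev : ℕ → ℕ) : Prop where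
  lev_s : lev J.s = 1
  walk : ∀ v : Fin J.n, lev v ≠ 0 →
    ∃ P, J.IsWalk J.s v P ∧ (∀ e ∈ P, act e) ∧ P.length + 1 = lev v
  closed : ∀ e, act e → lev (J.src e) ≠ 0 →
    lev (J.tgt e) ≠ 0 ∧ lev (J.tgt e) ≤ lev (J.src e) + 1

/-- The state of breadth-first search; the nodes `Q qh, …, Q (qt - 1)` are in the queue. -/
structure BFSState (J : Instance) (act : Fin J.m → Prop) (hd nxt lev Q : ℕ → ℕ) (qh qt : ℕ) :
    Prop where
  linked : Linked act J.src hd nxt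
  lev_s : lev J.s = 1
  le : qh ≤ qt
  mem : ∀ i < qt, ∃ v : Fin J.n, Q i = v ∧ lev v ≠ 0
  cover : ∀ v : Fin J.n, lev v ≠ 0 → ∃ i < qt, Q i = v
  mono : ∀ i j, i ≤ j → j < qt → lev (Q i) ≤ lev (Q j)
  scanned : ∀ i < qh, hd (Q i) = 0
  near : qh < qt → ∀ v : Fin J.n, lev v ≤ lev (Q qh) + 1
  removed : ∀ e, act e → hd (J.src e) ≤ e →
    lev (J.tgt e) ≠ 0 ∧ lev (J.tgt e) ≤ lev (J.src e) + 1
  walk : ∀ v : Fin J.n, lev v ≠ 0 →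
    ∃ P, J.IsWalk J.s v P ∧ (∀ e ∈ P, act e) ∧ P.length + 1 = lev v

namespace BFSState

variable {J : Instance} {act : Fin J.m → Prop} {hd nxt lev Q : ℕ → ℕ} {qh qt : ℕ}

/-- Once the queue is empty, all nodes with a level have exhausted lists, so each active edge
leaving them has been examined. -/
theorem isLevel (h : J.BFSState act hd nxt lev Q qh qt) (hq : ¬ qh < qt) : J.IsLevel act lev := by
  refine ⟨h.lev_s, h.walk, fun e he hs => h.removed e he ?_⟩
  obtain ⟨i, hi, hQ⟩ := h.cover _ hs
  have := h.scanned i (by omega)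
  rw [hQ] at this
  omega

theorem advance (h : J.BFSState act hd nxt lev Q qh qt) (hq : qh < qt) (h0 : hd (Q qh) = 0) :
    J.BFSState act hd nxt lev Q (qh + 1) qt :=
  { h with
    le := hq
    scanned := fun i hi => by
      rcases Nat.lt_succ_iff_lt_or_eq.1 hi with hi | rfl
      · exact h.scanned i hi
      · exact h0
    near := fun hq' v => (h.near hq v).trans
      (Nat.succ_le_succ (h.mono qh (qh + 1) (Nat.le_succ _) hq')) }

variable {u : Fin J.n} {e : Fin J.m} {hd' : ℕ → ℕ}

/-- No level exceeds that of the front of the queue by more than one, so a head already reached is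
not too high. -/
theorem scan_old (h : J.BFSState act hd nxt lev Q qh qt) (hq : qh < qt) (hu : Q qh = u)
    (hl : Linked act J.src hd' nxt)
    (hlt : ∀ e', act e' → ((e' : ℕ) < hd' (J.src e') ↔ (e' : ℕ) < hd (J.src e') ∧ e' ≠ e))
    (h0 : ∀ x, hd x = 0 → hd' x = 0) (hs : J.src e = u) (hv : lev (J.tgt e) ≠ 0) :
    J.BFSState act hd' nxt lev Q qh qt :=
  { h with
    linked := hl
    scanned := fun i hi => h0 _ (h.scanned i hi)
    removed := fun e' he' hle => by
      by_cases hee : e' = e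
      · subst hee
        refine ⟨hv, ?_⟩
        rw [hs, ← hu]
        exact h.near hq _
      · refine h.removed e' he' ?_
        by_contra hcon
        exact absurd ((hlt e' he').2 ⟨not_le.1 hcon, hee⟩) (not_lt.2 hle) }

/-- The new node gets the largest level that `near` allows, so appending it keeps the queue sorted
by level. -/
theorem scan_new (h : J.BFSState act hd nxt lev Q qh qt) (hq : qh < qt) (hu : Q qh = u)
    (hl : Linked act J.src hd' nxt)
    (hlt : ∀ e', act e' → ((e' : ℕ) < hd' (J.src e') ↔ (e' : ℕ) < hd (J.src e') ∧ e' ≠ e))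
    (h0 : ∀ x, hd x = 0 → hd' x = 0) (he : act e) (hs : J.src e = u) (hv : lev (J.tgt e) = 0) :
    J.BFSState act hd' nxt (Function.update lev (J.tgt e) (lev u + 1))
      (Function.update Q qt (J.tgt e)) qh (qt + 1) := by
  have hlu : lev u ≠ 0 := by
    obtain ⟨v, h1, h2⟩ := h.mem qh hq
    rwa [← hu, h1]
  have hlev : ∀ x, lev x ≠ 0 → Function.update lev (J.tgt e) (lev u + 1) x = lev x := by
    intro x hx
    rw [Function.update_of_ne]
    rintro rfl
    exact hx hv
  have hge : ∀ x, lev x ≤ Function.update lev (J.tgt e) (lev u + 1) x := by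
    intro x
    by_cases hx : lev x = 0
    · omega
    · rw [hlev x hx]
  have hQ : ∀ i < qt, Function.update Q qt (J.tgt e) i = Q i := fun i hi =>
    Function.update_of_ne (by omega) _ _
  have hQlev : ∀ i < qt, Function.update lev (J.tgt e) (lev u + 1) (Q i) = lev (Q i) := by
    intro i hi
    obtain ⟨v, h1, h2⟩ := h.mem i hi
    rw [h1, hlev _ h2]
  refine ⟨hl, ?_, by have := h.le; omega, fun i hi => ?_, fun v hv' => ?_, fun i j hij hj => ?_,
    fun i hi => ?_, fun _ v => ?_, fun e' he' hle => ?_, fun v hv' => ?_⟩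
  · rw [hlev _ (by rw [h.lev_s]; omega), h.lev_s]
  · rcases Nat.lt_succ_iff_lt_or_eq.1 hi with hi | rfl
    · obtain ⟨v, h1, h2⟩ := h.mem i hi
      exact ⟨v, by rw [hQ i hi, h1], by rwa [hlev _ h2]⟩
    · exact ⟨J.tgt e, by simp, by simp⟩
  · by_cases hvt : v = J.tgt e
    · subst hvt
      exact ⟨qt, by omega, by simp⟩
    · rw [update_fin_ne _ hvt] at hv'
      obtain ⟨i, h1, h2⟩ := h.cover v hv'
      exact ⟨i, by omega, by rw [hQ i h1, h2]⟩
  · rcases Nat.lt_succ_iff_lt_or_eq.1 hj with hj | rfl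
    · rw [hQ j hj, hQ i (by omega), hQlev j hj, hQlev i (by omega)]
      exact h.mono i j hij hj
    · rcases Nat.lt_or_eq_of_le hij with hi | rfl
      · rw [hQ i hi, hQlev i hi, Function.update_self, Function.update_self]
        obtain ⟨v, h1, h2⟩ := h.mem i hi
        rw [h1, ← hu]
        exact h.near hq v
      · exact le_rfl
  · have := h.le
    rw [hQ i (by omega)]
    exact h0 _ (h.scanned i hi)
  · rw [hQ qh hq, hQlev qh hq, hu]
    by_cases hvt : v = J.tgt e
    · subst hvt
      simp
    · rw [update_fin_ne _ hvt, ← hu]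
      exact h.near hq v
  · by_cases hee : e' = e
    · subst hee
      rw [Function.update_self]
      refine ⟨by omega, ?_⟩
      have := hge (J.src e')
      rw [hs] at this ⊢
      omega
    · have hle' : hd (J.src e') ≤ e' := by
        by_contra hcon
        exact absurd ((hlt e' he').2 ⟨not_le.1 hcon, hee⟩) (not_lt.2 hle)
      obtain ⟨h1, h2⟩ := h.removed e' he' hle'
      have := hge (J.src e')
      rw [hlev _ h1]
      exact ⟨h1, by omega⟩
  · by_cases hvt : v = J.tgt e
    · subst hvt
      obtain ⟨P, h1, h2, h3⟩ := h.walk u hlu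
      refine ⟨P ++ [e], isWalk_concat.2 ⟨hs ▸ h1, rfl⟩, fun e' he' => ?_, by simpa using h3⟩
      rcases List.mem_append.1 he' with h' | h'
      · exact h2 e' h'
      · rw [List.mem_singleton.1 h']
        exact he
    · rw [update_fin_ne _ hvt] at hv' ⊢
      exact h.walk v hv'

end BFSState

theorem runs_bfsProg {J : Instance} {act : Fin J.m → Prop} {σ : Mem} (hn : σ.nv 0 = J.n)
    (hs : σ.nv 3 = J.s) (htgt : ∀ e : Fin J.m, σ.na 8 e = J.tgt e)
    (hl : Linked act J.src (σ.na 9) (σ.na 10))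
    (hfull : ∀ e, act e → (e : ℕ) < σ.na 9 (J.src e)) :
    Runs bfsProg σ (300 * (J.n + J.m + 1)) fun σ' => J.IsLevel act (σ'.na 5) := by
  refine Runs.mono (B := (J.n + 1) * 14 + (10 + (2 * J.m + 1 + 1) * (45 + 4 + 1)))
    (Q := fun σ' => J.IsLevel act (σ'.na 5)) ?_ (by ring_nf; omega) fun _ _ h => h
  refine (runs_clear hn).seq fun σ₁ ha₁ hz => ?_
  have e3 : σ₁.nv 3 = J.s := (ha₁.nv 3 (by decide)).trans hs
  refine Runs.seq (Q := fun σ' => J.BFSState act (σ'.na 9) (σ'.na 10) (σ'.na 5) (σ'.na 11)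
    (σ'.nv 9) (σ'.nv 10) ∧ σ'.nv 9 = 0 ∧ σ'.nv 10 = 1) (B := 10) (Runs.of_wp
    (p := .seq (.nput 5 (.reg 3) (.const 1)) <| .seq (.nput 11 (.const 0) (.reg 3)) <|
      .seq (.nset 9 (.const 0)) (.nset 10 (.const 1))) ?_) fun σ₂ ha₂ hσ₂ => ?_
  · simp only [Prog.wp, NExpr.eval, e3]
    refine ⟨?_, by simp, by simp⟩
    have hz' : ∀ v : Fin J.n, v ≠ J.s → Function.update (σ₁.na 5) (J.s : ℕ) 1 (v : ℕ) = 0 := by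
      intro v hv
      rw [update_fin_ne _ hv]
      exact hz v v.2
    have hone : ∀ v : Fin J.n, Function.update (σ₁.na 5) (J.s : ℕ) 1 (v : ℕ) ≠ 0 → v = J.s :=
      fun v hv => by
        by_contra h
        exact hv (hz' v h)
    have e9 : σ₁.na 9 = σ.na 9 := ha₁.na 9 (by decide)
    have e10 : σ₁.na 10 = σ.na 10 := ha₁.na 10 (by decide)
    simp only [Mem.setN_na, Mem.putN_na_same, Mem.setN_nv_same, Mem.putN_nv, e3,
      Mem.putN_na_ne _ _ _ _ _ (show (9 : ℕ) ≠ 11 by decide),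
      Mem.putN_na_ne _ _ _ _ _ (show (9 : ℕ) ≠ 5 by decide),
      Mem.putN_na_ne _ _ _ _ _ (show (10 : ℕ) ≠ 11 by decide),
      Mem.putN_na_ne _ _ _ _ _ (show (10 : ℕ) ≠ 5 by decide),
      Mem.putN_na_ne _ _ _ _ _ (show (5 : ℕ) ≠ 11 by decide),
      Mem.putN_na_ne _ _ _ _ _ (show (11 : ℕ) ≠ 5 by decide),
      Mem.setN_nv_ne _ _ _ _ (show (9 : ℕ) ≠ 10 by decide), e9, e10]
    refine ⟨hl, by simp, by omega, fun i hi => ?_, fun v hv => ?_, fun i j hij hj => ?_,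
      fun i hi => by omega, fun _ v => ?_, fun e he hle => ?_, fun v hv => ?_⟩
    · obtain rfl : i = 0 := by omega
      exact ⟨J.s, by simp, by simp⟩
    · exact ⟨0, by omega, by simp [hone v hv]⟩
    · obtain rfl : i = j := by omega
      exact le_rfl
    · by_cases hv : v = J.s
      · subst hv; simp
      · rw [hz' v hv]; omega
    · have := hfull e he
      omega
    · obtain rfl := hone v hv
      exact ⟨[], rfl, by simp, by simp⟩
  have c8 : σ₂.na 8 = σ.na 8 := by rw [ha₂.na 8 (by decide), ha₁.na 8 (by decide)]
  obtain ⟨hσ₂, q9, q10⟩ := hσ₂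
  -- The potential is twice the number of unexamined edges plus the length of the queue: examining
  -- an edge lowers it by `2` and adds at most one node, and dropping the front lowers it by `1`.
  have key := Runs.loop (b := .nlt (.reg 9) (.reg 10)) (B := 45) (σ₀ := σ₂)
    (p := .seq (.nset 8 (.cell 11 (.reg 9))) <|
      .ite (.nle (.cell 9 (.reg 8)) (.const 0)) (.nset 9 (.add (.reg 9) (.const 1))) <|
      .seq (.nset 11 (.sub (.cell 9 (.reg 8)) (.const 1))) <|
      .seq (.nput 9 (.reg 8) (.cell 10 (.reg 11))) <|
      .ite (.nle (.cell 5 (.cell 8 (.reg 11))) (.const 0))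
        (.seq (.nput 5 (.cell 8 (.reg 11)) (.add (.cell 5 (.reg 8)) (.const 1))) <|
          .seq (.nput 11 (.reg 10) (.cell 8 (.reg 11))) (.nset 10 (.add (.reg 10) (.const 1))))
        .skip)
    (fun N σ' => J.BFSState act (σ'.na 9) (σ'.na 10) (σ'.na 5) (σ'.na 11)
      (σ'.nv 9) (σ'.nv 10) ∧
      N = 2 * (J.remaining act J.src (σ'.na 9)).card + (σ'.nv 10 - σ'.nv 9))
    (by
      rintro N σ₃ ha₃ ⟨hst, hN⟩ hb
      simp only [BExpr.holds, NExpr.eval, not_le] at hb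
      refine Runs.mono (Runs.of_wp (Q := fun σ' => ∃ n' < N, J.BFSState act (σ'.na 9) (σ'.na 10)
        (σ'.na 5) (σ'.na 11) (σ'.nv 9) (σ'.nv 10) ∧
        n' = 2 * (J.remaining act J.src (σ'.na 9)).card + (σ'.nv 10 - σ'.nv 9)) ?_)
        (by simp [Prog.bound, BExpr.cost, NExpr.cost]) fun _ _ h => h
      have c8' : σ₃.na 8 = σ.na 8 := by rw [ha₃.na 8 (by decide), c8]
      obtain ⟨u, hu, -⟩ := hst.mem _ hb
      simp only [Prog.wp, BExpr.holds, NExpr.eval]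
      refine ⟨fun h1 => ?_, fun h1 => ⟨fun h2 => ?_, fun h2 => ?_⟩⟩
      · simp only [Mem.setN_nv_same, Mem.setN_na] at h1
        refine ⟨_, ?_, ?_, rfl⟩
        · simp
          omega
        · have := hst.advance hb (by omega)
          simpa using this
      all_goals
        simp only [Mem.setN_nv_same, Mem.setN_na, hu] at h1
        obtain ⟨e, he, hsrc, hhd, hlk, hlt⟩ := hst.linked.consume (x := u) (by omega)
        have hcard := card_remaining_consume he (by rw [hsrc]; omega) hlt
        have h0 : ∀ x, σ₃.na 9 x = 0 → Function.update (σ₃.na 9) u (σ₃.na 10 e) x = 0 := by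
          intro x hx
          rw [Function.update_of_ne]
          · exact hx
          · rintro rfl
            omega
        have ht := htgt e
        simp [hu, hhd, c8', ht] at h2
      · have := hst.scan_new hb hu hlk hlt h0 he hsrc h2
        refine ⟨_, ?_, by simpa [hu, hhd, c8', ht] using this, rfl⟩
        simp [hu, hhd]
        omega
      · have := hst.scan_old hb hu hlk hlt h0 hsrc h2
        refine ⟨_, ?_, by simpa [hu, hhd] using this, rfl⟩
        simp [hu, hhd]
        omega)
    _ ⟨hσ₂, rfl⟩
  refine Runs.mono key ?_ fun σ' _ h => ?_
  · have : (J.remaining act J.src (σ₂.na 9)).card ≤ J.m := J.card_edgesWhere_le _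
    refine Nat.mul_le_mul ?_ ?_
    · rw [q9, q10]; omega
    · simp [BExpr.cost, NExpr.cost]
  · obtain ⟨⟨N, h1, -⟩, h2⟩ := h
    simp only [BExpr.holds, NExpr.eval, not_le] at h2
    exact h1.isLevel (by omega)

end Instance

/-! ## Blocking flows by depth-first search -/

/-- Change the flow on the edge with the number in register `11`. -/
def toggleProg : Prog := .nput 6 (.reg 11) (.sub (.const 1) (.cell 6 (.reg 11)))

/-- A step of depth-first search. The current node is in register `8`, the path to it is the stack
in array `11`, whose height is in register `9`. -/
def dfsStep : Prog :=
  .ite (.neq (.reg 8) (.reg 4))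
    (.seq (.nset 12 (.add (.reg 12) (.const 1))) <| .seq (.nset 8 (.reg 3)) (.nset 9 (.const 0))) <|
  .ite (.nle (.cell 9 (.reg 8)) (.const 0))
    (.seq (.nset 9 (.sub (.reg 9) (.const 1))) <| .seq (.nset 11 (.cell 11 (.reg 9))) <|
      .seq toggleProg (.nset 8 (.cell 7 (.reg 11)))) <|
  .seq (.nset 11 (.sub (.cell 9 (.reg 8)) (.const 1))) <|
  .seq (.nput 9 (.reg 8) (.cell 10 (.reg 11))) <|
  .ite (.neq (.cell 5 (.cell 8 (.reg 11))) (.add (.cell 5 (.reg 8)) (.const 1)))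
    (.seq (.nput 11 (.reg 9) (.reg 11)) <| .seq (.nset 9 (.add (.reg 9) (.const 1))) <|
      .seq toggleProg (.nset 8 (.cell 8 (.reg 11))))
    .skip

/-- Depth-first search until the source is a dead end. The flow in array `6` is changed along the
current path; whenever the destination is reached, the path is kept and counted in register `12`. -/
def dfsLoop : Prog :=
  .loop (.not (.and (.nle (.reg 9) (.const 0)) (.nle (.cell 9 (.reg 8)) (.const 0)))) dfsStep

namespace Instance

/-- The state of depth-first search: `f₀` is the flow at the beginning, `v₀` its value, `f` the
current flow, `v` the number of paths that have been counted, `u` the current node, and `P` the path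
to it. -/
structure DFSState (I : Instance) (f₀ lev : ℕ → ℕ) (v₀ : ℕ) (hd nxt f stk : ℕ → ℕ)
    (u : Fin I.n) (P : List (Fin I.m)) (v : ℕ) : Prop where
  linked : Linked I.Tight (I.resid f₀).src hd nxt
  isUnit : I.IsUnit f
  walk : (I.resid f₀).IsWalk I.s u P
  stack : ∀ (i : ℕ) (h : i < P.length), stk i = P[i]
  nodup : P.Nodup
  onStack : ∀ e ∈ P, f e ≠ f₀ e
  net : ∀ x, I.net (fun e => (f e : ℤ)) x =
    (if I.s = x then (v : ℤ) else 0) - (if I.t = x then (v : ℤ) else 0) +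
      (if I.s = x then 1 else 0) - if u = x then 1 else 0
  flip : ∀ e : Fin I.m, f e ≠ f₀ e → I.Tight e ∧ hd ((I.resid f₀).src e) ≤ e ∧
    lev ((I.resid f₀).src e) ≠ 0 ∧ lev ((I.resid f₀).tgt e) = lev ((I.resid f₀).src e) + 1
  lev_u : lev u ≠ 0
  dead : ∀ e : Fin I.m, I.Tight e → hd ((I.resid f₀).src e) ≤ e → f e = f₀ e →
    lev ((I.resid f₀).tgt e) = lev ((I.resid f₀).src e) + 1 →
    (I.resid f₀).tgt e ≠ I.t ∧ hd ((I.resid f₀).tgt e) = 0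
  v₀_le : v₀ ≤ v
  first : v = v₀ → ∀ e : Fin I.m, f e ≠ f₀ e → e ∈ P

namespace DFSState

variable {I : Instance} {f₀ lev : ℕ → ℕ} {v₀ : ℕ} {hd nxt f stk : ℕ → ℕ} {u : Fin I.n}
  {P : List (Fin I.m)} {v : ℕ}

/-- The unit travelling from `s` to `u` has arrived and is booked as value. The stack is forgotten,
but its edges stay changed. -/
theorem arrive (h : I.DFSState f₀ lev v₀ hd nxt f stk u P v) (hlev : lev I.s = 1) (hu : u = I.t) :
    I.DFSState f₀ lev v₀ hd nxt f stk I.s [] (v + 1) where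
  linked := h.linked
  isUnit := h.isUnit
  walk := rfl
  stack := by simp
  nodup := by simp
  onStack := by simp
  net x := by
    rw [h.net x, hu]
    push_cast
    split_ifs <;> ring
  flip := h.flip
  lev_u := by omega
  dead := h.dead
  v₀_le := by have := h.v₀_le; omega
  first := by have := h.v₀_le; omega

/-- Toggling `e` again restores its initial flow and takes the unit back to its tail. The edge is
now unchanged and removed, as `dead` permits, because its head is an exhausted node other than `t`.
-/
theorem pop (hf₀ : I.IsUnit f₀) {e : Fin I.m}
    (h : I.DFSState f₀ lev v₀ hd nxt f stk u (P ++ [e]) v)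
    (hu : u ≠ I.t) (h0 : hd u = 0) :
    I.DFSState f₀ lev v₀ hd nxt (Function.update f e (1 - f e)) stk ((I.resid f₀).src e) P v := by
  obtain ⟨hw, hte⟩ := isWalk_concat.1 h.walk
  have hfe : f e ≠ f₀ e := h.onStack e (by simp)
  have hfl := h.flip e hfe
  have hne : e ∉ P := fun he => (List.nodup_append.1 h.nodup).2.2 e he e (by simp) rfl
  have h1 : Function.update f e (1 - f e) (e : ℕ) = f₀ e := by
    have := h.isUnit.le_one e
    have := hf₀.le_one e
    rw [Function.update_self]
    omega
  exact
  { linked := h.linked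
    isUnit := h.isUnit.toggle hfl.1
    walk := hw
    stack := fun i hi => by
      rw [h.stack i (by simp; omega), List.getElem_append_left hi]
    nodup := (List.nodup_append.1 h.nodup).1
    onStack := fun e' he' => by
      rw [update_fin_ne _ fun hh : e' = e => hne (hh ▸ he')]
      exact h.onStack e' (by simp [he'])
    net := fun x => by
      obtain ⟨s1, s2⟩ := resid_src_swap (I := I) hfe (h.isUnit.le_one e) (hf₀.le_one e)
      rw [net_toggle e (h.isUnit.le_one e), h.net x, s1, s2, hte]
      ring
    flip := fun e' he' => by
      by_cases hee : e' = e
      · subst hee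
        exact absurd h1 he'
      · rw [update_fin_ne _ hee] at he'
        exact h.flip e' he'
    lev_u := hfl.2.2.1
    dead := fun e' hT hle hf hl => by
      by_cases hee : e' = e
      · subst hee
        rw [hte]
        exact ⟨hu, h0⟩
      · rw [update_fin_ne _ hee] at hf
        exact h.dead e' hT hle hf hl
    v₀_le := h.v₀_le
    first := fun hv e' he' => by
      by_cases hee : e' = e
      · subst hee
        exact absurd h1 he'
      · rw [update_fin_ne _ hee] at he'
        simpa [hee] using h.first hv e' he' }

variable {e : Fin I.m} {hd' : ℕ → ℕ}

theorem skip (h : I.DFSState f₀ lev v₀ hd nxt f stk u P v)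
    (hl : Linked I.Tight (I.resid f₀).src hd' nxt)
    (hlt : ∀ e', I.Tight e' → ((e' : ℕ) < hd' ((I.resid f₀).src e') ↔
      (e' : ℕ) < hd ((I.resid f₀).src e') ∧ e' ≠ e))
    (h0 : ∀ x, hd x = 0 → hd' x = 0)
    (he : f e = f₀ e → lev ((I.resid f₀).tgt e) ≠ lev ((I.resid f₀).src e) + 1) :
    I.DFSState f₀ lev v₀ hd' nxt f stk u P v :=
  { h with
    linked := hl
    flip := fun e' he' => by
      obtain ⟨h1, h2, h3⟩ := h.flip e' he'
      refine ⟨h1, ?_, h3⟩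
      by_contra hcon
      have := ((hlt e' h1).1 (not_le.1 hcon)).1
      omega
    dead := fun e' hT hle hf hl => by
      by_cases hee : e' = e
      · subst hee
        exact absurd hl (he hf)
      · have hle' : hd ((I.resid f₀).src e') ≤ e' := by
          by_contra hcon
          exact absurd ((hlt e' hT).2 ⟨not_le.1 hcon, hee⟩) (not_lt.2 hle)
        obtain ⟨h1, h2⟩ := h.dead e' hT hle' hf hl
        exact ⟨h1, h0 _ h2⟩ }

/-- Changed edges have left the lists, so an edge taken from a list still has its initial flow, and
toggling it moves the travelling unit to its head. -/
theorem push (hf₀ : I.IsUnit f₀) (h : I.DFSState f₀ lev v₀ hd nxt f stk u P v)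
    (hl : Linked I.Tight (I.resid f₀).src hd' nxt)
    (hlt : ∀ e', I.Tight e' → ((e' : ℕ) < hd' ((I.resid f₀).src e') ↔
      (e' : ℕ) < hd ((I.resid f₀).src e') ∧ e' ≠ e))
    (h0 : ∀ x, hd x = 0 → hd' x = 0) (hT : I.Tight e) (hsrc : (I.resid f₀).src e = u)
    (hrem : (e : ℕ) < hd u)
    (hadm : lev ((I.resid f₀).tgt e) = lev ((I.resid f₀).src e) + 1) :
    I.DFSState f₀ lev v₀ hd' nxt (Function.update f e (1 - f e))
      (Function.update stk P.length e) ((I.resid f₀).tgt e) (P ++ [e]) v := by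
  have hfe : f e = f₀ e := by
    by_contra hcon
    have := (h.flip e hcon).2.1
    rw [hsrc] at this
    omega
  have hne : e ∉ P := fun he => h.onStack e he hfe
  have h1 : Function.update f e (1 - f e) (e : ℕ) ≠ f₀ e := by
    have := hf₀.le_one e
    rw [Function.update_self]
    omega
  have hle : ∀ e', I.Tight e' → hd' ((I.resid f₀).src e') ≤ e' →
      e' ≠ e → hd ((I.resid f₀).src e') ≤ e' := fun e' hT' hle hee => by
    by_contra hcon
    exact absurd ((hlt e' hT').2 ⟨not_le.1 hcon, hee⟩) (not_lt.2 hle)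
  have hle' : ∀ e', I.Tight e' → (e' = e ∨ hd ((I.resid f₀).src e') ≤ e') →
      hd' ((I.resid f₀).src e') ≤ e' := fun e' hT' ho => by
    by_contra hcon
    have := (hlt e' hT').1 (not_le.1 hcon)
    rcases ho with ho | ho
    · exact this.2 ho
    · omega
  exact
  { linked := hl
    isUnit := h.isUnit.toggle hT
    walk := isWalk_concat.2 ⟨by rw [hsrc]; exact h.walk, rfl⟩
    stack := fun i hi => by
      rw [List.length_append, List.length_singleton] at hi
      rcases Nat.lt_succ_iff_lt_or_eq.1 hi with hi | rfl
      · rw [Function.update_of_ne (by omega), h.stack i hi, List.getElem_append_left hi]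
      · simp
    nodup := by
      rw [List.nodup_append]
      refine ⟨h.nodup, by simp, ?_⟩
      intro a ha b hb
      rw [List.mem_singleton.1 hb]
      rintro rfl
      exact hne ha
    onStack := fun e' he' => by
      rcases List.mem_append.1 he' with he' | he'
      · rw [update_fin_ne _ fun hh : e' = e => hne (hh ▸ he')]
        exact h.onStack e' he'
      · rw [List.mem_singleton.1 he']
        exact h1
    net := fun x => by
      obtain ⟨s1, s2⟩ := resid_src_congr (I := I) hfe
      rw [net_toggle e (h.isUnit.le_one e), h.net x, s1, s2, hsrc]
      ring
    flip := fun e' he' => by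
      by_cases hee : e' = e
      · subst hee
        exact ⟨hT, hle' _ hT (.inl rfl), by rw [hsrc]; exact h.lev_u, hadm⟩
      · rw [update_fin_ne _ hee] at he'
        obtain ⟨g1, g2, g3⟩ := h.flip e' he'
        exact ⟨g1, hle' _ g1 (.inr g2), g3⟩
    lev_u := by omega
    dead := fun e' hT' hc hf hl => by
      by_cases hee : e' = e
      · subst hee
        exact absurd hf h1
      · rw [update_fin_ne _ hee] at hf
        obtain ⟨g1, g2⟩ := h.dead e' hT' (hle e' hT' hc hee) hf hl
        exact ⟨g1, h0 _ g2⟩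
    v₀_le := h.v₀_le
    first := fun hv e' he' => by
      by_cases hee : e' = e
      · simp [hee]
      · rw [update_fin_ne _ hee] at he'
        simp [h.first hv e' he'] }

end DFSState

/-- The effect of a blocking flow: `f` and `v` are the new flow and its value. -/
structure Blocked (I : Instance) (f₀ lev : ℕ → ℕ) (v₀ : ℕ) (f : ℕ → ℕ) (v : ℕ) : Prop where
  isUnit : I.IsUnit f
  hasValue : I.HasValue f v
  flip : ∀ e : Fin I.m, f e ≠ f₀ e →
    lev ((I.resid f₀).src e) ≠ 0 ∧ lev ((I.resid f₀).tgt e) = lev ((I.resid f₀).src e) + 1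
  blocked : ∃ X : Set (Fin I.n), I.s ∈ X ∧ I.t ∉ X ∧
    ∀ e, I.Tight e → f e = f₀ e → (I.resid f₀).src e ∈ X →
      lev ((I.resid f₀).tgt e) = lev ((I.resid f₀).src e) + 1 → (I.resid f₀).tgt e ∈ X
  v₀_le : v₀ ≤ v
  first : v = v₀ → ∀ e : Fin I.m, f e = f₀ e

/-- The blocking set consists of the exhausted nodes other than `t`; `dead` says that unchanged
climbing edges do not leave it. With an empty stack the travelling unit vanishes from the balance.
-/
theorem DFSState.isBlocked {I : Instance} {f₀ lev : ℕ → ℕ} {v₀ : ℕ} {hd nxt f stk : ℕ → ℕ}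
    {u : Fin I.n} {v : ℕ} (hst : I.s ≠ I.t) (h : I.DFSState f₀ lev v₀ hd nxt f stk u [] v)
    (h0 : hd u = 0) : I.Blocked f₀ lev v₀ f v := by
  obtain rfl : I.s = u := h.walk
  refine ⟨h.isUnit, fun x => ?_, fun e he => (h.flip e he).2.2,
    ⟨{x | x ≠ I.t ∧ hd x = 0}, ⟨hst, h0⟩, fun h => h.1 rfl, fun e hT hf hX hl => ?_⟩, h.v₀_le,
    fun hv e => ?_⟩
  · rw [h.net x]
    ring
  · exact h.dead e hT (by rw [hX.2]; omega) hf hl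
  · by_contra hcon
    simpa using h.first hv e hcon

theorem runs_dfsLoop {I : Instance} (hst : I.s ≠ I.t) {f₀ lev : ℕ → ℕ} (hf₀ : I.IsUnit f₀)
    {σ : Mem} (hs : σ.nv 3 = I.s) (ht : σ.nv 4 = I.t) (hlev : σ.na 5 = lev)
    (hsrc : ∀ e : Fin I.m, σ.na 7 e = (I.resid f₀).src e)
    (htgt : ∀ e : Fin I.m, σ.na 8 e = (I.resid f₀).tgt e) (hlev_s : lev I.s = 1)
    (hf : σ.na 6 = f₀) (hl : Linked I.Tight (I.resid f₀).src (σ.na 9) (σ.na 10))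
    (hfull : ∀ e, I.Tight e → (e : ℕ) < σ.na 9 ((I.resid f₀).src e))
    (hval : I.HasValue f₀ (σ.nv 12)) (hu : σ.nv 8 = I.s) (hsp : σ.nv 9 = 0) :
    Runs dfsLoop σ (200 * (I.m + 1)) fun σ' =>
      I.Blocked f₀ lev (σ.nv 12) (σ'.na 6) (σ'.nv 12) := by
  obtain ⟨R, hR⟩ : ∃ R : (ℕ → ℕ) → ℕ,
      ∀ hd, R hd = (I.remaining I.Tight (I.resid f₀).src hd).card := ⟨_, fun _ => rfl⟩
  -- Potential: twice the remaining edges plus the height of the stack. A push costs `2` and returns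
  -- `1`, a skip costs `2`, a pop costs `1`, and an arrival empties a stack that is nonempty because
  -- `s ≠ t`.
  have key := Runs.loop (b := .not (.and (.nle (.reg 9) (.const 0))
      (.nle (.cell 9 (.reg 8)) (.const 0)))) (B := 86) (σ₀ := σ) (p := dfsStep)
    (fun N σ' => ∃ (u : Fin I.n) (P : List (Fin I.m)), σ'.nv 8 = u ∧ σ'.nv 9 = P.length ∧
      I.DFSState f₀ lev (σ.nv 12) (σ'.na 9) (σ'.na 10) (σ'.na 6) (σ'.na 11) u P (σ'.nv 12) ∧
      N = 2 * R (σ'.na 9) + P.length)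
    (by
      rintro N σ₁ ha ⟨u, P, hu, hP, hst₁, hN⟩ hb
      simp only [BExpr.holds, NExpr.eval, hu, hP] at hb
      refine Runs.mono (Runs.of_wp (p := dfsStep) (Q := fun σ' => ∃ n' < N,
        ∃ (u : Fin I.n) (P : List (Fin I.m)), σ'.nv 8 = u ∧ σ'.nv 9 = P.length ∧
        I.DFSState f₀ lev (σ.nv 12) (σ'.na 9) (σ'.na 10) (σ'.na 6) (σ'.na 11) u P (σ'.nv 12) ∧
        n' = 2 * R (σ'.na 9) + P.length) ?_)
        (by simp [Prog.bound, BExpr.cost, NExpr.cost, dfsStep, toggleProg]) fun _ _ h => h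
      have c3 : σ₁.nv 3 = I.s := by rw [ha.nv 3 (by decide), hs]
      have c4 : σ₁.nv 4 = I.t := by rw [ha.nv 4 (by decide), ht]
      have c5 : σ₁.na 5 = lev := by rw [ha.na 5 (by decide), hlev]
      have c7 : ∀ e : Fin I.m, σ₁.na 7 e = (I.resid f₀).src e := by
        rw [ha.na 7 (by decide)]; exact hsrc
      have c8 : ∀ e : Fin I.m, σ₁.na 8 e = (I.resid f₀).tgt e := by
        rw [ha.na 8 (by decide)]; exact htgt
      simp only [dfsStep, toggleProg, Prog.wp, BExpr.holds, NExpr.eval, hu, c4]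
      refine ⟨fun h1 => ?_, fun h1 => ⟨fun h2 => ?_, fun h2 => ?_⟩⟩
      · have hut : u = I.t := Fin.ext (le_antisymm h1.1 h1.2)
        refine ⟨_, ?_, I.s, [], by simp [c3], by simp, by simpa using hst₁.arrive hlev_s hut, rfl⟩
        have : P ≠ [] := by
          rintro rfl
          exact hst ((show I.s = u from hst₁.walk).trans hut)
        have := List.length_pos_of_ne_nil this
        simp
        omega
      · have hut : u ≠ I.t := fun h => h1 (by simp [h])
        have hne : P ≠ [] := by
          rintro rfl
          exact hb ⟨le_rfl, h2⟩
        obtain ⟨P', e, rfl⟩ : ∃ P' e, P = P' ++ [e] := by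
          obtain h | ⟨P', e, h⟩ := List.eq_nil_or_concat P
          · exact absurd h hne
          · exact ⟨P', e, by rw [h, List.concat_eq_append]⟩
        have hstk : σ₁.na 11 P'.length = e := by
          have := hst₁.stack P'.length (by simp)
          simpa using this
        have := hst₁.pop hf₀ hut (by omega)
        have hc := c7 e
        simp only [List.length_append, List.length_singleton] at hP hN
        refine ⟨_, ?_, (I.resid f₀).src e, P', by simp [hP, hstk, hc], by simp [hP],
          by simpa [hP, hstk] using this, rfl⟩
        simp
        omega
      · obtain ⟨e, he, hsrc', hhd, hlk, hlt⟩ := hst₁.linked.consume (x := u) (by omega)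
        have hcard := card_remaining_consume he (by rw [hsrc']; omega) hlt
        rw [← hR, ← hR] at hcard
        have h0 : ∀ x, σ₁.na 9 x = 0 → Function.update (σ₁.na 9) u (σ₁.na 10 e) x = 0 := by
          intro x hx
          rw [Function.update_of_ne]
          · exact hx
          · rintro rfl
            omega
        have hc := c8 e
        have hadm : (lev ((I.resid f₀).tgt e) ≤ lev u + 1 ∧ lev u + 1 ≤ lev ((I.resid f₀).tgt e)) ↔
            lev ((I.resid f₀).tgt e) = lev ((I.resid f₀).src e) + 1 := by
          rw [hsrc']; omega
        refine ⟨fun h3 => ?_, fun h3 => ?_⟩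
        all_goals
          simp only [Mem.setN_nv_same, Mem.setN_na, Mem.putN_nv,
            Mem.putN_na_ne _ _ _ _ _ (show (5 : ℕ) ≠ 9 by decide),
            Mem.putN_na_ne _ _ _ _ _ (show (8 : ℕ) ≠ 9 by decide),
            Mem.setN_nv_ne _ _ _ _ (show (8 : ℕ) ≠ 11 by decide), hu, hhd, c5, hc,
            Nat.add_sub_cancel, hadm] at h3
        · have := hst₁.push hf₀ hlk hlt h0 he hsrc' (by omega) h3
          refine ⟨_, ?_, (I.resid f₀).tgt e, P ++ [e], by simp [hhd, hc, hu], by simp [hP],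
            by simpa [hhd, hu, hP] using this, rfl⟩
          simp [hu, hhd]
          omega
        · have := hst₁.skip hlk hlt h0 fun _ => h3
          refine ⟨_, ?_, u, P, by simp [hu], by simp [hP], by simpa [hhd, hu] using this, rfl⟩
          simp [hu, hhd]
          omega)
    _ ⟨I.s, [], hu, hsp, by
      refine ⟨hl, by rwa [hf], rfl, by simp, by simp, by simp, fun x => ?_, ?_, by omega, ?_,
        le_rfl, ?_⟩
      · rw [hf, hval x]; ring
      · intro e he; simp [hf] at he
      · intro e hT hle
        have := hfull e hT
        omega
      · intro _ e he; simp [hf] at he, rfl⟩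
  refine Runs.mono key ?_ fun σ' _ h => ?_
  · have : R (σ.na 9) ≤ I.m := by
      rw [hR]
      exact I.card_edgesWhere_le _
    refine (Nat.mul_le_mul (n₂ := 2 * I.m + 1) (m₂ := 100) ?_ ?_).trans (by omega)
    · simp; omega
    · simp [BExpr.cost, NExpr.cost]
  · obtain ⟨⟨N, u, P, hu, hP, h1, -⟩, h2⟩ := h
    simp only [BExpr.holds, NExpr.eval, not_not, hu, hP] at h2
    obtain rfl : P = [] := List.length_eq_zero_iff.1 (by omega)
    exact h1.isBlocked hst (by omega)

end Instance

/-! ## Maximum flows -/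

/-- Write the tails and heads of the edges of the residual graph to the arrays `7` and `8`. -/
def residProg : Prog :=
  .for 7 1 <| .ite (.nle (.cell 6 (.reg 7)) (.const 0))
    (.seq (.nput 7 (.reg 7) (.cell 0 (.reg 7))) (.nput 8 (.reg 7) (.cell 1 (.reg 7))))
    (.seq (.nput 7 (.reg 7) (.cell 1 (.reg 7))) (.nput 8 (.reg 7) (.cell 0 (.reg 7))))

/-- A phase of the flow algorithm: augment by a blocking flow, or find that the flow is maximal and
set register `13`. -/
def phaseProg : Prog :=
  .seq residProg <| .seq (linkProg 4 7) <| .seq bfsProg <|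
    .ite (.nle (.cell 5 (.reg 4)) (.const 0)) (.nset 13 (.const 1)) <|
      .seq (linkProg 4 7) <| .seq (.seq (.nset 8 (.reg 3)) (.nset 9 (.const 0))) dfsLoop

/-- Mark the tight edges in array `4`, and start with the zero flow. -/
def markProg : Prog :=
  .for 7 1 <| .seq (.nput 6 (.reg 7) (.const 0)) <|
    .ite (.and
        (.rle (.add (.add (.cell 2 (.cell 0 (.reg 7))) (.cell 1 (.reg 7)))
          (.cell 3 (.cell 1 (.reg 7)))) (.cell 2 (.reg 4)))
        (.rle (.cell 2 (.reg 4)) (.add (.add (.cell 2 (.cell 0 (.reg 7))) (.cell 1 (.reg 7)))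
          (.cell 3 (.cell 1 (.reg 7))))))
      (.nput 4 (.reg 7) (.const 1)) (.nput 4 (.reg 7) (.const 0))

/-- Phases are carried out until the value of the flow is large enough or the flow is maximal. -/
def phasesLoop : Prog :=
  .loop (.and (.nlt (.reg 12) (.reg 5)) (.nle (.reg 13) (.const 0))) phaseProg

/-- Find a flow of value at least `k`, or a maximum flow. -/
def flowProg : Prog :=
  .seq markProg <| .seq (.seq (.nset 12 (.const 0)) (.nset 13 (.const 0))) phasesLoop

namespace Instance

/-- The tight edges are marked in array `4`. -/
def Marked (I : Instance) (σ : Mem) : Prop :=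
  ∀ e : Fin I.m, 1 ≤ σ.na 4 e ↔ I.Tight e

theorem runs_residProg {I : Instance} {σ : Mem} (h : I.Holds σ) :
    Runs residProg σ (40 * (I.m + 1)) fun σ' => ∀ e : Fin I.m,
      σ'.na 7 e = (I.resid (σ.na 6)).src e ∧ σ'.na 8 e = (I.resid (σ.na 6)).tgt e := by
  have key := Runs.for_wp (x := 7) (y := 1) (σ₀ := σ)
    (body := .ite (.nle (.cell 6 (.reg 7)) (.const 0))
      (.seq (.nput 7 (.reg 7) (.cell 0 (.reg 7))) (.nput 8 (.reg 7) (.cell 1 (.reg 7))))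
      (.seq (.nput 7 (.reg 7) (.cell 1 (.reg 7))) (.nput 8 (.reg 7) (.cell 0 (.reg 7)))))
    (fun i σ' => ∀ e : Fin I.m, (e : ℕ) < i →
      σ'.na 7 e = (I.resid (σ.na 6)).src e ∧ σ'.na 8 e = (I.resid (σ.na 6)).tgt e)
    (by decide) (by decide) (by decide) (by simp) (by
      intro i σ₁ hi ha hx hinv
      have hh := h.of_agree ha (by decide) (by decide) (by decide) (by decide)
      have c6 : σ₁.na 6 = σ.na 6 := ha.na 6 (by decide)
      simp only [Prog.wp, BExpr.holds, NExpr.eval, hx, c6]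
      refine ⟨fun h1 e he => ?_, fun h1 e he => ?_⟩
      all_goals
        by_cases hei : (e : ℕ) = i
        · have h2 := hh.src_eq e
          have h3 := hh.tgt_eq e
          subst hei
          simp at h1
          simp [h1, h2, h3, hx]
        · have h2 := hinv e (by omega)
          simpa [hx, hei] using h2)
  rw [h.m_eq] at key
  refine key.mono ?_ fun σ' _ hσ' e => hσ' e e.2
  rw [mul_comm]
  exact Nat.mul_le_mul_right _ (by simp [Prog.bound, BExpr.cost, NExpr.cost])

theorem runs_markProg {I : Instance} {σ : Mem} (h : I.HoldsDist σ) :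
    Runs markProg σ (60 * (I.m + 1)) fun σ' => I.Marked σ' ∧ ∀ e : Fin I.m, σ'.na 6 e = 0 := by
  have key := Runs.for_wp (x := 7) (y := 1) (σ₀ := σ)
    (body := .seq (.nput 6 (.reg 7) (.const 0)) <|
    .ite (.and
        (.rle (.add (.add (.cell 2 (.cell 0 (.reg 7))) (.cell 1 (.reg 7)))
          (.cell 3 (.cell 1 (.reg 7)))) (.cell 2 (.reg 4)))
        (.rle (.cell 2 (.reg 4)) (.add (.add (.cell 2 (.cell 0 (.reg 7))) (.cell 1 (.reg 7)))
          (.cell 3 (.cell 1 (.reg 7))))))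
      (.nput 4 (.reg 7) (.const 1)) (.nput 4 (.reg 7) (.const 0)))
    (fun i σ' => ∀ e : Fin I.m, (e : ℕ) < i → (1 ≤ σ'.na 4 e ↔ I.Tight e) ∧ σ'.na 6 e = 0)
    (by decide) (by decide) (by decide) (by simp) (by
      intro i σ₁ hi ha hx hinv
      rw [h.m_eq] at hi
      obtain ⟨e, rfl⟩ : ∃ e : Fin I.m, (e : ℕ) = i := ⟨⟨i, hi⟩, rfl⟩
      have hh := h.toHolds.of_agree ha (by decide) (by decide) (by decide) (by decide)
      have hT : (σ₁.ra 2 (σ₁.na 0 e) + σ₁.ra 1 e + σ₁.ra 3 (σ₁.na 1 e) ≤ σ₁.ra 2 (σ₁.nv 4) ∧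
          σ₁.ra 2 (σ₁.nv 4) ≤ σ₁.ra 2 (σ₁.na 0 e) + σ₁.ra 1 e + σ₁.ra 3 (σ₁.na 1 e)) ↔
          I.Tight e := by
        rw [hh.src_eq, hh.tgt_eq, hh.t_eq, ha.ra 1 (by decide), ha.ra 2 (by decide),
          ha.ra 3 (by decide), h.agg_eq, h.from_eq, h.from_eq, h.to_eq, ← le_antisymm_iff]
        rfl
      simp only [Prog.wp, BExpr.holds, NExpr.eval, RExpr.eval, Mem.putN_ra, Mem.putN_nv, hx,
        Mem.putN_na_ne _ _ _ _ _ (show (0 : ℕ) ≠ 6 by decide),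
        Mem.putN_na_ne _ _ _ _ _ (show (1 : ℕ) ≠ 6 by decide), hT]
      refine ⟨fun h1 e' he' => ?_, fun h1 e' he' => ?_⟩
      all_goals
        by_cases hei : e' = e
        · subst hei
          simp [h1]
        · have hne : (e' : ℕ) ≠ e := fun h => hei (Fin.ext h)
          have h2 := hinv e' (by omega)
          simpa [hne] using h2)
  rw [h.m_eq] at key
  refine key.mono ?_ fun σ' _ hσ' => ⟨fun e => (hσ' e e.2).1, fun e => (hσ' e e.2).2⟩
  rw [mul_comm]
  exact Nat.mul_le_mul_right _ (by simp [Prog.bound, BExpr.cost, NExpr.cost, RExpr.cost])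

/-- If `t` gets no level, the nodes with a level form a cut that no residual edge leaves, which
certifies maximality. Otherwise the depth-first search yields a blocking flow. -/
theorem runs_phaseProg {I : Instance} (hst : I.s ≠ I.t) (hm1 : 1 ≤ I.m) (hn : I.n ≤ 2 * I.m)
    {σ : Mem} (h : I.Holds σ) (hmark : I.Marked σ) (hf : I.IsUnit (σ.na 6))
    (hv : I.HasValue (σ.na 6) (σ.nv 12)) (h13 : σ.nv 13 = 0) :
    Runs phaseProg σ (3000 * I.m) fun σ' =>
      (σ'.nv 13 = 1 ∧ σ'.na 6 = σ.na 6 ∧ σ'.nv 12 = σ.nv 12 ∧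
        ∃ S, I.s ∈ S ∧ I.t ∉ S ∧ I.cutCard S = σ.nv 12) ∨
      (σ'.nv 13 = 0 ∧ ∃ lev : ℕ → ℕ, (I.resid (σ.na 6)).IsLevel I.Tight lev ∧ lev I.t ≠ 0 ∧
        I.Blocked (σ.na 6) lev (σ.nv 12) (σ'.na 6) (σ'.nv 12)) := by
  classical
  refine Runs.mono (B := 40 * (I.m + 1) + (50 * (I.n + I.m + 1) + (300 * (I.n + I.m + 1) +
    (5 + (50 * (I.n + I.m + 1) + (4 + 200 * (I.m + 1))))))) (Q := fun σ' =>
      (σ'.nv 13 = 1 ∧ σ'.na 6 = σ.na 6 ∧ σ'.nv 12 = σ.nv 12 ∧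
        ∃ S, I.s ∈ S ∧ I.t ∉ S ∧ I.cutCard S = σ.nv 12) ∨
      (σ'.nv 13 = 0 ∧ ∃ lev : ℕ → ℕ, (I.resid (σ.na 6)).IsLevel I.Tight lev ∧ lev I.t ≠ 0 ∧
        I.Blocked (σ.na 6) lev (σ.nv 12) (σ'.na 6) (σ'.nv 12))) ?_ (by omega) fun _ _ h => h
  refine (runs_residProg h).seq fun σ₁ ha₁ hres => ?_
  have hh₁ := h.of_agree ha₁ (by decide) (by decide) (by decide) (by decide)
  have hmark₁ : ∀ e : Fin I.m, 1 ≤ σ₁.na 4 e ↔ I.Tight e := by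
    rw [ha₁.na 4 (by decide)]; exact hmark
  refine (runs_linkProg (T := (I.resid (σ.na 6)).src) (by decide) (by decide) hh₁.n_eq hh₁.m_eq
    hmark₁ fun e => (hres e).1).seq fun σ₂ ha₂ hlk => ?_
  have hh₂ := hh₁.of_agree ha₂ (by decide) (by decide) (by decide) (by decide)
  have e8 : σ₂.na 8 = σ₁.na 8 := ha₂.na 8 (by decide)
  refine (runs_bfsProg (J := I.resid (σ.na 6)) hh₂.n_eq hh₂.s_eq
    (fun e => by rw [e8]; exact (hres e).2) hlk.1 hlk.2).seq fun σ₃ ha₃ hlev => ?_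
  have hh₃ := hh₂.of_agree ha₃ (by decide) (by decide) (by decide) (by decide)
  have e6 : σ₃.na 6 = σ.na 6 := by
    rw [ha₃.na 6 (by decide), ha₂.na 6 (by decide), ha₁.na 6 (by decide)]
  have e12 : σ₃.nv 12 = σ.nv 12 := by
    rw [ha₃.nv 12 (by decide), ha₂.nv 12 (by decide), ha₁.nv 12 (by decide)]
  have e13 : σ₃.nv 13 = 0 := by
    rw [ha₃.nv 13 (by decide), ha₂.nv 13 (by decide), ha₁.nv 13 (by decide), h13]
  refine Runs.ite (b := .nle (.cell 5 (.reg 4)) (.const 0)) (fun hb => ?_) fun hb => ?_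
  all_goals simp only [BExpr.holds, NExpr.eval, hh₃.t_eq] at hb
  · refine Runs.mono (Runs.of_wp (p := .nset 13 (.const 1)) (Q := fun σ' => σ'.nv 13 = 1 ∧
      σ'.na 6 = σ.na 6 ∧ σ'.nv 12 = σ.nv 12) ?_) ?_ fun σ' _ hσ' => ?_
    · simp [Prog.wp, NExpr.eval, e6, e12]
    · simp [Prog.bound, NExpr.cost]
      omega
    · refine .inl ⟨hσ'.1, hσ'.2.1, hσ'.2.2, Finset.univ.filter fun x => σ₃.na 5 x ≠ 0, ?_, ?_, ?_⟩
      · have := hlev.lev_s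
        simp [this]
      · simp
        omega
      · refine cutCard_eq_value hf hv ?_ ?_ fun e hT hs => ?_
        · have := hlev.lev_s
          simp [this]
        · simp
          omega
        · simp only [Finset.mem_filter, Finset.mem_univ, true_and] at hs ⊢
          exact (hlev.closed e hT hs).1
  · have hmark₃ : ∀ e : Fin I.m, 1 ≤ σ₃.na 4 e ↔ I.Tight e := by
      rw [ha₃.na 4 (by decide), ha₂.na 4 (by decide)]; exact hmark₁
    have e7 : σ₃.na 7 = σ₁.na 7 := by rw [ha₃.na 7 (by decide), ha₂.na 7 (by decide)]
    have e8' : σ₃.na 8 = σ₁.na 8 := by rw [ha₃.na 8 (by decide), e8]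
    -- The lists are built anew, because breadth-first search has consumed them.
    refine (runs_linkProg (T := (I.resid (σ.na 6)).src) (by decide) (by decide) hh₃.n_eq hh₃.m_eq
      hmark₃ fun e => by rw [e7]; exact (hres e).1).seq fun σ₄ ha₄ hlk₄ => ?_
    have hh₄ := hh₃.of_agree ha₄ (by decide) (by decide) (by decide) (by decide)
    refine Runs.seq (Q := fun σ' => σ'.nv 8 = I.s ∧ σ'.nv 9 = 0) (B := 4)
      (Runs.of_wp (p := .seq (.nset 8 (.reg 3)) (.nset 9 (.const 0)))
        (by simp [Prog.wp, NExpr.eval, hh₄.s_eq])) fun σ₅ ha₅ h5 => ?_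
    have hh₅ := hh₄.of_agree ha₅ (by decide) (by decide) (by decide) (by decide)
    have f12 : σ₅.nv 12 = σ.nv 12 := by
      rw [ha₅.nv 12 (by decide), ha₄.nv 12 (by decide), e12]
    have f9 : σ₅.na 9 = σ₄.na 9 := ha₅.na 9 (by decide)
    have f10 : σ₅.na 10 = σ₄.na 10 := ha₅.na 10 (by decide)
    have f7 : σ₅.na 7 = σ₁.na 7 := by
      rw [ha₅.na 7 (by decide), ha₄.na 7 (by decide), e7]
    have f8 : σ₅.na 8 = σ₁.na 8 := by
      rw [ha₅.na 8 (by decide), ha₄.na 8 (by decide), e8']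
    have f5 : σ₅.na 5 = σ₃.na 5 := by
      rw [ha₅.na 5 (by decide), ha₄.na 5 (by decide)]
    have f6 : σ₅.na 6 = σ.na 6 := by
      rw [ha₅.na 6 (by decide), ha₄.na 6 (by decide), e6]
    have f13 : σ₅.nv 13 = 0 := by
      rw [ha₅.nv 13 (by decide), ha₄.nv 13 (by decide), e13]
    refine (runs_dfsLoop hst hf hh₅.s_eq hh₅.t_eq f5 (fun e => by rw [f7]; exact (hres e).1)
      (fun e => by rw [f8]; exact (hres e).2) hlev.lev_s f6 (by rw [f9, f10]; exact hlk₄.1)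
      (by rw [f9]; exact hlk₄.2) (by rw [f12]; exact hv) h5.1 h5.2).imp fun σ' ha' hσ' => ?_
    rw [f12] at hσ'
    exact .inr ⟨by rw [ha'.nv 13 (by decide), f13], σ₃.na 5, hlev, by omega, hσ'⟩

/-- If no path had been completed, the flow would be unchanged. Then the walk found by breadth-first
search, with `lev t - 1` edges, would still be residual and too short for `le_length_of_blocking`.
-/
theorem Blocked.value_lt {I : Instance} {f₀ lev f : ℕ → ℕ} {v₀ v : ℕ} (hf₀ : I.IsUnit f₀)
    (hlev : (I.resid f₀).IsLevel I.Tight lev) (ht : lev I.t ≠ 0)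
    (h : I.Blocked f₀ lev v₀ f v) : v₀ < v := by
  refine lt_of_le_of_ne h.v₀_le fun hv => ?_
  obtain ⟨X, hs, ht', hX⟩ := h.blocked
  obtain ⟨P, hP, hT, hl⟩ := hlev.walk I.t ht
  have hw : ∀ (P : List (Fin I.m)) (u : Fin I.n), (I.resid f₀).IsWalk u I.t P →
      (I.resid f).IsWalk u I.t P := by
    intro P
    induction P with
    | nil => exact fun u hu => hu
    | cons e P ih =>
      rintro u ⟨h1, h2⟩
      obtain ⟨e1, e2⟩ := resid_src_congr (I := I) (h.first hv.symm e)
      exact ⟨e1.trans h1, by rw [e2]; exact ih _ h2⟩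
  have := le_length_of_blocking (lev := fun x => lev x) hf₀ h.isUnit hlev.lev_s hlev.closed h.flip
    hs ht' hX (P := P) (hw P I.s hP) hT
  omega

/-- Some old residual walk has `lev t - 1` edges, so `lev t ≥ j + 1`, and no new residual walk has
fewer than `lev t` edges. -/
theorem Blocked.far {I : Instance} {f₀ lev f : ℕ → ℕ} {v₀ v j : ℕ} (hf₀ : I.IsUnit f₀)
    (hlev : (I.resid f₀).IsLevel I.Tight lev) (ht : lev I.t ≠ 0)
    (h : I.Blocked f₀ lev v₀ f v)
    (hfar : ∀ P, (I.resid f₀).IsWalk I.s I.t P → (∀ e ∈ P, I.Tight e) → j ≤ P.length)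
    (P : List (Fin I.m)) (hP : (I.resid f).IsWalk I.s I.t P) (hT : ∀ e ∈ P, I.Tight e) :
    j + 1 ≤ P.length := by
  obtain ⟨X, hs, ht', hX⟩ := h.blocked
  obtain ⟨R, hR, hTR, hl⟩ := hlev.walk I.t ht
  have h1 := hfar R hR hTR
  have h2 := le_length_of_blocking (lev := fun x => lev x) hf₀ h.isUnit hlev.lev_s hlev.closed
    h.flip hs ht' hX hP hT
  omega

theorem runs_flowProg {I : Instance} (hst : I.s ≠ I.t) (hm1 : 1 ≤ I.m) (hn : I.n ≤ 2 * I.m)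
    {σ : Mem} (h : I.HoldsDist σ) :
    Runs flowProg σ (3500 * ((min I.k (2 * (Nat.sqrt I.m + 1)) + 1) * I.m)) fun σ' =>
      I.IsUnit (σ'.na 6) ∧ I.HasValue (σ'.na 6) (σ'.nv 12) ∧
      (I.k ≤ σ'.nv 12 ∨ ∃ S, I.s ∈ S ∧ I.t ∉ S ∧ I.cutCard S < I.k) := by
  set L := Nat.sqrt I.m + 1 with hL
  have hmL : I.m < L * L := Nat.lt_succ_sqrt I.m
  set N := min I.k (2 * L) with hN
  refine Runs.mono (B := 60 * (I.m + 1) + (4 + (N + 1) * (3000 * I.m + 9 + 1))) (Q := fun σ' =>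
      I.IsUnit (σ'.na 6) ∧ I.HasValue (σ'.na 6) (σ'.nv 12) ∧
      (I.k ≤ σ'.nv 12 ∨ ∃ S, I.s ∈ S ∧ I.t ∉ S ∧ I.cutCard S < I.k)) ?_ ?_ fun _ _ h => h
  swap
  · have : N ≤ N * I.m := Nat.le_mul_of_pos_right _ hm1
    ring_nf at this ⊢
    omega
  refine (runs_markProg h).seq fun σ₁ ha₁ hmark => ?_
  have hh₁ := h.toHolds.of_agree ha₁ (by decide) (by decide) (by decide) (by decide)
  refine Runs.seq (Q := fun σ' => σ'.nv 12 = 0 ∧ σ'.nv 13 = 0) (B := 4)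
    (Runs.of_wp (p := .seq (.nset 12 (.const 0)) (.nset 13 (.const 0)))
      (by simp [Prog.wp, NExpr.eval])) fun σ₂ ha₂ h2 => ?_
  have hh₂ := hh₁.of_agree ha₂ (by decide) (by decide) (by decide) (by decide)
  have e4 : σ₂.na 4 = σ₁.na 4 := ha₂.na 4 (by decide)
  have e6 : ∀ e : Fin I.m, σ₂.na 6 e = 0 := by
    rw [ha₂.na 6 (by decide)]; exact hmark.2
  -- Here `j` counts the phases, and both the value and the residual distance are at least `j`. From
  -- phase `L` on one cut is kept; as each phase adds at least one unit, its slack over the value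
  -- shrinks with `j - L`.
  have key := Runs.loop (b := .and (.nlt (.reg 12) (.reg 5)) (.nle (.reg 13) (.const 0)))
    (B := 3000 * I.m) (σ₀ := σ₂) (p := phaseProg)
    (fun n σ' => I.IsUnit (σ'.na 6) ∧ I.HasValue (σ'.na 6) (σ'.nv 12) ∧
      ((σ'.nv 13 = 0 ∧ ∃ j, n = N - j ∧ j ≤ σ'.nv 12 ∧
        (∀ P, (I.resid (σ'.na 6)).IsWalk I.s I.t P → (∀ e ∈ P, I.Tight e) → j ≤ P.length) ∧
        (L ≤ j → ∃ S, I.s ∈ S ∧ I.t ∉ S ∧ I.cutCard S + (j - L) < σ'.nv 12 + L)) ∨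
      (σ'.nv 13 = 1 ∧ n = 0 ∧ ∃ S, I.s ∈ S ∧ I.t ∉ S ∧ I.cutCard S = σ'.nv 12)))
    (by
      rintro n σ₃ ha₃ ⟨hf, hv, hor⟩ hb
      have hh₃ := hh₂.of_agree ha₃ (by decide) (by decide) (by decide) (by decide)
      have hmark₃ : I.Marked σ₃ := by
        rw [Marked, ha₃.na 4 (by decide), e4]; exact hmark.1
      simp only [BExpr.holds, NExpr.eval, hh₃.k_eq, not_le, nonpos_iff_eq_zero] at hb
      refine (runs_phaseProg hst hm1 hn hh₃ hmark₃ hf hv hb.2).imp fun σ₄ _ h4 => ?_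
      obtain ⟨-, j, hj, hjv, hfar, hcut⟩ | ⟨h13, -⟩ := hor
      swap
      · omega
      have hjN : j < N := by
        -- The loop test gives `j ≤ v < k`. If `j` were at least `2 * L`, the cut kept since phase
        -- `L` would be smaller than the value.
        refine lt_min (by omega) ?_
        by_contra hcon
        obtain ⟨S, hs, ht, hS⟩ := hcut (by omega)
        have := value_le_cutCard hf hv hs ht
        omega
      rcases h4 with ⟨g13, g6, g12, hS⟩ | ⟨g13, lev, hlev, ht, hbl⟩
      · exact ⟨0, by omega, by rwa [g6], by rwa [g6, g12], .inr ⟨g13, rfl, by rwa [g12]⟩⟩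
      · have hlt := hbl.value_lt hf hlev ht
        have hfar' := hbl.far hf hlev ht hfar
        refine ⟨N - (j + 1), by omega, hbl.isUnit, hbl.hasValue,
          .inl ⟨g13, j + 1, rfl, by omega, hfar', fun hLj => ?_⟩⟩
        by_cases hLj' : L ≤ j
        · obtain ⟨S, hs, ht, hS⟩ := hcut hLj'
          exact ⟨S, hs, ht, by omega⟩
        · have hLe : j + 1 = L := by omega
          rw [hLe] at hfar' ⊢
          obtain ⟨S, hs, ht, hS⟩ := exists_cut_of_far hbl.isUnit hbl.hasValue hmL hfar'
          exact ⟨S, hs, ht, by omega⟩)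
    N ⟨⟨fun e => by rw [e6]; omega, fun e he => absurd (e6 e) he⟩, fun x => by
      simp [e6, net_zero, h2.1], .inl ⟨h2.2, 0, by simp, by omega, by simp, by omega⟩⟩
  refine Runs.mono key ?_ fun σ' ha' hσ' => ?_
  · simp [BExpr.cost, NExpr.cost]
  · obtain ⟨⟨n, hf, hv, hor⟩, hb⟩ := hσ'
    have hh := hh₂.of_agree ha' (by decide) (by decide) (by decide) (by decide)
    simp only [BExpr.holds, NExpr.eval, hh.k_eq, not_le, nonpos_iff_eq_zero] at hb
    refine ⟨hf, hv, ?_⟩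
    by_cases hk : I.k ≤ σ'.nv 12
    · exact .inl hk
    · refine .inr ?_
      rcases hor with hor | ⟨-, -, S, h1, h2, h3⟩
      · exact absurd ⟨not_le.1 hk, hor.1⟩ hb
      · exact ⟨S, h1, h2, by omega⟩

end Instance

/-! ## Extraction of the paths -/

/-- Follow the edges with flow from the current node to the destination, and remove them from their
lists. Array `12` holds the last edge by which each node was left. -/
def walkLoop : Prog :=
  .loop (.not (.neq (.reg 8) (.reg 4))) <|
    .seq (.nset 11 (.sub (.cell 9 (.reg 8)) (.const 1))) <|
    .seq (.nput 9 (.reg 8) (.cell 10 (.reg 11))) <|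
    .seq (.nput 12 (.reg 8) (.reg 11)) (.nset 8 (.cell 1 (.reg 11)))

/-- Follow the edges in array `12` from the current node to the destination, and write them to the
output. -/
def outputLoop : Prog :=
  .loop (.not (.neq (.reg 8) (.reg 4))) <|
    .seq (.nset 11 (.cell 12 (.reg 8))) <| .seq (.nput 3 (.reg 14) (.reg 11)) <|
    .seq (.nset 14 (.add (.reg 14) (.const 1))) (.nset 8 (.cell 1 (.reg 11)))

/-- Extract a path. -/
def pathProg : Prog :=
  .seq (.nset 8 (.reg 3)) <| .seq walkLoop <| .seq (.nset 8 (.reg 3)) <| .seq outputLoop <|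
    .seq (.nset 15 (.add (.reg 15) (.const 1))) (.nput 2 (.reg 15) (.reg 14))

/-- Extract `k` paths from the flow in array `6`. -/
def extractProg : Prog :=
  .seq (linkProg 6 0) <| .seq
    (.seq (.nput 2 (.const 0) (.const 0)) <| .seq (.nset 14 (.const 0)) (.nset 15 (.const 0))) <|
    .loop (.nlt (.reg 15) (.reg 5)) pathProg

namespace Instance

/-- The net flow out of `x` if each edge of `F` carries a unit of flow. -/
def netOf (I : Instance) (F : Finset (Fin I.m)) (x : Fin I.n) : ℤ :=
  I.net (fun e => if e ∈ F then 1 else 0) x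

theorem netOf_erase {I : Instance} {F : Finset (Fin I.m)} {e : Fin I.m} (he : e ∈ F)
    (x : Fin I.n) : I.netOf (F.erase e) x =
      I.netOf F x - (if I.src e = x then 1 else 0) + if I.tgt e = x then 1 else 0 := by
  have : (fun e' => if e' ∈ F.erase e then (1 : ℤ) else 0) =
      fun e' => (if e' ∈ F then (1 : ℤ) else 0) + if e' = e then -1 else 0 := by
    ext e'
    by_cases h : e' = e
    · subst h; simp [he]
    · simp [h]
  rw [netOf, this, net_add, net_single, netOf]
  split_ifs <;> ring

theorem exists_mem_of_netOf_pos {I : Instance} {F : Finset (Fin I.m)} {x : Fin I.n}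
    (h : 0 < I.netOf F x) : ∃ e ∈ F, I.src e = x := by
  by_contra! hcon
  have h1 : ∑ e with I.src e = x, (if e ∈ F then (1 : ℤ) else 0) = 0 := by
    refine Finset.sum_eq_zero fun e he => ?_
    rw [if_neg fun heF => hcon e heF (Finset.mem_filter.1 he).2]
  have h2 : 0 ≤ ∑ e with I.tgt e = x, (if e ∈ F then (1 : ℤ) else 0) :=
    Finset.sum_nonneg fun e _ => by split_ifs <;> simp
  rw [netOf, net, h1] at h
  omega

/-! ### Walks along the flow -/

/-- The state of a walk of `i` steps from `s` to `u` along the edges of a flow, where `hd₀` were the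
first elements of the lists at the beginning; `τ x` is the time when node `x` was left for the last
time, by edge `last x`. -/
structure WalkState (I : Instance) (F : Fin I.m → Prop) (hd₀ : ℕ → ℕ) (r : ℕ) (hd nxt last : ℕ → ℕ)
    (u : Fin I.n) (τ : Fin I.n → ℕ) (i : ℕ) : Prop where
  linked : Linked F I.src hd nxt
  subset : I.remaining F I.src hd ⊆ I.remaining F I.src hd₀
  net : ∀ x, I.netOf (I.remaining F I.src hd) x =
    (if I.s = x then (r : ℤ) else 0) - (if I.t = x then (r : ℤ) + 1 else 0) +
      if u = x then 1 else 0
  last_spec : ∀ x : Fin I.n, τ x ≠ 0 → ∃ e : Fin I.m, last x = e ∧ I.src e = x ∧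
    e ∈ I.remaining F I.src hd₀ ∧ e ∉ I.remaining F I.src hd ∧
    (I.tgt e = u ∨ τ x < τ (I.tgt e))
  le : ∀ x, τ x ≤ i
  source : I.s = u ∨ τ I.s ≠ 0
  card : i + (I.remaining F I.src hd).card = (I.remaining F I.src hd₀).card

/-- The remaining edges carry `r` units from `s` to `t` and one more from `u` to `t`. So the net
flow out of `u ≠ t` is positive, and some remaining edge leaves `u`. -/
theorem WalkState.step {I : Instance} {F : Fin I.m → Prop} {hd₀ : ℕ → ℕ} {r : ℕ}
    {hd nxt last : ℕ → ℕ} {u : Fin I.n} {τ : Fin I.n → ℕ} {i : ℕ}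
    (h : I.WalkState F hd₀ r hd nxt last u τ i) (hu : u ≠ I.t) :
    ∃ e : Fin I.m, hd u = e + 1 ∧ I.WalkState F hd₀ r (Function.update hd u (nxt e)) nxt
      (Function.update last u e) (I.tgt e) (Function.update τ u (i + 1)) (i + 1) := by
  have hpos : 0 < I.netOf (I.remaining F I.src hd) u := by
    rw [h.net u, if_neg hu.symm]
    split_ifs <;> omega
  obtain ⟨e₀, he₀, hs₀⟩ := exists_mem_of_netOf_pos hpos
  obtain ⟨e, he, hsrc, hhd, hlk, hlt⟩ := h.linked.consume (x := u) (by
    have := (mem_remaining.1 he₀).2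
    rw [hs₀] at this
    omega)
  have heR : e ∈ I.remaining F I.src hd := mem_remaining.2 ⟨he, by rw [hsrc]; omega⟩
  have hR := remaining_consume hlt
  have hcard := card_remaining_consume he (by rw [hsrc]; omega) hlt
  refine ⟨e, hhd, hlk, ?_, fun x => ?_, fun x hx => ?_, fun x => ?_, .inr ?_, ?_⟩
  · rw [hR]
    exact fun e' he' => h.subset (Finset.mem_of_mem_erase he')
  · rw [hR, netOf_erase heR, h.net x, hsrc]
    ring
  · by_cases hxu : x = u
    · subst hxu
      refine ⟨e, by simp, hsrc, h.subset heR, ?_, .inl rfl⟩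
      rw [hR]
      simp
    · rw [Function.update_of_ne hxu] at hx
      obtain ⟨e', h1, h2, h3, h4, h5⟩ := h.last_spec x hx
      refine ⟨e', by rw [update_fin_ne _ hxu, h1], h2, h3, ?_, .inr ?_⟩
      · rw [hR]
        exact fun h => h4 (Finset.mem_of_mem_erase h)
      · rw [Function.update_of_ne hxu]
        by_cases htu : I.tgt e' = u
        -- An edge that led to the current node `u` now leads to a node left at time `i + 1`, later
        -- than all previous departures.
        · rw [htu, Function.update_self]
          have := h.le x
          omega
        · rw [Function.update_of_ne htu]
          exact h5.resolve_left htu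
  · by_cases hxu : x = u
    · subst hxu
      simp
    · rw [Function.update_of_ne hxu]
      have := h.le x
      omega
  · by_cases hsu : I.s = u
    · rw [hsu, Function.update_self]
      omega
    · rw [Function.update_of_ne hsu]
      exact h.source.resolve_left hsu
  · have := h.card
    omega

/-- The cost is stated in terms of the actual number `i` of steps, which equals the number of
removed edges, to allow amortization over all paths. -/
theorem exec_walkLoop {I : Instance} {F : Fin I.m → Prop} {r : ℕ} {σ : Mem} (h : I.Holds σ)
    (hl : Linked F I.src (σ.na 9) (σ.na 10))
    (hnet : ∀ x, I.netOf (I.remaining F I.src (σ.na 9)) x =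
      (if I.s = x then (r : ℤ) + 1 else 0) - if I.t = x then (r : ℤ) + 1 else 0)
    (hu : σ.nv 8 = I.s) :
    ∃ σ' c τ i, Exec walkLoop σ σ' c ∧ c ≤ (i + 1) * 30 ∧
      I.WalkState F (σ.na 9) r (σ'.na 9) (σ'.na 10) (σ'.na 12) I.t τ i := by
  obtain ⟨σ', c, n', he, hn', hc, hi, hb⟩ := exists_exec_loop (σ₀ := σ)
    (b := .not (.neq (.reg 8) (.reg 4))) (B := 20)
    (p := .seq (.nset 11 (.sub (.cell 9 (.reg 8)) (.const 1))) <|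
      .seq (.nput 9 (.reg 8) (.cell 10 (.reg 11))) <|
      .seq (.nput 12 (.reg 8) (.reg 11)) (.nset 8 (.cell 1 (.reg 11))))
    (fun n σ' => ∃ (u : Fin I.n) (τ : Fin I.n → ℕ) (i : ℕ), σ'.nv 8 = u ∧
      n + i = (I.remaining F I.src (σ.na 9)).card ∧
      I.WalkState F (σ.na 9) r (σ'.na 9) (σ'.na 10) (σ'.na 12) u τ i)
    (by
      rintro n σ₁ ha ⟨u, τ, i, hu, hn, hw⟩ hb
      have hh := h.of_agree ha (by decide) (by decide) (by decide) (by decide)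
      have hut : u ≠ I.t := by
        rintro rfl
        simp [BExpr.holds, NExpr.eval, hu, hh.t_eq] at hb
      obtain ⟨e, hhd, hw'⟩ := hw.step hut
      have htgt := hh.tgt_eq e
      obtain ⟨σ', c, he, hc, hQ⟩ := Runs.of_wp (σ := σ₁)
        (p := .seq (.nset 11 (.sub (.cell 9 (.reg 8)) (.const 1))) <|
          .seq (.nput 9 (.reg 8) (.cell 10 (.reg 11))) <|
          .seq (.nput 12 (.reg 8) (.reg 11)) (.nset 8 (.cell 1 (.reg 11))))
        (Q := fun σ' => σ'.nv 8 = I.tgt e ∧ I.WalkState F (σ.na 9) r (σ'.na 9) (σ'.na 10)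
          (σ'.na 12) (I.tgt e) (Function.update τ u (i + 1)) (i + 1))
        (by
          simp only [Prog.wp, NExpr.eval]
          refine ⟨by simp [hu, hhd, htgt], by simpa [hu, hhd] using hw'⟩)
      have hcard := hw'.card
      refine ⟨σ', c, n - 1, he, by omega, hc.trans ?_, _, _, _, hQ.1, ?_, hQ.2⟩
      · have : n - (n - 1) = 1 := by omega
        rw [this]
        simp [Prog.bound, NExpr.cost]
      · omega)
    (I.remaining F I.src (σ.na 9)).card ⟨I.s, fun _ => 0, 0, hu, by simp, by
      refine ⟨hl, Finset.Subset.refl _, fun x => ?_, by simp, by simp, .inl rfl, by simp⟩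
      rw [hnet x]
      split_ifs <;> ring⟩
  obtain ⟨u, τ, i, hu', hn, hw⟩ := hi
  have hh := h.of_agree he.agree (by decide) (by decide) (by decide) (by decide)
  simp only [BExpr.holds, NExpr.eval, hu', hh.t_eq, not_not] at hb
  obtain rfl : u = I.t := Fin.ext (le_antisymm hb.1 hb.2)
  refine ⟨σ', c, τ, i, he, hc.trans (Nat.mul_le_mul ?_ ?_), hw⟩
  · omega
  · simp [BExpr.cost, NExpr.cost]

/-! ### Output of a path -/

/-- The state when the path `O` from `s` to `u` has been written to the output. -/
structure OutState (I : Instance) (τ : Fin I.n → ℕ) (A : Fin I.m → Prop) (i pos : ℕ)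
    (out₀ out : ℕ → ℕ) (u : Fin I.n) (O : List (Fin I.m)) : Prop where
  walk : I.IsWalk I.s u O
  edges : ∀ e ∈ O, A e ∧ I.src e ≠ I.t
  nodup : (O.map I.src).Nodup
  le : O.length ≤ i
  time : u ≠ I.t → O.length < τ u ∧ ∀ e ∈ O, τ (I.src e) < τ u
  written : ∀ (l : ℕ) (h : l < O.length), out (pos + l) = O[l]
  before : ∀ p < pos, out p = out₀ p

/-- Departure times increase strictly along the output, so `u` differs from all earlier tails. Since
they are bounded by `i`, the output is no longer than the walk. -/
theorem OutState.step {I : Instance} {τ : Fin I.n → ℕ} {A : Fin I.m → Prop} {i pos : ℕ}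
    {out₀ out : ℕ → ℕ} {u : Fin I.n} {O : List (Fin I.m)} (h : I.OutState τ A i pos out₀ out u O)
    (hle : ∀ x, τ x ≤ i) (hu : u ≠ I.t) {e : Fin I.m} (hsrc : I.src e = u) (hA : A e)
    (ht : I.tgt e = I.t ∨ τ u < τ (I.tgt e)) :
    I.OutState τ A i pos out₀ (Function.update out (pos + O.length) e) (I.tgt e) (O ++ [e]) := by
  obtain ⟨h1, h2⟩ := h.time hu
  refine ⟨isWalk_concat.2 ⟨by rw [hsrc]; exact h.walk, rfl⟩, fun e' he' => ?_, ?_, ?_,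
    fun hut => ?_, fun l hl => ?_, fun p hp => ?_⟩
  · rcases List.mem_append.1 he' with h' | h'
    · exact h.edges e' h'
    · rw [List.mem_singleton.1 h', hsrc]
      exact ⟨hA, hu⟩
  · rw [List.map_append, List.nodup_append]
    refine ⟨h.nodup, by simp, fun a ha b hb => ?_⟩
    obtain ⟨e', he', rfl⟩ := List.mem_map.1 ha
    rw [List.map_singleton, List.mem_singleton, hsrc] at hb
    rintro rfl
    have := h2 e' he'
    rw [hb] at this
    omega
  · have := hle u
    rw [List.length_append, List.length_singleton]
    omega
  · have hlt := ht.resolve_left hut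
    refine ⟨by rw [List.length_append, List.length_singleton]; omega, fun e' he' => ?_⟩
    rcases List.mem_append.1 he' with h' | h'
    · exact (h2 e' h').trans hlt
    · rw [List.mem_singleton.1 h', hsrc]
      exact hlt
  · rw [List.length_append, List.length_singleton] at hl
    rcases Nat.lt_succ_iff_lt_or_eq.1 hl with hl | rfl
    · rw [Function.update_of_ne (by omega), h.written l hl, List.getElem_append_left hl]
    · simp
  · rw [Function.update_of_ne (by omega)]
    exact h.before p hp

theorem runs_outputLoop {I : Instance} {F : Fin I.m → Prop} {hd₀ hd nxt : ℕ → ℕ} {r i : ℕ}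
    {τ : Fin I.n → ℕ} (hst : I.s ≠ I.t) {σ : Mem} (h : I.Holds σ)
    (hw : I.WalkState F hd₀ r hd nxt (σ.na 12) I.t τ i) (hu : σ.nv 8 = I.s) :
    Runs outputLoop σ ((i + 1) * 30) fun σ' => ∃ O,
      I.OutState τ (fun e => e ∈ I.remaining F I.src hd₀ ∧ e ∉ I.remaining F I.src hd) i
        (σ.nv 14) (σ.na 3) (σ'.na 3) I.t O ∧ σ'.nv 14 = σ.nv 14 + O.length := by
  have hinit : τ I.s ≠ 0 := hw.source.resolve_left hst
  have key := Runs.loop (σ₀ := σ) (b := .not (.neq (.reg 8) (.reg 4))) (B := 20)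
    (p := .seq (.nset 11 (.cell 12 (.reg 8))) <| .seq (.nput 3 (.reg 14) (.reg 11)) <|
      .seq (.nset 14 (.add (.reg 14) (.const 1))) (.nset 8 (.cell 1 (.reg 11))))
    (fun n σ' => ∃ (u : Fin I.n) (O : List (Fin I.m)), σ'.nv 8 = u ∧ n + O.length = i ∧
      I.OutState τ (fun e => e ∈ I.remaining F I.src hd₀ ∧ e ∉ I.remaining F I.src hd) i
        (σ.nv 14) (σ.na 3) (σ'.na 3) u O ∧ σ'.nv 14 = σ.nv 14 + O.length)
    (by
      rintro n σ₁ ha ⟨u, O, hu, hn, ho, hpos⟩ hb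
      have hh := h.of_agree ha (by decide) (by decide) (by decide) (by decide)
      have hut : u ≠ I.t := by
        rintro rfl
        simp [BExpr.holds, NExpr.eval, hu, hh.t_eq] at hb
      have hτ := (ho.time hut).1
      obtain ⟨e, h1, h2, h3, h4, h5⟩ := hw.last_spec u (by omega)
      have hstep := ho.step hw.le hut h2 ⟨h3, h4⟩ h5
      have htgt := hh.tgt_eq e
      have e12 : σ₁.na 12 = σ.na 12 := ha.na 12 (by decide)
      refine Runs.mono (Runs.of_wp (σ := σ₁)
        (p := .seq (.nset 11 (.cell 12 (.reg 8))) <| .seq (.nput 3 (.reg 14) (.reg 11)) <|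
          .seq (.nset 14 (.add (.reg 14) (.const 1))) (.nset 8 (.cell 1 (.reg 11))))
        (Q := fun σ' => σ'.nv 8 = I.tgt e ∧ I.OutState τ
          (fun e => e ∈ I.remaining F I.src hd₀ ∧ e ∉ I.remaining F I.src hd) i
          (σ.nv 14) (σ.na 3) (σ'.na 3) (I.tgt e) (O ++ [e]) ∧
          σ'.nv 14 = σ.nv 14 + (O ++ [e]).length) ?_) ?_ fun σ' _ hσ' => ?_
      · simp only [Prog.wp, NExpr.eval]
        refine ⟨by simp [hu, e12, h1, htgt], by simpa [hu, e12, h1, hpos] using hstep, ?_⟩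
        simp [hpos, add_assoc]
      · simp [Prog.bound, NExpr.cost]
      · have := hstep.le
        rw [List.length_append, List.length_singleton] at this
        exact ⟨n - 1, by omega, I.tgt e, O ++ [e], hσ'.1, by
          rw [List.length_append, List.length_singleton]; omega, hσ'.2⟩)
    i ⟨I.s, [], hu, by simp, ⟨rfl, by simp, by simp, by simp, fun _ => by
      simpa using Nat.pos_of_ne_zero hinit, by simp, fun _ _ => rfl⟩, by simp⟩
  refine Runs.mono key (Nat.mul_le_mul_left _ (by simp [BExpr.cost, NExpr.cost]))
    fun σ' ha hσ' => ?_
  obtain ⟨⟨n, u, O, hu, -, ho, hpos⟩, hb⟩ := hσ'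
  have hh := h.of_agree ha (by decide) (by decide) (by decide) (by decide)
  simp only [BExpr.holds, NExpr.eval, hu, hh.t_eq, not_not] at hb
  obtain rfl : u = I.t := Fin.ext (le_antisymm hb.1 hb.2)
  exact ⟨O, ho, hpos⟩

/-! ### All paths -/

/-- The state when the paths `Q 0, …, Q (j - 1)` have been written to the output, and the remaining
edges carry a flow of value `r`. -/
structure ExtractState (I : Instance) (F : Fin I.m → Prop) (hd nxt start out : ℕ → ℕ)
    (Q : ℕ → List (Fin I.m)) (j pos r : ℕ) : Prop where
  linked : Linked F I.src hd nxt
  net : ∀ x, I.netOf (I.remaining F I.src hd) x =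
    (if I.s = x then (r : ℤ) else 0) - if I.t = x then (r : ℤ) else 0
  path : ∀ i < j, I.IsWalk I.s I.t (Q i) ∧ (I.nodes I.s (Q i)).Nodup ∧
    ∀ e ∈ Q i, F e ∧ e ∉ I.remaining F I.src hd
  disjoint : ∀ i < j, ∀ i' < j, i ≠ i' → List.Disjoint (Q i) (Q i')
  start_zero : start 0 = 0
  start_succ : ∀ i < j, start (i + 1) = start i + (Q i).length
  start_le : ∀ i ≤ j, start i ≤ pos
  start_eq : start j = pos
  written : ∀ i < j, ∀ (l : ℕ) (h : l < (Q i).length), out (start i + l) = (Q i)[l]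

/-- Earlier paths use only edges that had been removed before this walk, and the new path uses only
edges removed during it; hence they are disjoint. Edges of detours are removed without being output.
-/
theorem ExtractState.step {I : Instance} {F : Fin I.m → Prop} {hd nxt start out : ℕ → ℕ}
    {Q : ℕ → List (Fin I.m)} {j pos r : ℕ}
    (h : I.ExtractState F hd nxt start out Q j pos (r + 1)) {hd' nxt' last : ℕ → ℕ}
    {τ : Fin I.n → ℕ} {i : ℕ} (hw : I.WalkState F hd r hd' nxt' last I.t τ i) {out' : ℕ → ℕ}
    {O : List (Fin I.m)}
    (ho : I.OutState τ (fun e => e ∈ I.remaining F I.src hd ∧ e ∉ I.remaining F I.src hd') i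
      pos out out' I.t O) :
    I.ExtractState F hd' nxt' (Function.update start (j + 1) (pos + O.length)) out'
      (Function.update Q j O) (j + 1) (pos + O.length) r := by
  have hQ : ∀ i < j, Function.update Q j O i = Q i := fun i hi =>
    Function.update_of_ne (by omega) _ _
  have hS : ∀ i ≤ j, Function.update start (j + 1) (pos + O.length) i = start i := fun i hi =>
    Function.update_of_ne (by omega) _ _
  have hdis : ∀ i < j, List.Disjoint (Q i) O := fun i hi e h1 h2 =>
    ((h.path i hi).2.2 e h1).2 (ho.edges e h2).1.1
  refine ⟨hw.linked, fun x => ?_, fun i' hi => ?_, fun i₁ h₁ i₂ h₂ hne => ?_, ?_, fun i' hi => ?_,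
    fun i' hi => ?_, by simp, fun i' hi l hl => ?_⟩
  · rw [hw.net x]
    split_ifs <;> ring
  · rcases Nat.lt_succ_iff_lt_or_eq.1 hi with hi | rfl
    · rw [hQ _ hi]
      obtain ⟨g1, g2, g3⟩ := h.path i' hi
      exact ⟨g1, g2, fun e he => ⟨(g3 e he).1, fun hr => (g3 e he).2 (hw.subset hr)⟩⟩
    · rw [Function.update_self]
      refine ⟨ho.walk, ?_, fun e he => ?_⟩
      · rw [ho.walk.nodes_eq, List.nodup_append]
        refine ⟨ho.nodup, by simp, fun a ha b hb => ?_⟩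
        obtain ⟨e, he, rfl⟩ := List.mem_map.1 ha
        rw [List.mem_singleton.1 hb]
        exact (ho.edges e he).2
      · exact ⟨(mem_remaining.1 (ho.edges e he).1.1).1, (ho.edges e he).1.2⟩
  · rcases Nat.lt_succ_iff_lt_or_eq.1 h₁ with h₁ | rfl <;>
      rcases Nat.lt_succ_iff_lt_or_eq.1 h₂ with h₂ | rfl
    · rw [hQ _ h₁, hQ _ h₂]
      exact h.disjoint _ h₁ _ h₂ hne
    · rw [hQ _ h₁, Function.update_self]
      exact hdis _ h₁
    · rw [hQ _ h₂, Function.update_self]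
      exact (hdis _ h₂).symm
    · exact absurd rfl hne
  · rw [hS 0 (by omega), h.start_zero]
  · rcases Nat.lt_succ_iff_lt_or_eq.1 hi with hi | rfl
    · rw [hS _ (by omega), hS _ (by omega), hQ _ hi]
      exact h.start_succ i' hi
    · rw [hS _ le_rfl, Function.update_self, Function.update_self, h.start_eq]
  · rcases Nat.lt_or_eq_of_le hi with hi | rfl
    · rw [hS _ (by omega)]
      have := h.start_le i' (by omega)
      omega
    · rw [Function.update_self]
  · rw [hS _ (by omega)]
    rcases Nat.lt_succ_iff_lt_or_eq.1 hi with hi | rfl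
    · simp only [hQ _ hi] at hl ⊢
      have h1 := h.start_succ i' hi
      have h2 := h.start_le (i' + 1) (by omega)
      rw [ho.before _ (by omega)]
      exact h.written i' hi l hl
    · simp only [Function.update_self] at hl ⊢
      rw [h.start_eq]
      exact ho.written l hl

theorem exec_pathProg {I : Instance} {F : Fin I.m → Prop} (hst : I.s ≠ I.t) {σ : Mem}
    (h : I.Holds σ) {Q : ℕ → List (Fin I.m)} {r : ℕ}
    (hx : I.ExtractState F (σ.na 9) (σ.na 10) (σ.na 2) (σ.na 3) Q (σ.nv 15) (σ.nv 14) (r + 1)) :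
    ∃ σ' c n' Q', Exec pathProg σ σ' c ∧ n' < (I.remaining F I.src (σ.na 9)).card ∧
      c ≤ ((I.remaining F I.src (σ.na 9)).card - n') * 200 ∧
      n' = (I.remaining F I.src (σ'.na 9)).card ∧ σ'.nv 15 = σ.nv 15 + 1 ∧
      I.ExtractState F (σ'.na 9) (σ'.na 10) (σ'.na 2) (σ'.na 3) Q' (σ'.nv 15) (σ'.nv 14) r := by
  obtain ⟨σ₁, c₁, x₁, hc₁, hs₁⟩ := Runs.of_wp (p := .nset 8 (.reg 3)) (σ := σ)
    (Q := fun σ' => σ' = σ.setN 8 I.s) (by simp [Prog.wp, NExpr.eval, h.s_eq])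
  have hh₁ := h.of_agree x₁.agree (by decide) (by decide) (by decide) (by decide)
  obtain ⟨σ₂, c₂, τ, i, x₂, hc₂, hw⟩ := exec_walkLoop (F := F) (r := r) hh₁
    (by simpa [hs₁] using hx.linked) (by
      intro x
      have := hx.net x
      simpa [hs₁] using this) (by simp [hs₁])
  have hh₂ := hh₁.of_agree x₂.agree (by decide) (by decide) (by decide) (by decide)
  obtain ⟨σ₃, c₃, x₃, hc₃, hs₃⟩ := Runs.of_wp (p := .nset 8 (.reg 3)) (σ := σ₂)
    (Q := fun σ' => σ' = σ₂.setN 8 I.s) (by simp [Prog.wp, NExpr.eval, hh₂.s_eq])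
  have hh₃ := hh₂.of_agree x₃.agree (by decide) (by decide) (by decide) (by decide)
  have hw₃ : I.WalkState F (σ.na 9) r (σ₂.na 9) (σ₂.na 10) (σ₃.na 12) I.t τ i := by
    simpa [hs₁, hs₃] using hw
  obtain ⟨σ₄, c₄, x₄, hc₄, O, ho, hpos⟩ := runs_outputLoop hst hh₃ hw₃ (by simp [hs₃])
  obtain ⟨σ₅, c₅, x₅, hc₅, hs₅⟩ := Runs.of_wp (σ := σ₄)
    (p := .seq (.nset 15 (.add (.reg 15) (.const 1))) (.nput 2 (.reg 15) (.reg 14)))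
    (Q := fun σ' => σ' = (σ₄.setN 15 (σ₄.nv 15 + 1)).putN 2 (σ₄.nv 15 + 1) (σ₄.nv 14))
    (by simp [Prog.wp, NExpr.eval])
  have e15 : σ₄.nv 15 = σ.nv 15 := by
    rw [x₄.agree.nv 15 (by decide), x₃.agree.nv 15 (by decide), x₂.agree.nv 15 (by decide),
      x₁.agree.nv 15 (by decide)]
  have e14 : σ₃.nv 14 = σ.nv 14 := by
    rw [x₃.agree.nv 14 (by decide), x₂.agree.nv 14 (by decide), x₁.agree.nv 14 (by decide)]
  have e2 : σ₄.na 2 = σ.na 2 := by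
    rw [x₄.agree.na 2 (by decide), x₃.agree.na 2 (by decide), x₂.agree.na 2 (by decide),
      x₁.agree.na 2 (by decide)]
  have e3 : σ₃.na 3 = σ.na 3 := by
    rw [x₃.agree.na 3 (by decide), x₂.agree.na 3 (by decide), x₁.agree.na 3 (by decide)]
  have e9 : σ₄.na 9 = σ₂.na 9 := by
    rw [x₄.agree.na 9 (by decide), x₃.agree.na 9 (by decide)]
  have e10 : σ₄.na 10 = σ₂.na 10 := by
    rw [x₄.agree.na 10 (by decide), x₃.agree.na 10 (by decide)]
  rw [e14, e3] at ho
  have hres := hx.step hw₃ ho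
  have hcard := hw₃.card
  -- Because `s ≠ t` the walk removes at least one edge, so the constant overhead can be charged to
  -- the removed edges too.
  have hi : 1 ≤ i := by
    have := hw₃.le I.s
    have := hw₃.source.resolve_left hst
    omega
  refine ⟨σ₅, _, _, Function.update Q (σ.nv 15) O, .seq x₁ (.seq x₂ (.seq x₃ (.seq x₄ x₅))), ?_, ?_,
    rfl, ?_, by simpa [hs₅, e15, hpos, e14, e2, e9, e10] using hres⟩
  · simp [hs₅, e9]
    omega
  · have : (I.remaining F I.src (σ.na 9)).card - (I.remaining F I.src (σ₅.na 9)).card = i := by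
      simp [hs₅, e9]
      omega
    rw [this]
    simp only [Prog.bound, NExpr.cost] at hc₁ hc₃ hc₅
    omega
  · simp [hs₅, e15]

/-- The value left plus the number of paths found is always `v ≥ k`, so there is a unit to extract
until `k` paths are written. The bound does not involve `k`, as each edge is removed at most once.
-/
theorem runs_extractProg {I : Instance} (hst : I.s ≠ I.t) (hm1 : 1 ≤ I.m) (hn : I.n ≤ 2 * I.m)
    {σ : Mem} (h : I.Holds σ) (hf : I.IsUnit (σ.na 6)) {v : ℕ} (hv : I.HasValue (σ.na 6) v)
    (hk : I.k ≤ v) :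
    Runs extractProg σ (1000 * I.m) fun σ' => ∃ P : Fin I.k → List (Fin I.m),
      (∀ j, I.IsWalk I.s I.t (P j) ∧ ∀ e ∈ P j, I.Tight e) ∧ I.EdgeDisjoint P ∧
      (∀ j, (I.nodes I.s (P j)).Nodup) ∧ I.Written P σ' := by
  refine Runs.mono (B := 50 * (I.n + I.m + 1) + (7 + (I.m + 1) * (200 + 4 + 1))) (Q := fun σ' =>
      ∃ P : Fin I.k → List (Fin I.m),
      (∀ j, I.IsWalk I.s I.t (P j) ∧ ∀ e ∈ P j, I.Tight e) ∧ I.EdgeDisjoint P ∧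
      (∀ j, (I.nodes I.s (P j)).Nodup) ∧ I.Written P σ') ?_ (by omega) fun _ _ h => h
  refine (runs_linkProg (act := fun e => 1 ≤ σ.na 6 e) (T := I.src) (by decide) (by decide)
    h.n_eq h.m_eq (fun e => Iff.rfl) h.src_eq).seq fun σ₁ ha₁ hlk => ?_
  have hh₁ := h.of_agree ha₁ (by decide) (by decide) (by decide) (by decide)
  refine Runs.seq (B := 7) (Q := fun σ' => σ' = ((σ₁.putN 2 0 0).setN 14 0).setN 15 0)
    (Runs.of_wp (p := .seq (.nput 2 (.const 0) (.const 0)) <|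
      .seq (.nset 14 (.const 0)) (.nset 15 (.const 0))) (by simp [Prog.wp, NExpr.eval]))
    fun σ₂ ha₂ hs₂ => ?_
  have hh₂ := hh₁.of_agree ha₂ (by decide) (by decide) (by decide) (by decide)
  set F : Fin I.m → Prop := fun e => 1 ≤ σ.na 6 e with hF
  have hR : ∀ e, e ∈ I.remaining F I.src (σ₁.na 9) ↔ F e := fun e => by
    rw [mem_remaining]
    exact ⟨fun h => h.1, fun h => ⟨h, hlk.2 e h⟩⟩
  have hinit : I.ExtractState F (σ₂.na 9) (σ₂.na 10) (σ₂.na 2) (σ₂.na 3) (fun _ => [])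
      (σ₂.nv 15) (σ₂.nv 14) v := by
    have h15 : σ₂.nv 15 = 0 := by simp [hs₂]
    have h14 : σ₂.nv 14 = 0 := by simp [hs₂]
    have h2 : σ₂.na 2 0 = 0 := by simp [hs₂]
    rw [h15, h14]
    refine ⟨by simpa [hs₂] using hlk.1, fun x => ?_, by simp, by simp, h2, by simp, ?_, h2,
      by simp⟩
    · rw [← hv x, netOf]
      congr 1
      ext e
      have h1 : σ₂.na 9 = σ₁.na 9 := by simp [hs₂]
      rw [h1]
      have h2 := hf.le_one e
      by_cases h3 : σ.na 6 e = 0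
      · rw [if_neg (by rw [hR]; simp [hF, h3]), h3]
        simp
      · have h4 : σ.na 6 e = 1 := by omega
        rw [if_pos (by rw [hR]; simp [hF, h4]), h4]
        simp
    · intro i hi
      obtain rfl : i = 0 := by omega
      omega
  have h15 : σ₂.nv 15 = 0 := by simp [hs₂]
  clear hs₂
  obtain ⟨σ', c, n', he, hn', hc, hi, hb⟩ := exists_exec_loop (σ₀ := σ₂)
    (b := .nlt (.reg 15) (.reg 5)) (B := 200) (p := pathProg)
    (fun n σ' => n = (I.remaining F I.src (σ'.na 9)).card ∧ σ'.nv 15 ≤ I.k ∧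
      ∃ Q r, r + σ'.nv 15 = v ∧ I.ExtractState F (σ'.na 9) (σ'.na 10) (σ'.na 2) (σ'.na 3) Q
        (σ'.nv 15) (σ'.nv 14) r)
    (by
      rintro n σ₃ ha₃ ⟨rfl, hj, Q, r, hr, hst₃⟩ hb
      have hh₃ := hh₂.of_agree ha₃ (by decide) (by decide) (by decide) (by decide)
      simp only [BExpr.holds, NExpr.eval, hh₃.k_eq, not_le] at hb
      obtain ⟨r, rfl⟩ : ∃ r', r = r' + 1 := ⟨r - 1, by omega⟩
      obtain ⟨σ', c, n', Q', he, h1, h2, h3, h4, h5⟩ := exec_pathProg hst hh₃ hst₃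
      exact ⟨σ', c, n', he, h1, h2, h3, by omega, Q', r, by omega, h5⟩)
    _ ⟨rfl, by omega, _, v, by omega, hinit⟩
  obtain ⟨-, hj, Q, r, -, hx⟩ := hi
  have hh := hh₂.of_agree he.agree (by decide) (by decide) (by decide) (by decide)
  simp only [BExpr.holds, NExpr.eval, hh.k_eq, not_not] at hb
  have hjk : σ'.nv 15 = I.k := le_antisymm hj hb
  rw [hjk] at hx
  refine ⟨σ', c, he, hc.trans (Nat.mul_le_mul ?_ le_rfl), fun j => Q j, fun j => ?_,
    fun i j hij => ?_, fun j => (hx.path j j.2).2.1, hx.start_zero, fun j => ?_⟩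
  · have : (I.remaining F I.src (σ₂.na 9)).card ≤ I.m := I.card_edgesWhere_le _
    omega
  · obtain ⟨h1, -, h3⟩ := hx.path j j.2
    refine ⟨h1, fun e he => hf.supp e ?_⟩
    have := (h3 e he).1
    simp only [hF] at this
    omega
  · exact hx.disjoint i i.2 j j.2 fun h => hij (Fin.ext h)
  · exact ⟨hx.start_succ j j.2, fun l => hx.written j j.2 l l.2⟩

end Instance

/-! ## The second stage -/

/-- Find `k` edge-disjoint paths of tight edges. -/
def pathsProg : Prog :=
  .seq flowProg <| .ite (.nle (.reg 5) (.reg 12)) (.seq extractProg (.nset 6 (.const 1)))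
    (.nset 6 (.const 0))

/-- The second stage of the algorithm. -/
def searchProg : Prog :=
  .ite (.and (.rle (.cell 2 (.reg 4)) (.reg 0)) (.rle (.reg 0) (.cell 2 (.reg 4)))) pathsProg
    (.nset 6 (.const 0))

namespace Instance

theorem runs_pathsProg {I : Instance} (hst : I.s ≠ I.t) (hm1 : 1 ≤ I.m) (hn : I.n ≤ 2 * I.m)
    {σ : Mem} (h : I.HoldsDist σ) :
    Runs pathsProg σ (5000 * ((min I.k (2 * (Nat.sqrt I.m + 1)) + 1) * I.m)) fun σ' =>
      (σ'.nv 6 = 1 ∧ ∃ P : Fin I.k → List (Fin I.m),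
        (∀ j, I.IsWalk I.s I.t (P j) ∧ ∀ e ∈ P j, I.Tight e) ∧ I.EdgeDisjoint P ∧
        (∀ j, (I.nodes I.s (P j)).Nodup) ∧ I.Written P σ') ∨
      (σ'.nv 6 = 0 ∧ ∃ S, I.s ∈ S ∧ I.t ∉ S ∧ I.cutCard S < I.k) := by
  set M := (min I.k (2 * (Nat.sqrt I.m + 1)) + 1) * I.m with hM
  have hM1 : I.m ≤ M := Nat.le_mul_of_pos_left _ (by omega)
  refine Runs.mono (B := 3500 * M + (4 + (1000 * I.m + 2))) (Q := fun σ' =>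
      (σ'.nv 6 = 1 ∧ ∃ P : Fin I.k → List (Fin I.m),
        (∀ j, I.IsWalk I.s I.t (P j) ∧ ∀ e ∈ P j, I.Tight e) ∧ I.EdgeDisjoint P ∧
        (∀ j, (I.nodes I.s (P j)).Nodup) ∧ I.Written P σ') ∨
      (σ'.nv 6 = 0 ∧ ∃ S, I.s ∈ S ∧ I.t ∉ S ∧ I.cutCard S < I.k)) ?_ (by omega) fun _ _ h => h
  refine (runs_flowProg hst hm1 hn h).seq fun σ₁ ha₁ ⟨hf, hv, hor⟩ => ?_
  have hh₁ := h.toHolds.of_agree ha₁ (by decide) (by decide) (by decide) (by decide)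
  refine Runs.ite (b := .nle (.reg 5) (.reg 12)) (fun hb => ?_) fun hb => ?_
  all_goals simp only [BExpr.holds, NExpr.eval, hh₁.k_eq] at hb
  · refine (runs_extractProg hst hm1 hn hh₁ hf hv hb).seq (B' := 2) fun σ₂ _ h2 => ?_
    refine Runs.of_wp (p := .nset 6 (.const 1)) ?_
    obtain ⟨P, h1, h2, h3, h4⟩ := h2
    exact .inl ⟨by simp [NExpr.eval], P, h1, h2, h3, h4⟩
  · refine Runs.mono (Runs.of_wp (p := .nset 6 (.const 0)) (Q := fun σ' => σ'.nv 6 = 0) ?_) ?_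
      fun σ' _ hσ' => .inr ⟨hσ', hor.resolve_left hb⟩
    · simp [Prog.wp, NExpr.eval]
    · simp [Prog.bound, NExpr.cost]

/-- There is a memory that holds the instance and its distances. -/
theorem exists_holdsDist (I : Instance) : ∃ σ, I.HoldsDist σ := by
  refine ⟨⟨fun i => if i = 0 then I.n else if i = 1 then I.m else if i = 2 then I.q else
      if i = 3 then I.s else if i = 4 then I.t else I.k,
    fun a i => if h : i < I.m then if a = 0 then I.src ⟨i, h⟩ else I.tgt ⟨i, h⟩ else 0,
    fun _ => ∑ i, I.dist (I.w i) I.s I.t,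
    fun a i => if a = 0 then
        if h : i / I.m < I.q ∧ i % I.m < I.m then I.w ⟨i / I.m, h.1⟩ ⟨i % I.m, h.2⟩ else 0
      else if a = 1 then if h : i < I.m then I.agg ⟨i, h⟩ else 0
      else if h : i < I.n then
        if a = 2 then I.dist I.agg I.s ⟨i, h⟩ else I.dist I.agg ⟨i, h⟩ I.t
      else 0⟩,
    ⟨rfl, rfl, rfl, rfl, rfl, rfl, fun e => ?_, fun e => ?_, fun i e => ?_⟩, fun e => ?_,
    fun v => ?_, fun v => ?_, rfl⟩
  · simp
  · simp
  · have h1 : ((i : ℕ) * I.m + e) / I.m = i := by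
      rw [mul_comm, Nat.mul_add_div e.pos, Nat.div_eq_of_lt e.2, add_zero]
    have h2 : ((i : ℕ) * I.m + e) % I.m = e := by
      rw [mul_comm, Nat.mul_add_mod, Nat.mod_eq_of_lt e.2]
    simp [h1, h2]
  · simp
  · simp
  · simp

/-- Edge-disjoint walks of tight edges correspond to flows. -/
theorem Admissible.exists_walks_iff {I : Instance} (hI : I.Admissible) :
    (∃ P : Fin I.k → List (Fin I.m),
      (∀ j, I.IsWalk I.s I.t (P j) ∧ ∀ e ∈ P j, I.Tight e) ∧ I.EdgeDisjoint P) ↔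
    ∃ f, I.IsFlow f ∧ (I.k : ℝ) ≤ I.flowValue f := by
  refine ⟨fun ⟨P, hP, hd⟩ => exists_flow_of_walks hI.s_ne_t hP hd, fun ⟨f, hf, hk⟩ => ?_⟩
  -- The algorithm is run on some memory with the right data; its negative answer would exhibit a
  -- cut too small for `f`.
  obtain ⟨σ, hσ⟩ := I.exists_holdsDist
  obtain ⟨σ', c, -, -, ⟨-, P, h1, h2, -⟩ | ⟨-, S, hs, ht, hS⟩⟩ :=
    runs_pathsProg hI.s_ne_t hI.one_le_m hI.n_le hσ
  · exact ⟨P, h1, h2⟩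
  · have := hk.trans (hf.value_le_cutCard hs ht)
    norm_cast at this
    omega

theorem runs_searchProg {I : Instance} (hI : I.Admissible) {σ : Mem} (h : I.HoldsDist σ) :
    Runs searchProg σ (5010 * ((min I.k (2 * (Nat.sqrt I.m + 1)) + 1) * I.m)) I.Answered := by
  have hm1 := hI.one_le_m
  have hM1 : I.m ≤ (min I.k (2 * (Nat.sqrt I.m + 1)) + 1) * I.m :=
    Nat.le_mul_of_pos_left _ (by omega)
  refine (Runs.ite (b := .and (.rle (.cell 2 (.reg 4)) (.reg 0)) (.rle (.reg 0) (.cell 2 (.reg 4))))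
    (B := 5000 * ((min I.k (2 * (Nat.sqrt I.m + 1)) + 1) * I.m)) (fun hb => ?_) fun hb => ?_).mono
    (by simp [BExpr.cost, NExpr.cost, RExpr.cost]; omega) fun _ _ h => h
  all_goals
    simp only [BExpr.holds, NExpr.eval, RExpr.eval, h.t_eq, h.from_eq, h.sum_eq,
      ← le_antisymm_iff] at hb
  · have hall : ∀ P, I.IsAllShortest P ↔ I.IsWalk I.s I.t P ∧ ∀ e ∈ P, I.Tight e := fun P => by
      rw [hI.isAllShortest_iff hb P]
      exact ⟨fun hP => ⟨hP.1, (hI.isShortest_iff_tight hP.1).1 hP⟩,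
        fun hP => (hI.isShortest_iff_tight hP.1).2 hP.2⟩
    refine (runs_pathsProg hI.s_ne_t hm1 hI.n_le h).imp fun σ' _ hσ' => ?_
    rcases hσ' with ⟨h6, P, h1, h2, h3, h4⟩ | ⟨h6, S, hs, ht, hS⟩
    · exact .inl ⟨h6, P, ⟨fun j => (hall _).2 (h1 j), h2⟩, h3, h4⟩
    · refine .inr ⟨h6, fun ⟨P, hP, hd⟩ => ?_⟩
      obtain ⟨f, hf, hk⟩ := hI.exists_walks_iff.1 ⟨P, fun j => (hall _).1 (hP j), hd⟩
      have := hk.trans (hf.value_le_cutCard hs ht)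
      norm_cast at this
      omega
  · refine Runs.mono (Runs.of_wp (p := .nset 6 (.const 0)) (Q := fun σ' => σ'.nv 6 = 0) ?_) ?_
      fun σ' _ hσ' => .inr ⟨hσ', fun ⟨P, hP, _⟩ => ?_⟩
    · simp [Prog.wp, NExpr.eval]
    · simp only [Prog.bound, NExpr.cost]
      omega
    -- As `k ≥ 1`, a solution contains at least one all-criteria-shortest walk, which would force
    -- the equality that the test has refuted.
    · exact hb (hI.dist_eq_sum_iff.2 ⟨_, hP ⟨0, hI.one_le_k⟩⟩)

end Instance

/-- The number of phases times the number of edges is within the claimed bound. -/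
theorem phases_mul_le {k m : ℕ} (hk : 1 ≤ k) (hm : 1 ≤ m) :
    (((min k (2 * (Nat.sqrt m + 1)) + 1) * m : ℕ) : ℝ) ≤
      5 * min ((k : ℝ) * m) ((m : ℝ) ^ (3 / 2 : ℝ)) := by
  have hm0 : (1 : ℝ) ≤ m := by exact_mod_cast hm
  have hk0 : (1 : ℝ) ≤ k := by exact_mod_cast hk
  have hpow : (m : ℝ) ^ (3 / 2 : ℝ) = √m * m := by
    rw [Real.sqrt_eq_rpow, ← Real.rpow_add_one (by positivity)]
    norm_num
  rw [mul_min_of_nonneg _ _ (by norm_num), hpow, Nat.cast_mul]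
  -- The factor `5` covers both `k + 1 ≤ 5 k` and `2 (√m + 1) + 1 ≤ 5 √m`, by `k ≥ 1` and `√m ≥ 1`.
  refine le_min ?_ ?_
  · rw [← mul_assoc]
    refine mul_le_mul_of_nonneg_right ?_ (by positivity)
    have : ((min k (2 * (Nat.sqrt m + 1)) + 1 : ℕ) : ℝ) ≤ (k + 1 : ℕ) :=
      Nat.cast_le.2 (Nat.succ_le_succ (min_le_left _ _))
    push_cast at this ⊢
    linarith
  · rw [← mul_assoc]
    refine mul_le_mul_of_nonneg_right ?_ (by positivity)
    have h1 : ((min k (2 * (Nat.sqrt m + 1)) + 1 : ℕ) : ℝ) ≤ (2 * (Nat.sqrt m + 1) + 1 : ℕ) :=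
      Nat.cast_le.2 (Nat.succ_le_succ (min_le_right _ _))
    have h2 : (Nat.sqrt m : ℝ) ≤ √m := Real.nat_sqrt_le_real_sqrt
    have h3 : (1 : ℝ) ≤ √m := Real.one_le_sqrt.2 hm0
    push_cast at h1 ⊢
    linarith

end KDisjoint

theorem mainTheorem4 :
    -- the distances, and the walks to be found
    (∀ I : KDisjoint.Instance, I.Admissible →
      -- all distances in question are attained
      (∀ v, IsLeast (I.lengths I.agg I.s v) (I.dist I.agg I.s v) ∧
        IsLeast (I.lengths I.agg v I.t) (I.dist I.agg v I.t) ∧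
        ∀ i, IsLeast (I.lengths (I.w i) I.s v) (I.dist (I.w i) I.s v) ∧
          IsLeast (I.lengths (I.w i) v I.t) (I.dist (I.w i) v I.t)) ∧
      -- reduction to the aggregated weight
      ∑ i, I.dist (I.w i) I.s I.t ≤ I.dist I.agg I.s I.t ∧
      (I.dist I.agg I.s I.t = ∑ i, I.dist (I.w i) I.s I.t ↔ ∃ P, I.IsAllShortest P) ∧
      (I.dist I.agg I.s I.t = ∑ i, I.dist (I.w i) I.s I.t →
        ∀ P, I.IsAllShortest P ↔ I.IsShortest I.agg I.s I.t P) ∧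
      -- nodes and edges on shortest walks
      (∀ u, (∃ P, I.IsShortest I.agg I.s I.t P ∧ u ∈ I.nodes I.s P) ↔
        I.dist I.agg I.s u + I.dist I.agg u I.t = I.dist I.agg I.s I.t) ∧
      (∀ e, (∃ P, I.IsShortest I.agg I.s I.t P ∧ e ∈ P) ↔ I.Tight e) ∧
      -- the shortest walks are the walks in the subgraph of tight edges
      (∀ P, I.IsWalk I.s I.t P → (I.IsShortest I.agg I.s I.t P ↔ ∀ e ∈ P, I.Tight e)) ∧
      -- disjoint walks in that subgraph and unit-capacity flows
      ((∃ P : Fin I.k → List (Fin I.m),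
          (∀ j, I.IsWalk I.s I.t (P j) ∧ ∀ e ∈ P j, I.Tight e) ∧ I.EdgeDisjoint P) ↔
        ∃ f, I.IsFlow f ∧ (I.k : ℝ) ≤ I.flowValue f)) ∧
    -- the algorithm: distance computations, followed by the search for the paths
    ∃ (distances search : KDisjoint.Prog) (C : ℝ),
      ∀ I : KDisjoint.Instance, I.Admissible →
        (∀ σ, I.Holds σ → ∃ σ' c, KDisjoint.Exec distances σ σ' c ∧ I.HoldsDist σ' ∧
          (c : ℝ) ≤ C * ((I.q + 1) * I.n * I.m)) ∧
        (∀ σ, I.HoldsDist σ → ∃ σ' c, KDisjoint.Exec search σ σ' c ∧ I.Answered σ' ∧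
          (c : ℝ) ≤ C * min ((I.k : ℝ) * I.m) ((I.m : ℝ) ^ (3 / 2 : ℝ))) := by
  refine ⟨fun I hI => ⟨fun v => ⟨hI.isLeast_from v, hI.isLeast_to v, fun i =>
    ⟨hI.isLeast_from_criterion i v, hI.isLeast_to_criterion i v⟩⟩, hI.sum_dist_le,
    hI.dist_eq_sum_iff, hI.isAllShortest_iff, hI.node_iff, hI.edge_iff,
    fun P hP => hI.isShortest_iff_tight hP, hI.exists_walks_iff⟩,
    KDisjoint.distancesProg, KDisjoint.searchProg, 5010 * 5, fun I hI => ⟨fun σ hσ => ?_,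
    fun σ hσ => ?_⟩⟩
  · obtain ⟨σ', c, he, hc, hq⟩ := KDisjoint.Instance.runs_distancesProg hI hσ
    refine ⟨σ', c, he, hq, ?_⟩
    have h1 : (c : ℝ) ≤ 3000 * ((I.q + 1) * I.n * I.m) := by exact_mod_cast hc
    have h2 : (0 : ℝ) ≤ (I.q + 1) * I.n * I.m := by positivity
    linarith
  · obtain ⟨σ', c, he, hc, hq⟩ := KDisjoint.Instance.runs_searchProg hI hσ
    refine ⟨σ', c, he, hq, ?_⟩
    have h1 : (c : ℝ) ≤
        5010 * (((min I.k (2 * (Nat.sqrt I.m + 1)) + 1) * I.m : ℕ) : ℝ) := by exact_mod_cast hc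
    have h2 := KDisjoint.phases_mul_le hI.one_le_k hI.one_le_m
    linarith
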